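/- **Theorem 3 (security of SLP-III).** *Setting.* A bilinear group generator, on input $1^\lambda$, outputs primes $q_1,q_2$ and a description of cyclic groups $\mathbb G,\mathbb G_1$ of order $n=q_1q_2$ with an admissible pairing $e:\mathbb G\times\mathbb G\to\mathbb G_1$; generation, the group operations, $e$ and uniform sampling from $\mathbb G$ are efficient. BGN key generation picks uniform $g\in\mathbb G$ and $r$ modulo $n$, puts $h=(g^r)^{q_2}$, and outputs $pk=(n,\mathbb G,\mathbb G_1,e,g,h)$ and $sk=q_1$; an integer $a$ is encrypted in $\mathbb G$ as $g^ah^r$ with uniform $r$ modulo $n$. $F$ is an efficient keyed family of permutations of the index sets $[N]$. *SLP-III.* $\mathtt{KeyGen}(1^\lambda)$ outputs $pk$ and the secret key $(sk,k)$ with $k$ uniform in $\{0,1\}^\lambda$. For a graph $G$ with vertices $1,\dots,N$ and adjacency matrix $(a_{ij})$, $\mathtt{EncMatrix}$ encrypts every $a_{ij}$ independently under $pk$ and outputs the structure $T$ that stores the $i$-th encrypted row at position $F_k(i)$; the cloud server gets $T$ together with $pk$. The trapdoor of $v$ is $\tau_v=(F_k(v),s)$ with fresh uniform $s\in\{0,1\}^\lambda$.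 To answer it, the cloud server computes the encrypted scores (inner products of rows) through the pairing, permutes them by the permutation with key $s$, masks them and the entries of the queried row by random plaintexts, and sends them to the proxy server with a garbled circuit for the index of the maximum score; the proxy server decrypts, obtains the labels of its input bits by oblivious transfer, evaluates the garbled circuit and returns the index. *Security.* In $\mathbf{Real}(\lambda)$ a stateful adversary $\mathcal A$, on input $1^\lambda$, chooses a graph $G$ with at least one vertex, receives $T$ (with $pk$), then for a polynomial number $q(\lambda)$ of rounds adaptively chooses a vertex $v_i$ and receives $\tau_{v_i}$, and finally outputs a bit. In $\mathbf{Ideal}(\lambda)$, $T$ is produced by a stateful simulator $\mathcal S$ from $1^\lambda$ and $\mathcal L_{bld}(G)$, and the $i$-th trapdoor is produced by $\mathcal S$ from the query leakages of $v_1,\dots,v_i$. The scheme is *adaptively $\mathcal L$-secure against chosen-query attacks* if for every PPT $\mathcal A$ there is a PPT $\mathcal S$ such that $|\Pr[\mathbf{Real}(\lambda)=1]-\Pr[\mathbf{Ideal}(\lambda)=1]|$ is negligible. The messages of the oblivious transfer between the cloud server and the proxy server are not part of the view of $\mathcal A$. *Claim.* If BGN encryption in $\mathbb G$ is semantically secure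 and $F$ is a pseudorandom permutation, then SLP-III is adaptively $\mathcal L$-secure against chosen-query attacks for the leakage of SLP-I, $\mathcal L_{bld}(G)=|T|=N$ and $\mathcal L_{qry}(v)=\tau_v$ (where the stateful leakage algorithm holds a secret key generated by $\mathtt{KeyGen}$). It is also adaptively secure for the smaller leakage in which $\mathcal L_{qry}$ reveals, instead of $\tau_{v_i}$, only the position of the first occurrence of $v_i$ among $v_1,\dots,v_i$. -/

import Mathlib

namespace SLP

noncomputable section

/-! ## Probabilistic polynomial time

Algorithms are programs of a small typed language over booleans, natural numbers (in binary), pairs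
and lists.  Every program halts, since loops run along a list.  Every primitive step is charged
the size of the value that it reads plus the size of the value that it writes. Loops over
lists of polynomial length, iterating for instance the step function of a Turing machine, give
every polynomial-time computation, and every primitive is computable in time polynomial in
its charge; so polynomial cost here is the usual polynomial time. -/

/-- Data types of the language. -/
inductive Ty : Type
  | unit
  | bool
  | nat
  | prod (a b : Ty)
  | list (a : Ty)

/-- The values of a data type. -/
@[reducible] def Ty.denote : Ty → Type
  | .unit => Unit
  | .bool => Bool
  | .nat => ℕ
  | .prod a b => a.denote × b.denote
  | .list a => List a.denote

/-- Length of the representation of a value (natural numbers are written in binary). -/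
def Ty.size : (a : Ty) → a.denote → ℕ
  | .unit, _ => 1
  | .bool, _ => 1
  | .nat, n => Nat.size n + 1
  | .prod a b, x => a.size x.1 + b.size x.2 + 1
  | .list a, l => (l.map fun x => a.size x + 1).sum + 1

/-- Programs with input type `σ` and output type `τ`. -/
inductive Prog : Ty → Ty → Type
  | id {σ : Ty} : Prog σ σ
  | comp {σ τ υ : Ty} (p : Prog σ τ) (q : Prog τ υ) : Prog σ υ
  | unit {σ : Ty} : Prog σ .unit
  | pair {σ τ υ : Ty} (p : Prog σ τ) (q : Prog σ υ) : Prog σ (.prod τ υ)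
  | fst {σ τ : Ty} : Prog (.prod σ τ) σ
  | snd {σ τ : Ty} : Prog (.prod σ τ) τ
  | bool {σ : Ty} (b : Bool) : Prog σ .bool
  | ite {σ τ : Ty} (c : Prog σ .bool) (p q : Prog σ τ) : Prog σ τ
  | num {σ : Ty} (n : ℕ) : Prog σ .nat
  | add : Prog (.prod .nat .nat) .nat
  | sub : Prog (.prod .nat .nat) .nat
  | mul : Prog (.prod .nat .nat) .nat
  | div : Prog (.prod .nat .nat) .nat
  | mod : Prog (.prod .nat .nat) .nat
  | le : Prog (.prod .nat .nat) .bool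
  | bits : Prog .nat (.list .bool)
  | nil {σ τ : Ty} : Prog σ (.list τ)
  | cons {τ : Ty} : Prog (.prod τ (.list τ)) (.list τ)
  | caseList {σ τ υ : Ty} (p : Prog σ τ) (q : Prog (.prod (.prod υ (.list υ)) σ) τ) :
      Prog (.prod (.list υ) σ) τ
  | fold {τ υ : Ty} (body : Prog (.prod υ τ) τ) : Prog (.prod (.list υ) τ) τ
  | rand : Prog .nat .nat

/-- A uniformly random number below `m` (and `0` if `m = 0`). -/
def unif (m : ℕ) : PMF ℕ :=
  if h : m = 0 then PMF.pure 0
  else PMF.uniformOfFinset (Finset.range m) (Finset.nonempty_range_iff.mpr h)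

/-- A uniformly random bit string of length `k`. -/
def randomBits (k : ℕ) : PMF (List Bool) :=
  (PMF.uniformOfFintype (Fin k → Bool)).map List.ofFn

/-- Run a randomised loop body along a list, adding up the costs. -/
def foldRun {α β : Type} (f : α → β → PMF (β × ℕ)) : List α → β → PMF (β × ℕ)
  | [], b => PMF.pure (b, 0)
  | a :: l, b => do
      let r ← f a b
      let r' ← foldRun f l r.1
      PMF.pure (r'.1, r.2 + r'.2)

/-- A primitive step from `x` to `y`: the output `y` and its cost. -/
def step {σ τ : Ty} (x : σ.denote) (y : τ.denote) : τ.denote × ℕ :=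
  (y, σ.size x + τ.size y)

/-- Joint distribution of the output and of the running time of a program on an input. -/
def Prog.run : {σ τ : Ty} → Prog σ τ → σ.denote → PMF (τ.denote × ℕ)
  | σ, _, .id, x => PMF.pure (step (σ := σ) (τ := σ) x x)
  | _, _, .comp p q, x => do
      let r ← p.run x
      let r' ← q.run r.1
      PMF.pure (r'.1, r.2 + r'.2)
  | σ, _, .unit, x => PMF.pure (step (σ := σ) (τ := .unit) x ())
  | _, _, .pair p q, x => do
      let r ← p.run x
      let r' ← q.run x
      PMF.pure ((r.1, r'.1), r.2 + r'.2 + 1)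
  | .prod σ τ, _, .fst, x => PMF.pure (step (σ := .prod σ τ) (τ := σ) x x.1)
  | .prod σ τ, _, .snd, x => PMF.pure (step (σ := .prod σ τ) (τ := τ) x x.2)
  | σ, _, .bool b, x => PMF.pure (step (σ := σ) (τ := .bool) x b)
  | _, _, .ite c p q, x => do
      let r ← c.run x
      let r' ← if r.1 = true then p.run x else q.run x
      PMF.pure (r'.1, r.2 + r'.2)
  | σ, _, .num n, x => PMF.pure (step (σ := σ) (τ := .nat) x n)
  | _, _, .add, x => PMF.pure (step (σ := .prod .nat .nat) (τ := .nat) x (x.1 + x.2))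
  | _, _, .sub, x => PMF.pure (step (σ := .prod .nat .nat) (τ := .nat) x (x.1 - x.2))
  | _, _, .mul, x => PMF.pure (step (σ := .prod .nat .nat) (τ := .nat) x (x.1 * x.2))
  | _, _, .div, x => PMF.pure (step (σ := .prod .nat .nat) (τ := .nat) x (x.1 / x.2))
  | _, _, .mod, x => PMF.pure (step (σ := .prod .nat .nat) (τ := .nat) x (x.1 % x.2))
  | _, _, .le, x =>
      PMF.pure (step (σ := .prod .nat .nat) (τ := .bool) x (decide (x.1 ≤ x.2)))
  | _, _, .bits, x => PMF.pure (step (σ := .nat) (τ := .list .bool) x (Nat.bits x))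
  | σ, .list τ, .nil, x => PMF.pure (step (σ := σ) (τ := .list τ) x [])
  | _, .list τ, .cons, x =>
      PMF.pure (step (σ := .prod τ (.list τ)) (τ := .list τ) x (x.1 :: x.2))
  | .prod (.list υ) σ, _, .caseList p q, x => do
      let r ← (match x.1 with
        | [] => p.run x.2
        | a :: l => q.run ((a, l), x.2))
      PMF.pure (r.1, r.2 + Ty.size (.prod (.list υ) σ) x)
  | .prod (.list υ) τ, _, .fold body, x => do
      let r ← foldRun (fun a b => body.run (a, b)) x.1 x.2
      PMF.pure (r.1, r.2 + Ty.size (.prod (.list υ) τ) x)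
  | _, _, .rand, x => (unif x).map fun y => step (σ := .nat) (τ := .nat) x y

/-- Output distribution of a program. -/
def Prog.eval {σ τ : Ty} (p : Prog σ τ) (x : σ.denote) : PMF τ.denote :=
  (p.run x).map Prod.fst

/-- On input `x` the program takes at most `t` steps, whatever its random choices. -/
def Prog.RunsWithin {σ τ : Ty} (p : Prog σ τ) (x : σ.denote) (t : ℕ) : Prop :=
  ∀ r ∈ (p.run x).support, r.2 ≤ t

/-- The program is PPT: its running time is polynomial in the size of its input. -/
def Prog.IsPPT {σ τ : Ty} (p : Prog σ τ) : Prop :=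
  ∃ P : Polynomial ℕ, ∀ x : σ.denote, p.RunsWithin x (P.eval (σ.size x))

/-- The string `1^k`. -/
def unary (k : ℕ) : (Ty.list .unit).denote := List.replicate k ()

/-- Negligible functions of the security parameter. -/
def Negligible (f : ℕ → ℝ) : Prop :=
  Asymptotics.SuperpolynomialDecay Filter.atTop (fun k : ℕ => (k : ℝ)) f

/-- Probability that a randomised bit is `1`. -/
def prTrue (p : PMF Bool) : ℝ := (p true).toReal

/-- Independent samples from finitely many distributions. -/
def independent {α : Type} : {k : ℕ} → (Fin k → PMF α) → PMF (Fin k → α)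
  | 0, _ => PMF.pure Fin.elim0
  | _ + 1, p => do
      let a ← p 0
      let t ← independent fun i => p i.succ
      PMF.pure (Fin.cons a t)

/-- `q` rounds of interaction.  In every round the party sees its state and all answers so far,
and sends a message; the environment replies. Result: final state of the party and all answers. -/
def interact {σ ρ A B : Type} (party : σ → List A → PMF (B × σ)) (env : ρ → B → PMF (A × ρ)) :
    ℕ → σ → ρ → List A → PMF (σ × List A)
  | 0, s, _, l => PMF.pure (s, l)
  | q + 1, s, r, l => do
      let m ← party s l
      let a ← env r m.1
      interact party env q m.2 a.2 (l ++ [a.1])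

/-- The states in which a stateful party can be after receiving a list of answers, whatever
these answers are. -/
inductive Reaches {σ A B : Type} (start : σ → Prop) (party : σ → List A → PMF (B × σ)) :
    List A → σ → Prop
  | start {s : σ} (h : start s) : Reaches start party [] s
  | step {l : List A} {s : σ} {m : B × σ} (h : Reaches start party l s)
      (hm : m ∈ (party s l).support) (a : A) : Reaches start party (l ++ [a]) m.2

/-! ## Bilinear groups and the BGN encryption scheme -/

/-- A generator of bilinear groups of order `n = q₁ q₂`: on input `1^k` it outputs two primes and
a description `d` of cyclic groups `G d`, `G₁ d` of order `q₁ q₂` with an admissible pairing.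
Group elements are represented (uniquely) by values of type `Elt`, `Elt₁`; the group operations,
the pairing and uniform sampling from `G d` are efficient. -/
structure BilinearGroupGen where
  Desc : Ty
  Elt : Ty
  Elt₁ : Ty
  gen : Prog (.list .unit) (.prod (.prod .nat .nat) Desc)
  G : Desc.denote → Type
  G₁ : Desc.denote → Type
  [commGroup : ∀ d, CommGroup (G d)]
  [commGroup₁ : ∀ d, CommGroup (G₁ d)]
  [fintype : ∀ d, Fintype (G d)]
  [fintype₁ : ∀ d, Fintype (G₁ d)]
  code : ∀ d, G d → Elt.denote
  code₁ : ∀ d, G₁ d → Elt₁.denote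
  code_injective : ∀ d, Function.Injective (code d)
  code₁_injective : ∀ d, Function.Injective (code₁ d)
  e : ∀ d, G d →* G d →* G₁ d
  sample : Prog Desc Elt
  mul : Prog (.prod Desc (.prod Elt Elt)) Elt
  mul₁ : Prog (.prod Desc (.prod Elt₁ Elt₁)) Elt₁
  pairing : Prog (.prod Desc (.prod Elt Elt)) Elt₁
  gen_ppt : gen.IsPPT
  sample_ppt : sample.IsPPT
  mul_ppt : mul.IsPPT
  mul₁_ppt : mul₁.IsPPT
  pairing_ppt : pairing.IsPPT
  prime_left : ∀ k, ∀ o ∈ (gen.eval (unary k)).support, o.1.1.Prime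
  prime_right : ∀ k, ∀ o ∈ (gen.eval (unary k)).support, o.1.2.Prime
  cyclic : ∀ k, ∀ o ∈ (gen.eval (unary k)).support, IsCyclic (G o.2)
  cyclic₁ : ∀ k, ∀ o ∈ (gen.eval (unary k)).support, IsCyclic (G₁ o.2)
  card : ∀ k, ∀ o ∈ (gen.eval (unary k)).support, Nat.card (G o.2) = o.1.1 * o.1.2
  card₁ : ∀ k, ∀ o ∈ (gen.eval (unary k)).support, Nat.card (G₁ o.2) = o.1.1 * o.1.2
  nondegenerate : ∀ k, ∀ o ∈ (gen.eval (unary k)).support, ∀ g : G o.2,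
    (∀ x, x ∈ Subgroup.zpowers g) → e o.2 g g ≠ 1
  sample_spec : ∀ k, ∀ o ∈ (gen.eval (unary k)).support,
    sample.eval o.2 = (PMF.uniformOfFintype (G o.2)).map (code o.2)
  mul_spec : ∀ k, ∀ o ∈ (gen.eval (unary k)).support, ∀ x y : G o.2,
    mul.eval (o.2, (code o.2 x, code o.2 y)) = PMF.pure (code o.2 (x * y))
  mul₁_spec : ∀ k, ∀ o ∈ (gen.eval (unary k)).support, ∀ x y : G₁ o.2,
    mul₁.eval (o.2, (code₁ o.2 x, code₁ o.2 y)) = PMF.pure (code₁ o.2 (x * y))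
  pairing_spec : ∀ k, ∀ o ∈ (gen.eval (unary k)).support, ∀ x y : G o.2,
    pairing.eval (o.2, (code o.2 x, code o.2 y)) = PMF.pure (code₁ o.2 (e o.2 x y))

attribute [instance] BilinearGroupGen.commGroup BilinearGroupGen.commGroup₁
  BilinearGroupGen.fintype BilinearGroupGen.fintype₁

namespace BGN

/-- Public key `(n, 𝔾, 𝔾₁, e, g, h)`; the groups and the pairing are given by the description. -/
structure PublicKey (𝒢 : BilinearGroupGen) where
  n : ℕ
  d : 𝒢.Desc.denote
  g : 𝒢.G d
  h : 𝒢.G d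

/-- Data type of public keys. -/
abbrev KeyTy (𝒢 : BilinearGroupGen) : Ty := .prod .nat (.prod 𝒢.Desc (.prod 𝒢.Elt 𝒢.Elt))

variable {𝒢 : BilinearGroupGen}

/-- Representation of a public key. -/
def PublicKey.toData (pk : PublicKey 𝒢) : (KeyTy 𝒢).denote :=
  (pk.n, (pk.d, (𝒢.code pk.d pk.g, 𝒢.code pk.d pk.h)))

/-- Key generation: the public key and the secret key `q₁`. -/
def keyGen (𝒢 : BilinearGroupGen) (k : ℕ) : PMF (PublicKey 𝒢 × ℕ) := do
  let o ← 𝒢.gen.eval (unary k)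
  let g ← PMF.uniformOfFintype (𝒢.G o.2)
  let r ← unif (o.1.1 * o.1.2)
  let u := g ^ r
  PMF.pure ({ n := o.1.1 * o.1.2, d := o.2, g := g, h := u ^ o.1.2 }, o.1.1)

/-- Encryption in `𝔾`. -/
def encrypt (pk : PublicKey 𝒢) (a : ℕ) : PMF (𝒢.G pk.d) := do
  let r ← unif pk.n
  PMF.pure (pk.g ^ a * pk.h ^ r)

/-- Least discrete logarithm of `c` to the base `b`. -/
def dlog {M : Type} [Monoid M] (b c : M) : ℕ := sInf {s : ℕ | b ^ s = c}

/-- Decryption in `𝔾`. -/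
def decrypt (pk : PublicKey 𝒢) (sk : ℕ) (c : 𝒢.G pk.d) : ℕ := dlog (pk.g ^ sk) (c ^ sk)

/-- Decryption in `𝔾₁`. -/
def decrypt₁ (pk : PublicKey 𝒢) (sk : ℕ) (c : 𝒢.G₁ pk.d) : ℕ :=
  dlog (𝒢.e pk.d pk.g pk.g ^ sk) (c ^ sk)

/-- An adversary against semantic security: given the public key it chooses two messages, and
given an encryption of one of them it outputs a bit. -/
structure Adversary (𝒢 : BilinearGroupGen) where
  St : Ty
  choose : Prog (.prod (.list .unit) (KeyTy 𝒢)) (.prod (.prod .nat .nat) St)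
  guess : Prog (.prod St 𝒢.Elt) .bool

/-- The adversary runs in time polynomial in the security parameter, for all keys that may be
generated, all random choices and all challenge ciphertexts. -/
def Adversary.IsPPT (B : Adversary 𝒢) : Prop :=
  ∃ P : Polynomial ℕ, ∀ k : ℕ, ∀ ks ∈ (keyGen 𝒢 k).support,
    B.choose.RunsWithin (unary k, ks.1.toData) (P.eval k) ∧
    ∀ o ∈ (B.choose.eval (unary k, ks.1.toData)).support, ∀ c : 𝒢.G ks.1.d,
      B.guess.RunsWithin (o.2, 𝒢.code ks.1.d c) (P.eval k)

/-- The semantic security experiment, in which message number `b` is encrypted. -/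
def experiment (B : Adversary 𝒢) (b : Bool) (k : ℕ) : PMF Bool := do
  let ks ← keyGen 𝒢 k
  let o ← B.choose.eval (unary k, ks.1.toData)
  let c ← encrypt ks.1 (if b = true then o.1.2 else o.1.1)
  B.guess.eval (o.2, 𝒢.code ks.1.d c)

/-- Semantic security of BGN (indistinguishability under chosen-plaintext attacks). -/
def SemanticallySecure (𝒢 : BilinearGroupGen) : Prop :=
  ∀ B : Adversary 𝒢, B.IsPPT →
    Negligible fun k => |prTrue (experiment B true k) - prTrue (experiment B false k)|

end BGN

/-! ## Pseudorandom permutations -/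

/-- An efficiently computable keyed family of permutations of the index sets `{0, …, N - 1}`. -/
structure KeyedPerm where
  perm : List Bool → (N : ℕ) → Equiv.Perm (Fin N)
  prog : Prog (.prod (.list .bool) (.prod .nat .nat)) .nat
  prog_ppt : prog.IsPPT
  prog_spec : ∀ (key : List Bool) (N : ℕ) (x : Fin N),
    prog.eval (key, (N, x.val)) = PMF.pure ((perm key N x).val)

namespace PRP

/-- A distinguisher: it chooses the (polynomial) size of the index set, makes `q` adaptive
oracle queries and outputs a bit. -/
structure Distinguisher where
  St : Ty
  q : Polynomial ℕ
  start : Prog (.list .unit) (.prod (.list .unit) St)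
  query : Prog (.prod St (.list .nat)) (.prod .nat St)
  guess : Prog (.prod St (.list .nat)) .bool

/-- States of the distinguisher after some list of answers. -/
def Distinguisher.Reaches (D : Distinguisher) (k : ℕ) : List ℕ → D.St.denote → Prop :=
  SLP.Reaches (fun s => ∃ o ∈ (D.start.eval (unary k)).support, s = o.2)
    (fun s l => D.query.eval (s, l))

/-- Time polynomial in the security parameter and the length of the messages received. -/
def Distinguisher.IsPPT (D : Distinguisher) : Prop :=
  ∃ P : Polynomial ℕ, ∀ k : ℕ, D.start.RunsWithin (unary k) (P.eval k) ∧
    ∀ l s, D.Reaches k l s →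
      (l.length < D.q.eval k →
        D.query.RunsWithin (s, l) (P.eval (k + Ty.size (.list .nat) l))) ∧
      (l.length = D.q.eval k →
        D.guess.RunsWithin (s, l) (P.eval (k + Ty.size (.list .nat) l)))

/-- Oracle answer of a permutation (`0` for a query outside of the domain). -/
def answer {N : ℕ} (f : Equiv.Perm (Fin N)) (x : ℕ) : ℕ :=
  if h : x < N then (f ⟨x, h⟩).val else 0

/-- Interaction with an oracle drawn from the distribution `oracle N`. -/
def experiment (oracle : (N : ℕ) → PMF (Equiv.Perm (Fin N))) (D : Distinguisher) (k : ℕ) :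
    PMF Bool := do
  let o ← D.start.eval (unary k)
  let f ← oracle o.1.length
  let t ← interact (fun (s : D.St.denote) (l : List ℕ) => D.query.eval (s, l))
    (fun (_ : Unit) (x : ℕ) => PMF.pure (answer f x, ())) (D.q.eval k) o.2 () []
  D.guess.eval (t.1, t.2)

end PRP

/-- `F` is a pseudorandom permutation: under a random key of `k` bits it is indistinguishable from
a uniformly random permutation. -/
def KeyedPerm.IsPRP (F : KeyedPerm) : Prop :=
  ∀ D : PRP.Distinguisher, D.IsPPT → Negligible fun k =>
    |prTrue (PRP.experiment (fun N => (randomBits k).map fun key => F.perm key N) D k)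
      - prTrue (PRP.experiment (fun N => PMF.uniformOfFintype (Equiv.Perm (Fin N))) D k)|

/-! ## Secure link prediction schemes and their security -/

/-- The algorithms of a secure link prediction scheme (each of them also gets the security
parameter). `TTy` and `TauTy` are the data types of what the cloud server receives.
`PSK` is the part of the secret key that is shared with the proxy server, `Response` is what the
cloud server provides to the proxy server. -/
structure Scheme where
  PK : Type
  SK : Type
  PSK : Type
  T : Type
  Response : Type
  TTy : Ty
  TauTy : Ty
  dataT : T → TTy.denote
  share : SK → PSK
  keyGen : ℕ → PMF (PK × SK)
  encMatrix : ℕ → {N : ℕ} → SimpleGraph (Fin N) → SK → PK → PMF T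
  trapdoorGen : ℕ → {N : ℕ} → Fin N → SK → PMF TauTy.denote
  lpQuery : ℕ → TauTy.denote → T → PMF Response
  findMaxVertex : ℕ → PK → PSK → Response → PMF ℕ

/-- Data type of graphs: a nonempty list of rows of an adjacency matrix (first row, other rows). -/
abbrev GraphTy : Ty := .prod (.list .bool) (.list (.list .bool))

/-- Number of vertices. -/
def numVertices (M : GraphTy.denote) : ℕ := M.2.length + 1

/-- The graph given by a matrix (symmetrised, without loops). -/
def toGraph (M : GraphTy.denote) : SimpleGraph (Fin (numVertices M)) :=
  SimpleGraph.fromRel fun i j => ((M.1 :: M.2).getD i.val []).getD j.val false = true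

/-- The vertex with a given number (numbers are taken modulo the number of vertices). -/
def toVertex (M : GraphTy.denote) (v : ℕ) : Fin (numVertices M) :=
  ⟨v % numVertices M, Nat.mod_lt _ (Nat.succ_pos _)⟩

/-- A stateful chosen-query adversary: `start` is `𝒜₀`, `query` is `𝒜₁, …, 𝒜_q` (the index is the
number of trapdoors received so far, plus one) and `guess` is `𝒜_{q+1}`. -/
structure Adversary (TTy TauTy : Ty) where
  St : Ty
  q : Polynomial ℕ
  start : Prog (.list .unit) (.prod GraphTy St)
  query : Prog (.prod St (.prod TTy (.list TauTy))) (.prod .nat St)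
  guess : Prog (.prod St (.prod TTy (.list TauTy))) .bool

/-- States of the adversary after receiving `T` and some list of trapdoors. -/
def Adversary.Reaches {TTy TauTy : Ty} (A : Adversary TTy TauTy) (k : ℕ) (T : TTy.denote) :
    List TauTy.denote → A.St.denote → Prop :=
  SLP.Reaches (fun s => ∃ o ∈ (A.start.eval (unary k)).support, s = o.2)
    (fun s l => A.query.eval (s, (T, l)))

/-- Time polynomial in the security parameter and the length of the messages received. -/
def Adversary.IsPPT {TTy TauTy : Ty} (A : Adversary TTy TauTy) : Prop :=
  ∃ P : Polynomial ℕ, ∀ k : ℕ, A.start.RunsWithin (unary k) (P.eval k) ∧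
    ∀ T l s, A.Reaches k T l s →
      (l.length < A.q.eval k → A.query.RunsWithin (s, (T, l))
        (P.eval (k + Ty.size (.prod TTy (.list TauTy)) (T, l)))) ∧
      (l.length = A.q.eval k → A.guess.RunsWithin (s, (T, l))
        (P.eval (k + Ty.size (.prod TTy (.list TauTy)) (T, l))))

/-- A stateful leakage algorithm. -/
structure Leakage where
  BldTy : Ty
  QryTy : Ty
  State : Type
  bld : ℕ → {N : ℕ} → SimpleGraph (Fin N) → PMF (BldTy.denote × State)
  qry : ℕ → {N : ℕ} → Fin N → State → PMF (QryTy.denote × State)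

/-- A stateful simulator: `start` is `𝒮₀`, `next` is `𝒮₁, …, 𝒮_q`, which gets all query leakages up
to and including that of the current query. -/
structure Simulator (TTy TauTy BldTy QryTy : Ty) where
  St : Ty
  start : Prog (.prod (.list .unit) BldTy) (.prod TTy St)
  next : Prog (.prod St (.list QryTy)) (.prod TauTy St)

/-- States of the simulator after some list of query leakages. -/
inductive Simulator.Reaches {TTy TauTy BldTy QryTy : Ty} (S : Simulator TTy TauTy BldTy QryTy)
    (k : ℕ) (b : BldTy.denote) : List QryTy.denote → S.St.denote → Prop
  | start {o : TTy.denote × S.St.denote} (h : o ∈ (S.start.eval (unary k, b)).support) :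
      Simulator.Reaches S k b [] o.2
  | step {l : List QryTy.denote} {s : S.St.denote} {a : QryTy.denote}
      {o : TauTy.denote × S.St.denote} (h : Simulator.Reaches S k b l s)
      (ho : o ∈ (S.next.eval (s, l ++ [a])).support) : Simulator.Reaches S k b (l ++ [a]) o.2

/-- Time polynomial in the security parameter and the length of the leakages received. -/
def Simulator.IsPPT {TTy TauTy BldTy QryTy : Ty} (S : Simulator TTy TauTy BldTy QryTy) : Prop :=
  ∃ P : Polynomial ℕ, ∀ (k : ℕ) (b : BldTy.denote),
    S.start.RunsWithin (unary k, b) (P.eval (k + BldTy.size b)) ∧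
    ∀ l s, S.Reaches k b l s → ∀ a, S.next.RunsWithin (s, l ++ [a])
      (P.eval (k + BldTy.size b + Ty.size (.list QryTy) (l ++ [a])))

/-- The game `Real`. -/
def real (Sch : Scheme) (A : Adversary Sch.TTy Sch.TauTy) (k : ℕ) : PMF Bool := do
  let ks ← Sch.keyGen k
  let o ← A.start.eval (unary k)
  let T ← Sch.encMatrix k (toGraph o.1) ks.2 ks.1
  let t ← interact
    (fun (s : A.St.denote) (l : List Sch.TauTy.denote) => A.query.eval (s, (Sch.dataT T, l)))
    (fun (_ : Unit) (v : ℕ) =>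
      (Sch.trapdoorGen k (toVertex o.1 v) ks.2).map fun τ => (τ, ()))
    (A.q.eval k) o.2 () []
  A.guess.eval (t.1, (Sch.dataT T, t.2))

/-- The game `Ideal`. The environment keeps the states of the simulator and of the leakage
algorithm and the list of query leakages. -/
def ideal (Sch : Scheme) (L : Leakage) (A : Adversary Sch.TTy Sch.TauTy)
    (S : Simulator Sch.TTy Sch.TauTy L.BldTy L.QryTy) (k : ℕ) : PMF Bool := do
  let o ← A.start.eval (unary k)
  let b ← L.bld k (toGraph o.1)
  let T ← S.start.eval (unary k, b.1)
  let t ← interact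
    (fun (s : A.St.denote) (l : List Sch.TauTy.denote) => A.query.eval (s, (T.1, l)))
    (fun (w : (S.St.denote × L.State) × List L.QryTy.denote) (v : ℕ) => do
      let a ← L.qry k (toVertex o.1 v) w.1.2
      let τ ← S.next.eval (w.1.1, w.2 ++ [a.1])
      PMF.pure (τ.1, ((τ.2, a.2), w.2 ++ [a.1])))
    (A.q.eval k) o.2 ((T.2, b.2), []) []
  A.guess.eval (t.1, (T.1, t.2))

/-- Adaptive semantic `L`-security against chosen-query attacks. -/
def Scheme.AdaptivelySecure (Sch : Scheme) (L : Leakage) : Prop :=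
  ∀ A : Adversary Sch.TTy Sch.TauTy, A.IsPPT →
    ∃ S : Simulator Sch.TTy Sch.TauTy L.BldTy L.QryTy, S.IsPPT ∧
      Negligible fun k => |prTrue (real Sch A k) - prTrue (ideal Sch L A S k)|

/-- The leakage `ℒ_bld(G) = |V|` (the number of entries of `T`) and `ℒ_qry(v) = τ_v`. The leakage
algorithm holds the secret key under which the trapdoors are formed. -/
def trapdoorLeakage (Sch : Scheme) : Leakage where
  BldTy := .list .unit
  QryTy := Sch.TauTy
  State := Sch.SK
  bld k N _ := (Sch.keyGen k).map fun ks => (unary N, ks.2)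
  qry k _ v sk := (Sch.trapdoorGen k v sk).map fun τ => (τ, sk)

/-- The leakage `|V|` and, for each query, only whether and when the same vertex was queried
before: the position of its first occurrence in the list of queries. -/
def repetitionLeakage : Leakage where
  BldTy := .list .unit
  QryTy := .nat
  State := List ℕ
  bld _ N _ := PMF.pure (unary N, [])
  qry _ _ v l := PMF.pure ((l ++ [v.val]).idxOf v.val, l ++ [v.val])

/-! ## Boolean circuits and garbling (point-and-permute with free XOR) -/

/-- Gates; the arguments are wire numbers. -/
inductive Gate : Type
  | xor (a b : ℕ)
  | and (a b : ℕ)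
  | not (a : ℕ)

/-- Wires are numbered: first the inputs, then one wire per gate, in order. -/
structure Circuit where
  inputs : ℕ
  gates : List Gate
  outputs : List ℕ

/-- A wire label: a `k`-bit key and a permutation bit. -/
abbrev Label (k : ℕ) : Type := (Fin k → Bool) × Bool

/-- The zero label. -/
def zeroLabel (k : ℕ) : Label k := (fun _ => false, false)

/-- Bitwise exclusive or. -/
def Label.add {k : ℕ} (a b : Label k) : Label k :=
  (fun i => Bool.xor (a.1 i) (b.1 i), Bool.xor a.2 b.2)

/-- The label for the bit `v` of a wire with zero-label `w`, for the global offset `R`. -/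
def Label.forBit {k : ℕ} (R w : Label k) (v : Bool) : Label k := if v = true then w.add R else w

/-- A hash function that encrypts table entries: two keys and a gate number give a label. -/
abbrev GarblingHash : Type := (k : ℕ) → (Fin k → Bool) → (Fin k → Bool) → ℕ → Label k

/-- A garbled circuit: the table of every gate (used for `and` gates only), indexed by permutation
bits, and the bits that decode the output labels. -/
structure Garbled (k : ℕ) where
  circuit : Circuit
  tables : List (Bool → Bool → Label k)
  decode : List Bool

/-- Garble one gate with output wire number `i`, given the zero-labels of the earlier wires. -/
def garbleGate (H : GarblingHash) {k : ℕ} (R : Label k) (ws : List (Label k)) (i : ℕ) :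
    Gate → PMF (Label k × (Bool → Bool → Label k))
  | .xor a b => PMF.pure
      ((ws.getD a (zeroLabel k)).add (ws.getD b (zeroLabel k)), fun _ _ => zeroLabel k)
  | .not a => PMF.pure ((ws.getD a (zeroLabel k)).add R, fun _ _ => zeroLabel k)
  | .and a b => do
      let w ← PMF.uniformOfFintype (Label k)
      let wa := ws.getD a (zeroLabel k)
      let wb := ws.getD b (zeroLabel k)
      PMF.pure (w, fun pa pb =>
        let va := Bool.xor pa wa.2
        let vb := Bool.xor pb wb.2
        (H k (wa.forBit R va).1 (wb.forBit R vb).1 i).add (Label.forBit R w (va && vb)))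

/-- Garble a list of gates; returns the zero-labels of all wires and the tables. -/
def garbleGates (H : GarblingHash) {k : ℕ} (R : Label k) :
    List Gate → List (Label k) → PMF (List (Label k) × List (Bool → Bool → Label k))
  | [], ws => PMF.pure (ws, [])
  | g :: gs, ws => do
      let o ← garbleGate H R ws ws.length g
      let rest ← garbleGates H R gs (ws ++ [o.1])
      PMF.pure (rest.1, o.2 :: rest.2)

/-- Garble a circuit; returns the garbled circuit and the two labels of every input wire. -/
def garble (H : GarblingHash) (k : ℕ) (C : Circuit) :
    PMF (Garbled k × List (Label k × Label k)) := do
  let K ← PMF.uniformOfFintype (Fin k → Bool)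
  let R : Label k := (K, true)
  let ins ← independent fun _ : Fin C.inputs => PMF.uniformOfFintype (Label k)
  let o ← garbleGates H R C.gates (List.ofFn ins)
  PMF.pure ({ circuit := C, tables := o.2,
              decode := C.outputs.map fun w => (o.1.getD w (zeroLabel k)).2 },
    List.ofFn fun i => (ins i, (ins i).add R))

/-- Active labels of all wires, from those of the inputs. -/
def evalLabels (H : GarblingHash) {k : ℕ} :
    List (Gate × (Bool → Bool → Label k)) → List (Label k) → List (Label k)
  | [], ws => ws
  | (g, t) :: gs, ws =>
      evalLabels H gs (ws ++ [match g with
        | .xor a b => (ws.getD a (zeroLabel k)).add (ws.getD b (zeroLabel k))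
        | .not a => ws.getD a (zeroLabel k)
        | .and a b =>
            let wa := ws.getD a (zeroLabel k)
            let wb := ws.getD b (zeroLabel k)
            (t wa.2 wb.2).add (H k wa.1 wb.1 ws.length)])

/-- Evaluate a garbled circuit on labels of the inputs. -/
def Garbled.evaluate (H : GarblingHash) {k : ℕ} (Γ : Garbled k) (ins : List (Label k)) :
    List Bool :=
  let ws := evalLabels H (Γ.circuit.gates.zip Γ.tables) ins
  (Γ.circuit.outputs.zip Γ.decode).map fun p => Bool.xor (ws.getD p.1 (zeroLabel k)).2 p.2

/-! ## The maximum circuit -/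

end

/-- Circuit construction: the gates emitted so far. -/
abbrev Build (α : Type) : Type := StateM (List Gate) α

/-- Emit a gate in a circuit with `m` inputs and return its output wire. -/
def emit (m : ℕ) (g : Gate) : Build ℕ := do
  let gs ← get
  set (gs ++ [g])
  return m + gs.length

/-- Subtraction modulo `2 ^ l` of little-endian numbers, with incoming borrow `b`; returns the
difference and the outgoing borrow. -/
def subBlock (m : ℕ) : List ℕ → List ℕ → ℕ → Build (List ℕ × ℕ)
  | x :: xs, y :: ys, b => do
      let xy ← emit m (.xor x y)
      let d ← emit m (.xor xy b)
      let nx ← emit m (.not x)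
      let s ← emit m (.xor nx b)
      let t ← emit m (.xor y b)
      let u ← emit m (.and s t)
      let b' ← emit m (.xor b u)
      let r ← subBlock m xs ys b'
      return (d :: r.1, r.2)
  | _, _, b => return ([], b)

/-- The multiplexer: the second list if the control wire `c` carries `1`, else the first. -/
def muxBlock (m : ℕ) (c : ℕ) (xs ys : List ℕ) : Build (List ℕ) :=
  (xs.zip ys).mapM fun p => do
    let d ← emit m (.xor p.1 p.2)
    let e ← emit m (.and c d)
    emit m (.xor p.1 e)

/-- The block `NSS`: the score `s̄ - r` if the bits `a` and `r''` agree, else `0`. -/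
def nssBlock (m z0 : ℕ) (s r : List ℕ) (a r'' : ℕ) : Build (List ℕ) := do
  let d ← subBlock m s r z0
  let ne ← emit m (.xor a r'')
  let eq ← emit m (.not ne)
  d.1.mapM fun w => emit m (.and w eq)

/-- The block `Max` on two pairs (score, index): the one with the larger score. -/
def maxBlock (m z0 : ℕ) (p q : List ℕ × List ℕ) : Build (List ℕ × List ℕ) := do
  let lt ← subBlock m p.1 q.1 z0
  let s ← muxBlock m lt.2 p.1 q.1
  let i ← muxBlock m lt.2 p.2 q.2
  return (s, i)

/-- One layer of `Max` blocks. -/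
def maxLayer (m z0 : ℕ) : List (List ℕ × List ℕ) → Build (List (List ℕ × List ℕ))
  | p :: q :: rest => do
      let r ← maxBlock m z0 p q
      let rs ← maxLayer m z0 rest
      return r :: rs
  | l => return l

/-- Several layers of `Max` blocks. -/
def maxLayers (m z0 : ℕ) : ℕ → List (List ℕ × List ℕ) → Build (List (List ℕ × List ℕ))
  | 0, l => return l
  | t + 1, l => do maxLayers m z0 t (← maxLayer m z0 l)

/-- The first `l` bits of `x`, little-endian. -/
def lowBits (l x : ℕ) : List Bool := (List.range l).map fun i => x.testBit i

/-- The number with the given little-endian bits. -/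
def ofBits : List Bool → ℕ
  | [] => 0
  | b :: bs => (if b = true then 1 else 0) + 2 * ofBits bs

/-- The maximum circuit for `N` scores of `l = ⌈log₂ N⌉` bits. The inputs are, for every `i`, the
bits of `s̄ᵢ` and the bit `aᵢ` (proxy server), then, for every `i`, the bits of `rᵢ` and the bit
`rᵢ''` (cloud server). The output is the index of a vertex with maximum score. -/
def maxCircuit (N : ℕ) : Circuit :=
  let l := Nat.clog 2 N
  let m := 2 * (N * (l + 1))
  let build : Build (List ℕ) := do
    let z0 ← emit m (.xor 0 0)
    let o1 ← emit m (.not z0)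
    let scores ← (List.range N).mapM fun i => do
      let p := i * (l + 1)
      let c := N * (l + 1) + i * (l + 1)
      let s ← nssBlock m z0 ((List.range l).map (p + ·)) ((List.range l).map (c + ·))
        (p + l) (c + l)
      return (s, (lowBits l i).map fun b => if b = true then o1 else z0)
    let top ← maxLayers m z0 l scores
    return (top.headD ([], [])).2
  let r := build.run []
  { inputs := m, gates := r.2, outputs := r.1 }

/-! ## The scheme `SLP-III` -/

noncomputable section

namespace SLPIII

/-- The structure `T` held by the cloud server: the encrypted rows, stored at permuted positions.
It comes with the public key, which the cloud server needs to compute on it. -/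
structure Table (𝒢 : BilinearGroupGen) where
  pk : BGN.PublicKey 𝒢
  N : ℕ
  rows : Fin N → Fin N → 𝒢.G pk.d

/-- The entry of `T` at a position (and `1` outside of the table). -/
def Table.entry {𝒢 : BilinearGroupGen} (T : Table 𝒢) (i j : ℕ) : 𝒢.G T.pk.d :=
  if h : i < T.N ∧ j < T.N then T.rows ⟨i, h.1⟩ ⟨j, h.2⟩ else 1

/-- What the cloud server provides to the proxy server in a query: masked encrypted scores `ĉ`,
masked encrypted row `m̂`, the garbled circuit, the labels of the inputs of the cloud server, and
the pairs of labels offered in the oblivious transfers, one per input bit of the proxy server. -/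
structure Response (𝒢 : BilinearGroupGen) (k : ℕ) where
  d : 𝒢.Desc.denote
  chat : List (𝒢.G₁ d)
  mhat : List (𝒢.G d)
  mgc : Garbled k
  csLabels : List (Label k)
  otPairs : List (Label k × Label k)

variable {𝒢 : BilinearGroupGen}

/-- Key generation. -/
def keyGen (𝒢 : BilinearGroupGen) (k : ℕ) : PMF (BGN.PublicKey 𝒢 × (ℕ × List Bool)) := do
  let kperm ← randomBits k
  let ks ← BGN.keyGen 𝒢 k
  PMF.pure (ks.1, (ks.2, kperm))

/-- Encryption of the adjacency matrix; row `i` is stored at position `F_{kperm}(i)`. -/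
def encMatrix (F : KeyedPerm) {N : ℕ} (Gr : SimpleGraph (Fin N)) (sk : ℕ × List Bool)
    (pk : BGN.PublicKey 𝒢) : PMF (Table 𝒢) := by
  classical
  exact do
    let M ← independent fun i : Fin N => independent fun j : Fin N =>
      BGN.encrypt pk (if Gr.Adj i j then 1 else 0)
    PMF.pure { pk := pk, N := N, rows := fun p => M ((F.perm sk.2 N).symm p) }

/-- The trapdoor `(F_{kperm}(v), s)` with a random key `s`. -/
def trapdoorGen (F : KeyedPerm) (k : ℕ) {N : ℕ} (v : Fin N) (sk : ℕ × List Bool) :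
    PMF (ℕ × List Bool) := do
  let s ← randomBits k
  PMF.pure ((F.perm sk.2 N v).val, s)

/-- The encrypted score of the row at position `i` with the row at position `i'`. -/
def score (k : ℕ) (T : Table 𝒢) (i' i : ℕ) : PMF (𝒢.G₁ T.pk.d) :=
  if i ≠ i' then
    PMF.pure (∏ j : Fin T.N, 𝒢.e T.pk.d (T.entry i' j) (T.entry i j))
  else do
    let r ← unif (2 ^ k)
    PMF.pure (𝒢.e T.pk.d T.pk.g T.pk.g ^ 0 * 𝒢.e T.pk.d T.pk.g T.pk.h ^ r)

/-- The query algorithm of the cloud server. -/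
def lpQuery (perm : KeyedPerm) (H : GarblingHash) (k : ℕ) (τ : ℕ × List Bool) (T : Table 𝒢) :
    PMF (Response 𝒢 k) := do
  let i' := τ.1
  let πs := perm.perm τ.2 T.N
  let c ← independent fun i : Fin T.N => score k T i' i
  let r ← independent fun _ : Fin T.N => unif (2 ^ k)
  let r' ← independent fun _ : Fin T.N => unif (2 ^ k)
  let x ← independent fun _ : Fin T.N => unif (2 ^ k)
  let x' ← independent fun _ : Fin T.N => unif (2 ^ k)
  let l := Nat.clog 2 T.N
  let Γ ← garble H k (maxCircuit T.N)
  let csBits := (List.finRange T.N).flatMap fun i =>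
    lowBits l (r i) ++ [decide (r' i % 2 = 1)]
  let n₁ := T.N * (l + 1)
  PMF.pure
    { d := T.pk.d
      chat := List.ofFn fun i => c (πs i) * 𝒢.e T.pk.d T.pk.g T.pk.g ^ r i
        * 𝒢.e T.pk.d T.pk.g T.pk.h ^ x i
      mhat := List.ofFn fun i => T.entry i' (πs i) * T.pk.g ^ r' i * T.pk.h ^ x' i
      mgc := Γ.1
      csLabels := ((Γ.2.drop n₁).zip csBits).map fun p => if p.2 = true then p.1.2 else p.1.1
      otPairs := Γ.2.take n₁ }

/-- The algorithm of the proxy server: decrypt, obtain one label of every pair by oblivious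
transfer, and evaluate the garbled circuit. (A response over other groups than those of the public
key does not occur.) -/
def findMaxVertex (H : GarblingHash) (k : ℕ) (pk : BGN.PublicKey 𝒢) (sk : ℕ)
    (R : Response 𝒢 k) : PMF ℕ := by
  classical
  exact
    if hd : R.d = pk.d then
      let s := R.chat.map fun c => BGN.decrypt₁ pk sk (hd ▸ c)
      let a := R.mhat.map fun c => BGN.decrypt pk sk (hd ▸ c) % 2
      let l := Nat.clog 2 R.chat.length
      let psBits := (s.zip a).flatMap fun p => lowBits l p.1 ++ [decide (p.2 = 1)]
      let psLabels := (R.otPairs.zip psBits).map fun p => if p.2 = true then p.1.2 else p.1.1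
      PMF.pure (ofBits (R.mgc.evaluate H (psLabels ++ R.csLabels)))
    else PMF.pure 0

end SLPIII

/-- The scheme `SLP-III` from the BGN scheme over the bilinear groups `𝒢`, the keyed permutations `F`
(positions of the rows) and `π` (order of the scores sent to the proxy server) and the hash
function `H` of the garbled circuit. -/
def slpIII (𝒢 : BilinearGroupGen) (F π : KeyedPerm) (H : GarblingHash) : Scheme where
  PK := BGN.PublicKey 𝒢
  SK := ℕ × List Bool
  PSK := ℕ
  T := SLPIII.Table 𝒢
  Response := Σ k : ℕ, SLPIII.Response 𝒢 k
  TTy := .prod (BGN.KeyTy 𝒢) (.list (.list 𝒢.Elt))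
  TauTy := .prod .nat (.list .bool)
  dataT T := (T.pk.toData, List.ofFn fun i => List.ofFn fun j => 𝒢.code T.pk.d (T.rows i j))
  share sk := sk.1
  keyGen := SLPIII.keyGen 𝒢
  encMatrix _ _ Gr sk pk := SLPIII.encMatrix F Gr sk pk
  trapdoorGen k _ v sk := SLPIII.trapdoorGen F k v sk
  lpQuery k τ T := (SLPIII.lpQuery π H k τ T).map fun R => ⟨k, R⟩
  findMaxVertex _ pk sk R := SLPIII.findMaxVertex H R.1 pk sk R.2

end

end SLP

namespace SLP
noncomputable section

/-! ## Output distributions of programs -/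

/-! The adversary sees only the public key, the encrypted table and the trapdoors, and the graph
enters this view only through the plaintexts of the table. The proof therefore compares three games:
the real one (`keyedGame` with the row-permuted adjacency matrix, by `real_eq`), the game `zeroGame`
in which every entry is an encryption of zero, and `randomGame`, in which moreover the keyed
permutation is replaced by a uniform one.

From real to zero (`negligible_keyedGame_sub_zeroGame`) there is a hybrid argument over the entries
of the matrix: hybrid `t` keeps the first `t` entries and encrypts zeros elsewhere. Neighbouring
hybrids differ in one ciphertext, which the reduction obtains as its challenge. It draws the key of
`F` itself, so it can permute the rows and answer every query without the BGN secret key. A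
uniformly random index `t` below a polynomial `n` makes the sum telescope: the difference of the
extreme hybrids is exactly `n` times the advantage of this single adversary (`prTrue_hybrid`), hence
negligible.

For the first leakage, a simulator that encrypts zeros under a fresh public key and repeats the
leaked trapdoors reproduces `zeroGame` exactly (`ideal_trapdoorLeakage_eq`): trapdoors use only the
permutation key, which is independent of the BGN keys.

For the second leakage, passing from `zeroGame` to `randomGame` costs one application of
pseudorandomness (`negligible_zeroGame_sub_randomGame`), since with a zero table the permutation is
needed only through its values at queried vertices. A uniform permutation can be sampled lazily
(`interact_randomExtension`): a new vertex gets a uniform unused position, an old one the position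
it had. This requires only the index of the first occurrence of each query, which is what the
leakage reveals, so `ideal_repetitionLeakage_eq` is again an exact equality.

Most of the length is due to the concrete cost model: every simulator and reduction is written as a
`Prog`, its output distribution is computed by `eval_` lemmas, and its running time is bounded.
Since writing the output is charged (`size_le_cost`), polynomial time implies polynomially bounded
output, so polynomial time composes. Loops additionally need a bound on the accumulator. Group
operations and the adversary are well behaved only on genuine group elements and reachable states,
so time is bounded on families of admissible inputs (`PolyOn`), not only on all inputs (`IsPPT`). -/

theorem monad_bind_eq_bind {α β : Type} (p : PMF α) (f : α → PMF β) : p >>= f = p.bind f := rfl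

/-- The output of a randomised loop body, run along a list. -/
def foldEval {α β : Type} (f : α → β → PMF β) : List α → β → PMF β
  | [], b => PMF.pure b
  | a :: l, b => (f a b).bind (foldEval f l)

theorem map_fst_foldRun {α β : Type} (f : α → β → PMF (β × ℕ)) (l : List α) (b : β) :
    (foldRun f l b).map Prod.fst = foldEval (fun a b => (f a b).map Prod.fst) l b := by
  induction l generalizing b with
  | nil => simp [foldRun, foldEval, PMF.pure_map]
  | cons a l ih =>
    simp only [foldRun, foldEval, monad_bind_eq_bind, PMF.map_bind, PMF.bind_map, PMF.pure_map]
    congr 1; funext r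
    rw [Function.comp, ← ih]; rfl

theorem foldEval_eq_pure {α β : Type} {f : α → β → PMF β} {g : α → β → β} {l : List α}
    (h : ∀ a ∈ l, ∀ b, f a b = PMF.pure (g a b)) (b : β) :
    foldEval f l b = PMF.pure (l.foldl (fun b a => g a b) b) := by
  induction l generalizing b with
  | nil => rfl
  | cons a l ih =>
    rw [foldEval, h a (by simp), PMF.pure_bind, ih fun a ha => h a (by simp [ha])]; rfl

namespace Prog
variable {σ τ υ ω : Ty}

@[simp] theorem eval_id (x : σ.denote) : (Prog.id : Prog σ σ).eval x = PMF.pure x := by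
  simp [eval, run, step, PMF.pure_map]

@[simp] theorem eval_comp (p : Prog σ τ) (q : Prog τ υ) (x : σ.denote) :
    (p.comp q).eval x = (p.eval x).bind q.eval := by
  simp only [eval, run, monad_bind_eq_bind, PMF.map_bind, PMF.bind_map, PMF.pure_map]
  rfl

@[simp] theorem eval_unit (x : σ.denote) : (Prog.unit : Prog σ .unit).eval x = PMF.pure () := by
  simp [eval, run, step, PMF.pure_map]

@[simp] theorem eval_pair (p : Prog σ τ) (q : Prog σ υ) (x : σ.denote) :
    (p.pair q).eval x = (p.eval x).bind fun a => (q.eval x).bind fun b => PMF.pure (a, b) := by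
  simp only [eval, run, monad_bind_eq_bind, PMF.map_bind, PMF.bind_map, PMF.pure_map]
  rfl

@[simp] theorem eval_fst (x : (Ty.prod σ τ).denote) :
    (Prog.fst : Prog (.prod σ τ) σ).eval x = PMF.pure x.1 := by
  simp [eval, run, step, PMF.pure_map]

@[simp] theorem eval_snd (x : (Ty.prod σ τ).denote) :
    (Prog.snd : Prog (.prod σ τ) τ).eval x = PMF.pure x.2 := by
  simp [eval, run, step, PMF.pure_map]

@[simp] theorem eval_bool (b : Bool) (x : σ.denote) :
    (Prog.bool b : Prog σ .bool).eval x = PMF.pure b := by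
  simp [eval, run, step, PMF.pure_map]

theorem run_ite (c : Prog σ .bool) (p q : Prog σ τ) (x : σ.denote) :
    (Prog.ite c p q).run x = (c.run x).bind fun r =>
      (if r.1 = true then p.run x else q.run x).bind fun r' => PMF.pure (r'.1, r.2 + r'.2) := by
  simp only [run, monad_bind_eq_bind]
  congr 1; funext b
  split_ifs <;> rfl

@[simp] theorem eval_ite (c : Prog σ .bool) (p q : Prog σ τ) (x : σ.denote) :
    (Prog.ite c p q).eval x =
      (c.eval x).bind fun b => if b = true then p.eval x else q.eval x := by
  simp only [eval, run_ite, PMF.map_bind, PMF.bind_map, PMF.pure_map]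
  congr 1; funext b
  by_cases h : b.1 = true <;> simp only [h, Function.comp] <;> rfl

@[simp] theorem eval_num (n : ℕ) (x : σ.denote) :
    (Prog.num n : Prog σ .nat).eval x = PMF.pure n := by
  simp [eval, run, step, PMF.pure_map]

@[simp] theorem eval_add (x : (Ty.prod .nat .nat).denote) :
    Prog.add.eval x = PMF.pure (x.1 + x.2) := by
  simp [eval, run, step, PMF.pure_map]

@[simp] theorem eval_sub (x : (Ty.prod .nat .nat).denote) :
    Prog.sub.eval x = PMF.pure (x.1 - x.2) := by
  simp [eval, run, step, PMF.pure_map]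

@[simp] theorem eval_mul (x : (Ty.prod .nat .nat).denote) :
    Prog.mul.eval x = PMF.pure (x.1 * x.2) := by
  simp [eval, run, step, PMF.pure_map]

@[simp] theorem eval_div (x : (Ty.prod .nat .nat).denote) :
    Prog.div.eval x = PMF.pure (x.1 / x.2) := by
  simp [eval, run, step, PMF.pure_map]

@[simp] theorem eval_mod (x : (Ty.prod .nat .nat).denote) :
    Prog.mod.eval x = PMF.pure (x.1 % x.2) := by
  simp [eval, run, step, PMF.pure_map]

@[simp] theorem eval_le (x : (Ty.prod .nat .nat).denote) :
    Prog.le.eval x = PMF.pure (decide (x.1 ≤ x.2)) := by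
  simp [eval, run, step, PMF.pure_map]

@[simp] theorem eval_bits (x : Ty.nat.denote) : Prog.bits.eval x = PMF.pure (Nat.bits x) := by
  simp [eval, run, step, PMF.pure_map]

@[simp] theorem eval_nil (x : σ.denote) :
    (Prog.nil : Prog σ (.list τ)).eval x = PMF.pure [] := by
  simp [eval, run, step, PMF.pure_map]

@[simp] theorem eval_cons (x : (Ty.prod τ (.list τ)).denote) :
    (Prog.cons : Prog (.prod τ (.list τ)) (.list τ)).eval x = PMF.pure (x.1 :: x.2) := by
  simp [eval, run, step, PMF.pure_map]

@[simp] theorem eval_rand (x : Ty.nat.denote) : Prog.rand.eval x = unif x := by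
  simp only [eval, run, step, PMF.map_comp]
  exact PMF.map_id _

@[simp] theorem eval_fold (body : Prog (.prod υ τ) τ) (x : (Ty.prod (.list υ) τ).denote) :
    (Prog.fold body).eval x = foldEval (fun a b => body.eval (a, b)) x.1 x.2 := by
  simp only [eval, run, monad_bind_eq_bind, PMF.map_bind, PMF.pure_map]
  exact map_fst_foldRun _ _ _

/-! ## Running times -/

theorem runsWithin_mono {p : Prog σ τ} {x : σ.denote} {s t : ℕ} (h : p.RunsWithin x s)
    (hst : s ≤ t) : p.RunsWithin x t := fun r hr => (h r hr).trans hst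

theorem RunsWithin.comp {p : Prog σ τ} {q : Prog τ υ} {x : σ.denote} {s t : ℕ}
    (hp : p.RunsWithin x s) (hq : ∀ y ∈ (p.eval x).support, q.RunsWithin y t) :
    (p.comp q).RunsWithin x (s + t) := by
  intro r hr
  simp only [run, monad_bind_eq_bind, PMF.mem_support_bind_iff, PMF.mem_support_pure_iff] at hr
  obtain ⟨a, ha, b, hb, rfl⟩ := hr
  exact add_le_add (hp a ha) (hq a.1 ((PMF.mem_support_map_iff _ _ _).2 ⟨a, ha, rfl⟩) b hb)

theorem RunsWithin.pair {p : Prog σ τ} {q : Prog σ υ} {x : σ.denote} {s t : ℕ}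
    (hp : p.RunsWithin x s) (hq : q.RunsWithin x t) : (p.pair q).RunsWithin x (s + t + 1) := by
  intro r hr
  simp only [run, monad_bind_eq_bind, PMF.mem_support_bind_iff, PMF.mem_support_pure_iff] at hr
  obtain ⟨a, ha, b, hb, rfl⟩ := hr
  exact add_le_add (add_le_add (hp a ha) (hq b hb)) le_rfl

/-- The two branch bounds are added, not maximised, so that polynomial bounds stay polynomial. A
branch has to be bounded only if the test can select it. -/
theorem RunsWithin.ite {c : Prog σ .bool} {p q : Prog σ τ} {x : σ.denote} {s t u : ℕ}
    (hc : c.RunsWithin x s) (hp : true ∈ (c.eval x).support → p.RunsWithin x t)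
    (hq : false ∈ (c.eval x).support → q.RunsWithin x u) :
    (Prog.ite c p q).RunsWithin x (s + t + u) := by
  intro r hr
  simp only [run_ite, PMF.mem_support_bind_iff, PMF.mem_support_pure_iff] at hr
  obtain ⟨a, ha, b, hb, rfl⟩ := hr
  have ha' : a.1 ∈ (c.eval x).support := (PMF.mem_support_map_iff _ _ _).2 ⟨a, ha, rfl⟩
  have h1 := hc a ha
  by_cases h : a.1 = true
  · rw [if_pos h] at hb; rw [h] at ha'
    have := hp ha' b hb; simp only; omega
  · rw [if_neg h] at hb; rw [Bool.eq_false_of_not_eq_true h] at ha'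
    have := hq ha' b hb; simp only; omega

/-- The invariant is indexed by the prefix already consumed, so it may allow the accumulator to grow
with the number of rounds. The initial prefix `pre` is general only for the induction. -/
theorem foldRun_cost_le {α β : Type} {f : α → β → PMF (β × ℕ)} {t : ℕ}
    (Inv : List α → β → Prop) :
    ∀ (l pre : List α) (b : β), Inv pre b →
      (∀ pre' a post, pre ++ l = pre' ++ a :: post → ∀ b, Inv pre' b →
        ∀ r ∈ (f a b).support, r.2 ≤ t ∧ Inv (pre' ++ [a]) r.1) →
      ∀ r ∈ (foldRun f l b).support, r.2 ≤ l.length * t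
  | [], _, _, _, _, r, hr => by
    simp only [foldRun, PMF.mem_support_pure_iff] at hr; simp [hr]
  | a :: l, pre, b, hb, h, r, hr => by
    simp only [foldRun, monad_bind_eq_bind, PMF.mem_support_bind_iff,
      PMF.mem_support_pure_iff] at hr
    obtain ⟨c, hc, d, hd, rfl⟩ := hr
    have h1 := h pre a l rfl b hb c hc
    have h2 := foldRun_cost_le Inv l (pre ++ [a]) c.1 h1.2
      (fun pre' a' post he => h pre' a' post (by simpa using he)) d hd
    simp only [List.length_cons, add_mul, one_mul]; omega

theorem RunsWithin.fold {body : Prog (.prod υ τ) τ} {x : (Ty.prod (.list υ) τ).denote} {t : ℕ}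
    (Inv : List υ.denote → τ.denote → Prop) (h0 : Inv [] x.2)
    (h : ∀ pre a post, x.1 = pre ++ a :: post → ∀ b, Inv pre b →
      body.RunsWithin (a, b) t ∧ ∀ b' ∈ (body.eval (a, b)).support, Inv (pre ++ [a]) b') :
    (Prog.fold body).RunsWithin x (x.1.length * t + Ty.size (.prod (.list υ) τ) x) := by
  intro r hr
  simp only [run, monad_bind_eq_bind, PMF.mem_support_bind_iff, PMF.mem_support_pure_iff] at hr
  obtain ⟨c, hc, rfl⟩ := hr
  have := foldRun_cost_le (t := t) Inv x.1 [] x.2 h0 (fun pre a post he b hb r hr =>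
    ⟨(h pre a post (by simpa using he) b hb).1 r hr, (h pre a post (by simpa using he) b hb).2 _
      ((PMF.mem_support_map_iff _ _ _).2 ⟨r, hr, rfl⟩)⟩) c hc
  simp only; omega

/-- The summand `τ.size b` is needed because an empty loop returns its initial value for free;
`Prog.fold` covers it by charging for its whole input. -/
theorem size_le_foldRun_cost {α : Type} {f : α → τ.denote → PMF (τ.denote × ℕ)}
    (h : ∀ a b, ∀ r ∈ (f a b).support, τ.size r.1 ≤ r.2) :
    ∀ (l : List α) (b : τ.denote), ∀ r ∈ (foldRun f l b).support, τ.size r.1 ≤ r.2 + τ.size b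
  | [], b, r, hr => by
    simp only [foldRun, PMF.mem_support_pure_iff] at hr; simp [hr]
  | a :: l, b, r, hr => by
    simp only [foldRun, monad_bind_eq_bind, PMF.mem_support_bind_iff,
      PMF.mem_support_pure_iff] at hr
    obtain ⟨c, hc, d, hd, rfl⟩ := hr
    have h1 := h a b c hc
    have h2 := size_le_foldRun_cost h l c.1 d hd
    simp only; omega

/-- Writing the output is part of the running time. -/
theorem size_le_cost : {σ τ : Ty} → (p : Prog σ τ) → (x : σ.denote) →
    ∀ r ∈ (p.run x).support, τ.size r.1 ≤ r.2
  | _, _, .id, x, r, hr | _, _, .unit, x, r, hr | .prod _ _, _, .fst, x, r, hr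
  | .prod _ _, _, .snd, x, r, hr | _, _, .bool b, x, r, hr | _, _, .num n, x, r, hr
  | _, _, .add, x, r, hr | _, _, .sub, x, r, hr | _, _, .mul, x, r, hr | _, _, .div, x, r, hr
  | _, _, .mod, x, r, hr | _, _, .le, x, r, hr | _, _, .bits, x, r, hr
  | _, .list _, .nil, x, r, hr | _, .list _, .cons, x, r, hr => by
    simp only [run, PMF.mem_support_pure_iff] at hr
    rw [hr]; simp only [SLP.step]; omega
  | _, _, .rand, x, r, hr => by
    simp only [run, PMF.mem_support_map_iff] at hr
    obtain ⟨y, _, rfl⟩ := hr; simp only [SLP.step]; omega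
  | _, _, .comp p q, x, r, hr => by
    simp only [run, monad_bind_eq_bind, PMF.mem_support_bind_iff, PMF.mem_support_pure_iff] at hr
    obtain ⟨a, ha, b, hb, rfl⟩ := hr
    have := size_le_cost q _ b hb
    simp only; omega
  | _, _, .pair p q, x, r, hr => by
    simp only [run, monad_bind_eq_bind, PMF.mem_support_bind_iff, PMF.mem_support_pure_iff] at hr
    obtain ⟨a, ha, b, hb, rfl⟩ := hr
    have h1 := size_le_cost p _ a ha
    have h2 := size_le_cost q _ b hb
    simp only [Ty.size]; omega
  | _, _, .ite c p q, x, r, hr => by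
    simp only [run_ite, PMF.mem_support_bind_iff, PMF.mem_support_pure_iff] at hr
    obtain ⟨a, ha, b, hb, rfl⟩ := hr
    have : Ty.size _ b.1 ≤ b.2 := by
      split_ifs at hb
      · exact size_le_cost p _ b hb
      · exact size_le_cost q _ b hb
    simp only; omega
  | .prod (.list _) _, _, .caseList p q, x, r, hr => by
    obtain ⟨l, x⟩ := x
    simp only [run, monad_bind_eq_bind, PMF.mem_support_bind_iff, PMF.mem_support_pure_iff] at hr
    obtain ⟨b, hb, rfl⟩ := hr
    have : Ty.size _ b.1 ≤ b.2 := by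
      cases l with
      | nil => exact size_le_cost p _ b hb
      | cons a l => exact size_le_cost q _ b hb
    simp only; omega
  | .prod (.list _) _, _, .fold body, x, r, hr => by
    simp only [run, monad_bind_eq_bind, PMF.mem_support_bind_iff, PMF.mem_support_pure_iff] at hr
    obtain ⟨b, hb, rfl⟩ := hr
    have := size_le_foldRun_cost (fun a b => size_le_cost body (a, b)) _ _ b hb
    simp only [Ty.size]; omega

/-- The source of all size bounds below: intermediate results of fast programs are short, so the
next program in a composition is fast as well. -/
theorem RunsWithin.size_le {p : Prog σ τ} {x : σ.denote} {t : ℕ} (h : p.RunsWithin x t)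
    {y : τ.denote} (hy : y ∈ (p.eval x).support) : τ.size y ≤ t := by
  obtain ⟨r, hr, rfl⟩ := (PMF.mem_support_map_iff _ _ _).1 hy
  exact (size_le_cost p x r hr).trans (h r hr)

end Prog
end
end SLP

namespace SLP
noncomputable section

/-! ## Polynomial time -/

/-- Coefficients in `ℕ` are nonnegative. -/
theorem polynomial_eval_mono (P : Polynomial ℕ) {m n : ℕ} (h : m ≤ n) : P.eval m ≤ P.eval n := by
  simp only [Polynomial.eval_eq_sum_range]
  gcongr

/-- Sets of data whose size is polynomial in a parameter. -/
def Bdd (σ : Ty) (X : ℕ → Set σ.denote) : Prop :=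
  ∃ P : Polynomial ℕ, ∀ k, ∀ x ∈ X k, σ.size x ≤ P.eval k

namespace Prog
variable {σ τ υ ω : Ty}

/-- On the inputs in `X k` the running time is polynomial in `k`. -/
def PolyOn (p : Prog σ τ) (X : ℕ → Set σ.denote) : Prop :=
  ∃ P : Polynomial ℕ, ∀ k, ∀ x ∈ X k, p.RunsWithin x (P.eval k)

/-- The possible outputs of a program. -/
def image (p : Prog σ τ) (X : ℕ → Set σ.denote) (k : ℕ) : Set τ.denote :=
  {y | ∃ x ∈ X k, y ∈ (p.eval x).support}

theorem IsPPT.polyOn {p : Prog σ τ} (hp : p.IsPPT) {X : ℕ → Set σ.denote} (hX : Bdd σ X) :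
    p.PolyOn X := by
  obtain ⟨P, hP⟩ := hp
  obtain ⟨Q, hQ⟩ := hX
  refine ⟨P.comp Q, fun k x hx => runsWithin_mono (hP x) ?_⟩
  rw [Polynomial.eval_comp]
  exact polynomial_eval_mono P (hQ k x hx)

/-- Take as `k`-th set all inputs of size exactly `k`. This lets closure properties be proved for
`PolyOn` and transferred to `IsPPT`. -/
theorem isPPT_of_polyOn {p : Prog σ τ} (h : ∀ X, Bdd σ X → p.PolyOn X) : p.IsPPT := by
  obtain ⟨P, hP⟩ := h (fun k => {x | σ.size x = k}) ⟨Polynomial.X, fun k x hx => by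
    simpa using le_of_eq hx⟩
  exact ⟨P, fun x => hP _ x rfl⟩

theorem PolyOn.bdd_image {p : Prog σ τ} {X : ℕ → Set σ.denote} (hp : p.PolyOn X) :
    Bdd τ (p.image X) := by
  obtain ⟨P, hP⟩ := hp
  exact ⟨P, fun k y ⟨x, hx, hy⟩ => (hP k x hx).size_le hy⟩

theorem PolyOn.mono {p : Prog σ τ} {X Y : ℕ → Set σ.denote} (hp : p.PolyOn Y)
    (h : ∀ k, X k ⊆ Y k) : p.PolyOn X := by
  obtain ⟨P, hP⟩ := hp
  exact ⟨P, fun k x hx => hP k x (h k hx)⟩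

theorem PolyOn.comp {p : Prog σ τ} {q : Prog τ υ} {X : ℕ → Set σ.denote} (hp : p.PolyOn X)
    (hq : q.PolyOn (p.image X)) : (p.comp q).PolyOn X := by
  obtain ⟨P, hP⟩ := hp
  obtain ⟨Q, hQ⟩ := hq
  exact ⟨P + Q, fun k x hx => by
    rw [Polynomial.eval_add]; exact (hP k x hx).comp fun y hy => hQ k y ⟨x, hx, hy⟩⟩

theorem PolyOn.pair {p : Prog σ τ} {q : Prog σ υ} {X : ℕ → Set σ.denote} (hp : p.PolyOn X)
    (hq : q.PolyOn X) : (p.pair q).PolyOn X := by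
  obtain ⟨P, hP⟩ := hp
  obtain ⟨Q, hQ⟩ := hq
  exact ⟨P + Q + 1, fun k x hx => by simpa using (hP k x hx).pair (hQ k x hx)⟩

theorem PolyOn.ite {c : Prog σ .bool} {p q : Prog σ τ} {X : ℕ → Set σ.denote} (hc : c.PolyOn X)
    (hp : p.PolyOn fun k => {x ∈ X k | true ∈ (c.eval x).support})
    (hq : q.PolyOn fun k => {x ∈ X k | false ∈ (c.eval x).support}) :
    (Prog.ite c p q).PolyOn X := by
  obtain ⟨R, hR⟩ := hc
  obtain ⟨P, hP⟩ := hp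
  obtain ⟨Q, hQ⟩ := hq
  exact ⟨R + P + Q, fun k x hx => by
    simpa using (hR k x hx).ite (fun h => hP k x ⟨hx, h⟩) (fun h => hQ k x ⟨hx, h⟩)⟩

theorem length_le_size (l : List σ.denote) : l.length ≤ Ty.size (.list σ) l := by
  induction l with
  | nil => simp
  | cons a l ih => simp only [Ty.size, List.map_cons, List.sum_cons, List.length_cons] at *; omega

/-- A body of polynomial time does not make a loop polynomial, as the accumulator could double in
every round. The invariant has to confine all inputs of the body to a family `Y` on which its time
is bounded uniformly. -/
theorem PolyOn.fold {body : Prog (.prod υ τ) τ} {X : ℕ → Set (Ty.prod (.list υ) τ).denote}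
    {Y : ℕ → Set (Ty.prod υ τ).denote} (hX : Bdd _ X) (hb : body.PolyOn Y)
    (Inv : ℕ → (Ty.prod (.list υ) τ).denote → List υ.denote → τ.denote → Prop)
    (h0 : ∀ k, ∀ x ∈ X k, Inv k x [] x.2)
    (h : ∀ k, ∀ x ∈ X k, ∀ pre a post, x.1 = pre ++ a :: post → ∀ b, Inv k x pre b →
      (a, b) ∈ Y k ∧ ∀ b' ∈ (body.eval (a, b)).support, Inv k x (pre ++ [a]) b') :
    (Prog.fold body).PolyOn X := by
  obtain ⟨P, hP⟩ := hX
  obtain ⟨Q, hQ⟩ := hb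
  refine ⟨P * Q + P, fun k x hx => runsWithin_mono (RunsWithin.fold (t := Q.eval k) (Inv k x)
    (h0 k x hx) fun pre a post he b hb =>
      ⟨hQ k _ (h k x hx pre a post he b hb).1, (h k x hx pre a post he b hb).2⟩) ?_⟩
  have h1 := hP k x hx
  have h2 := length_le_size x.1
  have h3 : x.1.length ≤ P.eval k := by simp only [Ty.size] at h1 h2 ⊢; omega
  rw [Polynomial.eval_add, Polynomial.eval_mul]
  gcongr

/-- Bind the result of `p` and run `q` with it in front of the context. -/
def letP (p : Prog σ τ) (q : Prog (.prod τ σ) υ) : Prog σ υ := (p.pair .id).comp q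

@[simp] theorem eval_letP (p : Prog σ τ) (q : Prog (.prod τ σ) υ) (x : σ.denote) :
    (p.letP q).eval x = (p.eval x).bind fun a => q.eval (a, x) := by
  simp [letP, PMF.bind_bind, PMF.pure_bind]

/-- The context after binding the result of `p`. -/
def ext (p : Prog σ τ) (X : ℕ → Set σ.denote) (k : ℕ) : Set (Ty.prod τ σ).denote :=
  {z | z.2 ∈ X k ∧ z.1 ∈ (p.eval z.2).support}

theorem isPPT_step {p : Prog σ τ} (f : σ.denote → τ.denote)
    (h : ∀ x, p.run x = PMF.pure (SLP.step x (f x)))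
    (hf : ∃ P : Polynomial ℕ, ∀ x, τ.size (f x) ≤ P.eval (σ.size x)) : p.IsPPT := by
  obtain ⟨P, hP⟩ := hf
  refine ⟨Polynomial.X + P, fun x r hr => ?_⟩
  rw [h, PMF.mem_support_pure_iff] at hr
  simpa [hr, SLP.step] using hP x

@[simp] theorem isPPT_id : (Prog.id : Prog σ σ).IsPPT :=
  isPPT_step _ (fun x => by rw [run]) ⟨Polynomial.X, fun x => by simp⟩

@[simp] theorem isPPT_unit : (Prog.unit : Prog σ .unit).IsPPT :=
  isPPT_step _ (fun x => by rw [run]) ⟨1, fun x => by simp [Ty.size]⟩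

@[simp] theorem isPPT_fst : (Prog.fst : Prog (.prod σ τ) σ).IsPPT :=
  isPPT_step _ (fun x => by rw [run]) ⟨Polynomial.X, fun x => by simp [Ty.size]; omega⟩

@[simp] theorem isPPT_snd : (Prog.snd : Prog (.prod σ τ) τ).IsPPT :=
  isPPT_step _ (fun x => by rw [run]) ⟨Polynomial.X, fun x => by simp [Ty.size]; omega⟩

@[simp] theorem isPPT_bool (b : Bool) : (Prog.bool b : Prog σ .bool).IsPPT :=
  isPPT_step _ (fun x => by rw [run]) ⟨1, fun x => by simp [Ty.size]⟩

@[simp] theorem isPPT_num (n : ℕ) : (Prog.num n : Prog σ .nat).IsPPT :=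
  isPPT_step _ (fun x => by rw [run]) ⟨Polynomial.C (Ty.size .nat n), fun x => by simp⟩

theorem size_add_le (m n : ℕ) : Nat.size (m + n) ≤ Nat.size m + Nat.size n + 1 := by
  rw [Nat.size_le]
  have h1 := Nat.lt_size_self m
  have h2 := Nat.lt_size_self n
  have h3 : 2 ^ m.size ≤ 2 ^ (m.size + n.size) := Nat.pow_le_pow_right (by simp) (by simp)
  have h4 : 2 ^ n.size ≤ 2 ^ (m.size + n.size) := Nat.pow_le_pow_right (by simp) (by simp)
  rw [pow_succ]; omega

theorem size_mul_le (m n : ℕ) : Nat.size (m * n) ≤ Nat.size m + Nat.size n := by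
  rw [Nat.size_le, pow_add]
  exact Nat.mul_lt_mul'' (Nat.lt_size_self m) (Nat.lt_size_self n)

@[simp] theorem isPPT_add : Prog.add.IsPPT :=
  isPPT_step _ (fun x => by rw [run]) ⟨Polynomial.X, fun x => by
    have := size_add_le x.1 x.2
    simp only [Ty.size, Polynomial.eval_X]; omega⟩

@[simp] theorem isPPT_mul : Prog.mul.IsPPT :=
  isPPT_step _ (fun x => by rw [run]) ⟨Polynomial.X, fun x => by
    have := size_mul_le x.1 x.2
    simp only [Ty.size, Polynomial.eval_X]; omega⟩

@[simp] theorem isPPT_sub : Prog.sub.IsPPT :=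
  isPPT_step _ (fun x => by rw [run]) ⟨Polynomial.X, fun x => by
    have := Nat.size_le_size (Nat.sub_le x.1 x.2)
    simp only [Ty.size, Polynomial.eval_X]; omega⟩

@[simp] theorem isPPT_div : Prog.div.IsPPT :=
  isPPT_step _ (fun x => by rw [run]) ⟨Polynomial.X, fun x => by
    have := Nat.size_le_size (Nat.div_le_self x.1 x.2)
    simp only [Ty.size, Polynomial.eval_X]; omega⟩

@[simp] theorem isPPT_mod : Prog.mod.IsPPT :=
  isPPT_step _ (fun x => by rw [run]) ⟨Polynomial.X, fun x => by
    have := Nat.size_le_size (Nat.mod_le x.1 x.2)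
    simp only [Ty.size, Polynomial.eval_X]; omega⟩

@[simp] theorem isPPT_le : Prog.le.IsPPT :=
  isPPT_step _ (fun x => by rw [run]) ⟨1, fun x => by simp [Ty.size]⟩

theorem size_list_eq (l : List σ.denote) {c : ℕ} (h : ∀ a ∈ l, σ.size a = c) :
    Ty.size (.list σ) l = l.length * (c + 1) + 1 := by
  induction l with
  | nil => simp [Ty.size]
  | cons a l ih =>
    have := ih fun a ha => h a (by simp [ha])
    have h' := h a (by simp)
    simp only [Ty.size, List.map_cons, List.sum_cons, List.length_cons, add_mul] at *; omega

theorem size_list_le (l : List σ.denote) {c : ℕ} (h : ∀ a ∈ l, σ.size a ≤ c) :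
    Ty.size (.list σ) l ≤ l.length * (c + 1) + 1 := by
  induction l with
  | nil => simp [Ty.size]
  | cons a l ih =>
    have := ih fun a ha => h a (by simp [ha])
    have h' := h a (by simp)
    simp only [Ty.size, List.map_cons, List.sum_cons, List.length_cons, add_mul] at *; omega

theorem size_lt_size_list {l : List σ.denote} {a : σ.denote} (h : a ∈ l) :
    σ.size a < Ty.size (.list σ) l := by
  induction l with
  | nil => simp at h
  | cons b l ih =>
    simp only [Ty.size, List.map_cons, List.sum_cons] at *
    rcases List.mem_cons.1 h with rfl | h
    · omega
    · have := ih h; omega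

theorem size_append (l₁ l₂ : List σ.denote) :
    Ty.size (.list σ) (l₁ ++ l₂) + 1 = Ty.size (.list σ) l₁ + Ty.size (.list σ) l₂ := by
  simp [Ty.size]; omega

theorem size_bits (n : ℕ) : Ty.size (.list .bool) (Nat.bits n) = 2 * n.size + 1 := by
  rw [size_list_eq (σ := .bool) (Nat.bits n) (c := 1) (fun _ _ => rfl), ← Nat.size_eq_bits_len]
  omega

theorem size_unary (k : ℕ) : Ty.size (.list .unit) (unary k) = 2 * k + 1 := by
  rw [size_list_eq (σ := .unit) (unary k) (c := 1) (fun _ _ => rfl)]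
  simp [unary]; omega

@[simp] theorem isPPT_bits : Prog.bits.IsPPT :=
  isPPT_step _ (fun x => by rw [run]) ⟨2 * Polynomial.X, fun x => by
    have := size_bits x
    simp only [Polynomial.eval_mul, Polynomial.eval_ofNat, Polynomial.eval_X]
    rw [this]; simp only [Ty.size]; omega⟩

@[simp] theorem isPPT_nil : (Prog.nil : Prog σ (.list τ)).IsPPT :=
  isPPT_step _ (fun x => by rw [run]) ⟨1, fun x => by simp [Ty.size]⟩

@[simp] theorem isPPT_cons : (Prog.cons : Prog (.prod τ (.list τ)) (.list τ)).IsPPT :=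
  isPPT_step _ (fun x => by rw [run]) ⟨Polynomial.X, fun x => by simp [Ty.size]; omega⟩

theorem unif_le {m n : ℕ} (h : n ∈ (unif m).support) : n ≤ m := by
  rw [unif] at h
  split_ifs at h with hm
  · rw [PMF.mem_support_pure_iff] at h; omega
  · rw [PMF.mem_support_uniformOfFinset_iff, Finset.mem_range] at h; omega

@[simp] theorem isPPT_rand : Prog.rand.IsPPT := by
  refine ⟨2 * Polynomial.X, fun x r hr => ?_⟩
  rw [run, PMF.mem_support_map_iff] at hr
  obtain ⟨y, hy, rfl⟩ := hr
  have := Nat.size_le_size (unif_le hy)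
  simp only [SLP.step, Ty.size, Polynomial.eval_mul, Polynomial.eval_ofNat, Polynomial.eval_X]
  omega

@[simp] theorem isPPT_comp {p : Prog σ τ} {q : Prog τ υ} (hp : p.IsPPT) (hq : q.IsPPT) :
    (p.comp q).IsPPT :=
  isPPT_of_polyOn fun _ hX => (hp.polyOn hX).comp (hq.polyOn (hp.polyOn hX).bdd_image)

@[simp] theorem isPPT_pair {p : Prog σ τ} {q : Prog σ υ} (hp : p.IsPPT) (hq : q.IsPPT) :
    (p.pair q).IsPPT :=
  isPPT_of_polyOn fun _ hX => (hp.polyOn hX).pair (hq.polyOn hX)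

@[simp] theorem isPPT_ite {c : Prog σ .bool} {p q : Prog σ τ} (hc : c.IsPPT) (hp : p.IsPPT)
    (hq : q.IsPPT) : (Prog.ite c p q).IsPPT :=
  isPPT_of_polyOn fun _ hX => (hc.polyOn hX).ite
    ((hp.polyOn hX).mono fun _ _ h => h.1) ((hq.polyOn hX).mono fun _ _ h => h.1)

@[simp] theorem isPPT_letP {p : Prog σ τ} {q : Prog (.prod τ σ) υ} (hp : p.IsPPT)
    (hq : q.IsPPT) : (p.letP q).IsPPT := by simp [letP, hp, hq]

theorem PolyOn.bdd_ext {p : Prog σ τ} {X : ℕ → Set σ.denote} (hX : Bdd σ X) (hp : p.PolyOn X) :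
    Bdd _ (p.ext X) := by
  obtain ⟨P, hP⟩ := hX
  obtain ⟨Q, hQ⟩ := hp
  refine ⟨P + Q + 1, fun k z hz => ?_⟩
  have h1 := hP k z.2 hz.1
  have h2 := (hQ k z.2 hz.1).size_le hz.2
  simp only [Ty.size, Polynomial.eval_add, Polynomial.eval_one]; omega

theorem PolyOn.letP {p : Prog σ τ} {q : Prog (.prod τ σ) υ} {X : ℕ → Set σ.denote}
    (hX : Bdd σ X) (hp : p.PolyOn X) (hq : q.PolyOn (p.ext X)) : (p.letP q).PolyOn X :=
  (hp.pair (isPPT_id.polyOn hX)).comp <| hq.mono fun k z ⟨x, hx, hz⟩ => by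
    simp only [eval_pair, eval_id, PMF.pure_bind, PMF.mem_support_bind_iff,
      PMF.mem_support_pure_iff] at hz
    obtain ⟨a, ha, rfl⟩ := hz
    exact ⟨hx, ha⟩

/-! ## Loops with an environment -/

/-- A loop whose body may read an environment. -/
def foldE (body : Prog (.prod υ (.prod σ τ)) τ) : Prog (.prod (.list υ) (.prod σ τ)) τ :=
  (Prog.fold ((Prog.snd.comp Prog.fst).pair body)).comp Prog.snd

@[simp] theorem eval_foldE (body : Prog (.prod υ (.prod σ τ)) τ)
    (x : (Ty.prod (.list υ) (.prod σ τ)).denote) :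
    (foldE body).eval x = foldEval (fun a b => body.eval (a, (x.2.1, b))) x.1 x.2.2 := by
  obtain ⟨l, e, b⟩ := x
  simp only [foldE, eval_comp, eval_fold]
  induction l generalizing b with
  | nil => simp [foldEval, PMF.pure_bind]
  | cons a l ih =>
    simp only [foldEval, eval_pair, eval_comp, eval_snd, eval_fst, PMF.pure_bind, PMF.bind_bind]
    exact congrArg _ (funext fun b' => by
      simpa only [eval_pair, eval_comp, eval_snd, eval_fst, PMF.pure_bind] using ih b')

/-- If one round adds at most `R.eval k` to the size of the accumulator, whatever the accumulator
is, then polynomially many rounds keep it polynomial. `W` contains the pairs of list element and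
environment that can occur. -/
theorem PolyOn.foldE {body : Prog (.prod υ (.prod σ τ)) τ}
    {X : ℕ → Set (Ty.prod (.list υ) (.prod σ τ)).denote} (hX : Bdd _ X)
    (W : ℕ → Set (υ.denote × σ.denote)) (hW : ∀ k, ∀ x ∈ X k, ∀ a ∈ x.1, (a, x.2.1) ∈ W k)
    (hb : ∀ Y, Bdd _ Y → (∀ k, ∀ y ∈ Y k, (y.1, y.2.1) ∈ W k) → body.PolyOn Y)
    (growth : ∃ R : Polynomial ℕ, ∀ k, ∀ w ∈ W k, ∀ b, ∀ b' ∈ (body.eval (w.1, (w.2, b))).support,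
      τ.size b' ≤ τ.size b + R.eval k) :
    (Prog.foldE body).PolyOn X := by
  obtain ⟨R, hR⟩ := growth
  obtain ⟨P, hP⟩ := hX
  let Y : ℕ → Set (Ty.prod υ (.prod σ τ)).denote := fun k => {y | ∃ x ∈ X k, y.1 ∈ x.1 ∧
    y.2.1 = x.2.1 ∧ τ.size y.2.2 ≤ τ.size x.2.2 + x.1.length * R.eval k}
  have hY : Bdd _ Y := by
    refine ⟨P + P + P + P * R + 2, fun k y ⟨x, hx, h1, h2, h3⟩ => ?_⟩
    have h4 := hP k x hx
    have h5 := length_le_size x.1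
    have h6 := size_lt_size_list h1
    have h7 : x.1.length * R.eval k ≤ P.eval k * R.eval k := by
      gcongr; simp only [Ty.size] at h4 h5 ⊢; omega
    have h8 : Ty.size σ y.2.1 ≤ P.eval k := by
      rw [h2]; simp only [Ty.size] at h4 ⊢; omega
    simp only [Ty.size, Polynomial.eval_add, Polynomial.eval_mul, Polynomial.eval_ofNat] at *
    omega
  have hbY : body.PolyOn Y := hb Y hY fun k y ⟨x, hx, h1, h2, _⟩ => h2 ▸ hW k x hx _ h1
  have hfold : (Prog.fold ((Prog.snd.comp Prog.fst).pair body)).PolyOn X := by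
    refine PolyOn.fold (Y := Y) ⟨P, hP⟩
      (((isPPT_comp isPPT_snd isPPT_fst).polyOn hY).pair hbY)
      (fun k x pre b => b.1 = x.2.1 ∧ τ.size b.2 ≤ τ.size x.2.2 + pre.length * R.eval k)
      (fun k x hx => ⟨rfl, by simp⟩)
      fun k x hx pre a post he b hb => ⟨⟨x, hx, by simp [he], hb.1, hb.2.trans ?_⟩, ?_⟩
    · gcongr; simp [he]
    · intro b' hb'
      simp only [eval_pair, eval_comp, eval_snd, eval_fst, PMF.pure_bind,
        PMF.mem_support_bind_iff, PMF.mem_support_pure_iff] at hb'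
      obtain ⟨c, hc, rfl⟩ := hb'
      have hw := hR k (a, x.2.1) (hW k x hx a (by simp [he])) b.2 c (by rw [← hb.1]; exact hc)
      refine ⟨hb.1, hw.trans ?_⟩
      have := hb.2
      simp only [List.length_append, List.length_singleton, add_mul, one_mul]; omega
  exact hfold.comp (isPPT_snd.polyOn hfold.bdd_image)

/-- The growth in one round may depend on the element and the environment but not on the
accumulator, which excludes repeated doubling. -/
theorem isPPT_foldE {body : Prog (.prod υ (.prod σ τ)) τ} (hb : body.IsPPT)
    (growth : ∃ R : Polynomial ℕ, ∀ a e b, ∀ b' ∈ (body.eval (a, (e, b))).support,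
      τ.size b' ≤ τ.size b + R.eval (υ.size a + σ.size e)) : (foldE body).IsPPT := by
  refine isPPT_of_polyOn fun X hX => ?_
  have hX' := hX
  obtain ⟨P, hP⟩ := hX'
  obtain ⟨R, hR⟩ := growth
  refine PolyOn.foldE hX (fun k => {w | υ.size w.1 + σ.size w.2 ≤ P.eval k}) ?_
    (fun Y hY _ => hb.polyOn hY) ⟨R.comp P, fun k w hw b b' hb' => (hR _ _ _ _ hb').trans ?_⟩
  · intro k x hx a ha
    have h1 := hP k x hx
    have h2 := size_lt_size_list ha
    simp only [Ty.size, Set.mem_ofPred_eq] at *; omega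
  · rw [Polynomial.eval_comp]
    have := polynomial_eval_mono R hw
    omega

end Prog
end
end SLP

namespace SLP
noncomputable section

/-! ## Random lists -/

/-- Independent samples along a list. -/
def mapList {α β : Type} (f : α → PMF β) : List α → PMF (List β)
  | [] => PMF.pure []
  | a :: l => (f a).bind fun b => (mapList f l).bind fun bs => PMF.pure (b :: bs)

theorem mapList_eq_pure {α β : Type} {f : α → PMF β} {g : α → β} {l : List α}
    (h : ∀ a ∈ l, f a = PMF.pure (g a)) : mapList f l = PMF.pure (l.map g) := by
  induction l with
  | nil => rfl
  | cons a l ih =>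
    rw [mapList, h a (by simp), ih fun a ha => h a (by simp [ha]), PMF.pure_bind, PMF.pure_bind]
    rfl

theorem mapList_congr {α β : Type} {f g : α → PMF β} {l : List α} (h : ∀ a ∈ l, f a = g a) :
    mapList f l = mapList g l := by
  induction l with
  | nil => rfl
  | cons a l ih => rw [mapList, mapList, h a (by simp), ih fun a ha => h a (by simp [ha])]

theorem mapList_map {α β γ : Type} (f : β → PMF γ) (g : α → β) (l : List α) :
    mapList f (l.map g) = mapList (fun a => f (g a)) l := by
  induction l with
  | nil => rfl
  | cons a l ih => rw [List.map_cons, mapList, mapList, ih]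

theorem mapList_map_map {α β γ : Type} (f : α → PMF β) (g : β → γ) (l : List α) :
    mapList (fun a => (f a).map g) l = (mapList f l).map (List.map g) := by
  induction l with
  | nil => simp [mapList, PMF.pure_map]
  | cons a l ih =>
    simp only [mapList, ih, PMF.map_bind, PMF.bind_map, PMF.pure_map]
    rfl

/-- Connects the tuples of samples in the definitions of the games with the lists that programs
produce. -/
theorem mapList_ofFn {α : Type} {n : ℕ} (p : Fin n → PMF α) :
    mapList p (List.finRange n) = (independent p).map List.ofFn := by
  induction n with
  | zero => simp [mapList, independent, PMF.pure_map]
  | succ n ih =>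
    rw [List.finRange_succ, mapList, mapList_map, ih fun i => p i.succ]
    simp only [independent, monad_bind_eq_bind, PMF.map_bind, PMF.bind_map, PMF.pure_map]
    congr 1; funext a; congr 1; funext t
    simp [Function.comp, List.ofFn_succ]

theorem foldEval_cons_eq_mapList {α β : Type} (f : α → PMF β) (l : List α) (acc : List β) :
    foldEval (fun a b => (f a).bind fun c => PMF.pure (c :: b)) l acc
      = (mapList f l).map fun r => r.reverse ++ acc := by
  induction l generalizing acc with
  | nil => simp [foldEval, mapList, PMF.pure_map]
  | cons a l ih =>
    simp only [foldEval, mapList, PMF.bind_bind, PMF.pure_bind, PMF.map_bind, PMF.pure_map, ih]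
    congr 1; funext c
    simp only [PMF.map, Function.comp_def, List.reverse_cons, List.append_assoc,
      List.singleton_append]

namespace Prog
variable {σ τ υ ω : Ty}

/-! ## Programs on lists -/

def reverseP : Prog (.list υ) (.list υ) := (Prog.id.pair .nil).comp (.fold .cons)

@[simp] theorem eval_reverseP (l : (Ty.list υ).denote) :
    reverseP.eval l = PMF.pure l.reverse := by
  simp only [reverseP, eval_comp, eval_pair, eval_id, eval_nil, PMF.pure_bind, eval_fold, eval_cons]
  rw [foldEval_eq_pure (g := fun a b => a :: b) fun a _ b => rfl]
  simp

/-- Elements only move from one list to the other, so the total size is conserved, up to the `1`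
charged for an empty list. -/
theorem polyOn_fold_cons {X} (hX : Bdd _ X) : (Prog.fold (.cons (τ := υ))).PolyOn X := by
  have hX' := hX
  obtain ⟨P, hP⟩ := hX'
  refine PolyOn.fold (Y := fun k => {y | Ty.size _ y ≤ P.eval k + P.eval k}) hX
    (isPPT_cons.polyOn ⟨P + P, fun k x hx => by simpa using hx⟩)
    (fun k x pre b => Ty.size (.list υ) b + 1 =
      Ty.size (.list υ) pre + Ty.size (.list υ) x.2) (fun k x hx => by simp [Ty.size]; omega)
    fun k x hx pre a post he b hb => ?_
  have h1 := hP k x hx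
  have h2 := size_append pre (a :: post)
  rw [← he] at h2
  simp only [eval_cons, PMF.mem_support_pure_iff, forall_eq]
  simp only [Ty.size, List.map_append, List.map_cons, List.map_nil, List.sum_append, List.sum_cons,
    List.sum_nil, Set.mem_ofPred_eq] at *
  constructor <;> omega

@[simp] theorem isPPT_fold_cons : (Prog.fold (.cons (τ := υ))).IsPPT :=
  isPPT_of_polyOn fun _ => polyOn_fold_cons

@[simp] theorem isPPT_reverseP : (reverseP (υ := υ)).IsPPT := by simp [reverseP]

def appendP : Prog (.prod (.list υ) (.list υ)) (.list υ) :=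
  ((Prog.fst.comp reverseP).pair .snd).comp (.fold .cons)

@[simp] theorem eval_appendP (x : (Ty.prod (.list υ) (.list υ)).denote) :
    appendP.eval x = PMF.pure (x.1 ++ x.2) := by
  simp only [appendP, eval_comp, eval_pair, eval_fst, eval_reverseP, eval_snd, PMF.pure_bind,
    eval_fold, eval_cons]
  rw [foldEval_eq_pure (g := fun a b => a :: b) fun a _ b => rfl]
  simp

@[simp] theorem isPPT_appendP : (appendP (υ := υ)).IsPPT := by
  simp (maxDischargeDepth := 99) [appendP]

/-- Run `body` on every element of a list, with an environment. -/
def mapP (body : Prog (.prod υ σ) τ) : Prog (.prod (.list υ) σ) (.list τ) :=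
  ((Prog.fst.pair (Prog.snd.pair .nil)).comp (foldE
    (((Prog.fst.pair (Prog.snd.comp .fst)).comp body |>.pair (Prog.snd.comp .snd)).comp
      .cons))).comp reverseP

@[simp] theorem eval_mapP (body : Prog (.prod υ σ) τ) (x : (Ty.prod (.list υ) σ).denote) :
    (mapP body).eval x = mapList (fun a => body.eval (a, x.2)) x.1 := by
  simp only [mapP, eval_comp, eval_pair, eval_fst, eval_snd, eval_nil, PMF.pure_bind, eval_foldE,
    eval_cons, PMF.bind_bind]
  rw [foldEval_cons_eq_mapList (fun a => body.eval (a, x.2))]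
  simp only [PMF.map, PMF.bind_bind, Function.comp_def, PMF.pure_bind, eval_reverseP,
    List.append_nil, List.reverse_reverse, PMF.bind_pure]

theorem PolyOn.mapP {body : Prog (.prod υ σ) τ} {X : ℕ → Set (Ty.prod (.list υ) σ).denote}
    (hX : Bdd _ X) (hb : body.PolyOn fun k => {w | ∃ x ∈ X k, w.1 ∈ x.1 ∧ w.2 = x.2}) :
    (mapP body).PolyOn X := by
  refine PolyOn.comp ?_ (isPPT_reverseP.polyOn (PolyOn.bdd_image ?_))
  -- The loop is analysed twice with the same proof: as the first stage, and to bound the list that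
  -- is handed to `reverseP`.
  all_goals
    refine PolyOn.comp (IsPPT.polyOn (by simp) hX) (PolyOn.foldE (PolyOn.bdd_image
      (IsPPT.polyOn (by simp) hX)) (fun k => {w | ∃ x ∈ X k, w.1 ∈ x.1 ∧ w.2 = x.2}) ?_ ?_ ?_)
    · rintro k x ⟨y, hy, hx⟩ a ha
      simp only [eval_pair, eval_fst, eval_snd, eval_nil, PMF.pure_bind,
        PMF.mem_support_pure_iff] at hx
      subst hx
      exact ⟨y, hy, ha, rfl⟩
    · intro Y hY h
      have h1 : (Prog.comp (Prog.fst.pair (Prog.snd.comp .fst)) body :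
          Prog (.prod υ (.prod σ (.list τ))) τ).PolyOn Y := by
        refine (IsPPT.polyOn (by simp) hY).comp (hb.mono ?_)
        rintro k z ⟨y, hy, hz⟩
        simp only [eval_pair, eval_fst, eval_snd, eval_comp, PMF.pure_bind,
          PMF.mem_support_pure_iff] at hz
        subst hz
        exact h k y hy
      have h2 := h1.pair (IsPPT.polyOn (p := Prog.snd.comp .snd) (by simp) hY)
      exact h2.comp (isPPT_cons.polyOn h2.bdd_image)
    · obtain ⟨R, hR⟩ := hb
      refine ⟨R + 1, fun k w hw b b' hb' => ?_⟩
      simp only [eval_pair, eval_fst, eval_snd, eval_cons, eval_comp, PMF.pure_bind, PMF.bind_bind,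
        PMF.mem_support_bind_iff, PMF.mem_support_pure_iff] at hb'
      obtain ⟨y, hy, rfl⟩ := hb'
      have := (hR k w hw).size_le hy
      simp only [Ty.size, List.map_cons, List.sum_cons, Polynomial.eval_add, Polynomial.eval_one]
      omega

@[simp] theorem isPPT_mapP {body : Prog (.prod υ σ) τ} (hb : body.IsPPT) : (mapP body).IsPPT := by
  refine isPPT_of_polyOn fun X hX => PolyOn.mapP hX (hb.polyOn ?_)
  obtain ⟨P, hP⟩ := hX
  refine ⟨P, fun k w ⟨x, hx, h1, h2⟩ => (le_trans ?_ (hP k x hx))⟩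
  have := size_lt_size_list h1
  simp only [Ty.size, h2] at *; omega

/-- Keep the elements of a list that satisfy a test, with an environment. -/
def filterP (c : Prog (.prod υ σ) .bool) : Prog (.prod (.list υ) σ) (.list υ) :=
  ((Prog.fst.pair (Prog.snd.pair .nil)).comp (foldE
    (.ite ((Prog.fst.pair (Prog.snd.comp .fst)).comp c)
      ((Prog.fst.pair (Prog.snd.comp .snd)).comp .cons) (Prog.snd.comp .snd)))).comp reverseP

/-- The test has to be deterministic only on the elements of the list: in `inverseP` it calls
`F.prog`, which is specified only on the index set. -/
theorem eval_filterP {c : Prog (.prod υ σ) .bool} {x : (Ty.prod (.list υ) σ).denote}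
    {f : υ.denote → Bool} (h : ∀ a ∈ x.1, c.eval (a, x.2) = PMF.pure (f a)) :
    (filterP c).eval x = PMF.pure (x.1.filter f) := by
  simp only [filterP, eval_comp, eval_pair, eval_fst, eval_snd, eval_nil, PMF.pure_bind, eval_foldE,
    eval_cons, eval_ite]
  rw [foldEval_eq_pure (g := fun a b => if f a = true then a :: b else b) fun a ha b => by
    simp only [h a ha, PMF.pure_bind]; split_ifs <;> rfl]
  simp only [PMF.pure_bind, eval_reverseP]
  congr 1
  have : ∀ (l acc : List υ.denote), (l.foldl (fun b a => if f a = true then a :: b else b) acc) =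
      (l.filter f).reverse ++ acc := by
    intro l
    induction l with
    | nil => simp
    | cons a l ih =>
      intro acc
      rw [List.foldl_cons, ih, List.filter_cons]
      split_ifs <;> simp
  rw [this]; simp

@[simp] theorem isPPT_filterP {c : Prog (.prod υ σ) .bool} (hc : c.IsPPT) :
    (filterP c).IsPPT := by
  refine isPPT_comp (isPPT_comp (by simp) (isPPT_foldE
    (by simp (maxDischargeDepth := 99) [hc]) ⟨Polynomial.X + 1, ?_⟩))
    (by simp)
  intro a e b b' hb'
  simp only [eval_ite, eval_pair, eval_fst, eval_snd, eval_cons, eval_comp, PMF.pure_bind,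
    PMF.mem_support_bind_iff] at hb'
  obtain ⟨t, _, hb'⟩ := hb'
  split_ifs at hb' <;> rw [PMF.mem_support_pure_iff] at hb' <;> subst hb' <;>
    simp [Ty.size]; omega

/-- The length of a list. -/
def lengthP : Prog (.list υ) .nat :=
  (Prog.id.pair (Prog.unit.pair (.num 0))).comp (foldE (((Prog.snd.comp .snd).pair (.num 1)).comp .add))

@[simp] theorem eval_lengthP (l : (Ty.list υ).denote) : lengthP.eval l = PMF.pure l.length := by
  simp only [lengthP, eval_comp, eval_pair, eval_id, eval_unit, eval_num, PMF.pure_bind, eval_foldE,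
    eval_add, eval_snd]
  rw [foldEval_eq_pure (g := fun _ b => b + 1) fun a _ b => rfl]
  have : ∀ (l : List υ.denote) (b : ℕ), l.foldl (fun b _ => b + 1) b = b + l.length := by
    intro l; induction l with
    | nil => simp
    | cons a l ih => intro b; rw [List.foldl_cons, ih, List.length_cons]; omega
  rw [this, zero_add]

@[simp] theorem isPPT_lengthP : (lengthP (υ := υ)).IsPPT := by
  refine isPPT_comp (by simp) (isPPT_foldE (by simp (maxDischargeDepth := 99)) ⟨2, fun a e b b' hb' => ?_⟩)
  simp only [eval_pair, eval_snd, eval_num, eval_add, eval_comp, PMF.pure_bind,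
    PMF.mem_support_pure_iff] at hb'
  subst hb'
  have := size_add_le b 1
  simp only [Nat.size_one] at this
  simp only [Ty.size, Polynomial.eval_ofNat]; omega

/-- The numbers below the length of a list. -/
def rangeP : Prog (.list υ) (.list .nat) :=
  (Prog.id.pair (lengthP.pair .nil)).comp (foldE
    (((((Prog.snd.comp .fst).pair ((Prog.snd.comp .snd).comp lengthP)).comp .sub |>.pair
      (.num 1)).comp .sub |>.pair (Prog.snd.comp .snd)).comp .cons))

@[simp] theorem eval_rangeP (l : (Ty.list υ).denote) :
    rangeP.eval l = PMF.pure (List.range l.length) := by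
  simp only [rangeP, eval_comp, eval_pair, eval_id, eval_nil, PMF.pure_bind, eval_foldE,
    eval_cons, eval_fst, eval_snd, eval_lengthP, eval_sub, eval_num]
  rw [foldEval_eq_pure (g := fun _ b => (l.length - b.length - 1) :: b) fun a _ b => rfl]
  congr 1
  -- The loop counts downwards, so a prefix of length `m` has produced the top `m` numbers below
  -- `n`. Hence the induction removes the last element and `n` is decoupled from the length.
  have : ∀ (n : ℕ) (l : List υ.denote), l.length ≤ n →
      l.foldl (fun (b : List ℕ) _ => (n - b.length - 1) :: b) [] =
      (List.range l.length).map fun i => n - l.length + i := by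
    intro n l; induction l using List.reverseRecOn with
    | nil => simp
    | append_singleton l a ih =>
      intro h
      rw [List.length_append, List.length_singleton] at h ⊢
      rw [List.foldl_append, ih (by omega), List.range_succ_eq_map]
      simp only [List.foldl_cons, List.foldl_nil, List.length_map, List.length_range,
        List.map_cons, List.map_map, List.cons.injEq]
      refine ⟨by omega, List.map_congr_left fun i _ => ?_⟩
      simp only [Function.comp]; omega
  rw [this _ _ le_rfl]
  simp

@[simp] theorem isPPT_rangeP : (rangeP (υ := υ)).IsPPT := by
  refine isPPT_comp (by simp (maxDischargeDepth := 99)) (isPPT_foldE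
    (by simp (maxDischargeDepth := 99)) ⟨Polynomial.X + 1, fun a e b b' hb' => ?_⟩)
  simp only [eval_pair, eval_fst, eval_snd, eval_num, eval_sub, eval_comp, eval_lengthP, eval_cons,
    PMF.pure_bind, PMF.mem_support_pure_iff] at hb'
  subst hb'
  have := Nat.size_le_size ((Nat.sub_le (e - b.length) 1).trans (Nat.sub_le e b.length))
  simp only [Ty.size, List.map_cons, List.sum_cons, Polynomial.eval_add, Polynomial.eval_X,
    Polynomial.eval_one]
  omega

/-- Equality of numbers. -/
def eqP : Prog (.prod .nat .nat) .bool := .ite .le ((Prog.snd.pair .fst).comp .le) (.bool false)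

@[simp] theorem eval_eqP (x : (Ty.prod .nat .nat).denote) :
    eqP.eval x = PMF.pure (decide (x.1 = x.2)) := by
  simp only [eqP, eval_ite, eval_le, PMF.pure_bind, eval_comp, eval_pair, eval_fst, eval_snd,
    eval_bool, decide_eq_true_eq]
  obtain ⟨a, b⟩ := x
  have : ∀ a b : ℕ, (if a ≤ b then PMF.pure (decide (b ≤ a)) else PMF.pure false) =
      PMF.pure (decide (a = b)) := fun a b => by
    split_ifs with h
    · congr 1; simp; omega
    · rw [decide_eq_false (by omega)]
  exact this a b

@[simp] theorem isPPT_eqP : eqP.IsPPT := by simp (maxDischargeDepth := 99) [eqP]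

/-- The last element of a list, or a default value. -/
def lastP : Prog (.prod (.list υ) υ) υ := .fold .fst

@[simp] theorem eval_lastP (x : (Ty.prod (.list υ) υ).denote) :
    lastP.eval x = PMF.pure (x.1.getLastD x.2) := by
  simp only [lastP, eval_fold, eval_fst]
  rw [foldEval_eq_pure (g := fun a _ => a) fun a _ b => rfl]
  congr 1
  obtain ⟨l, d⟩ := x
  induction l generalizing d with
  | nil => rfl
  | cons a l ih => rw [List.foldl_cons, ih, List.getLastD_cons]

@[simp] theorem isPPT_lastP : (lastP (υ := υ)).IsPPT := by
  refine isPPT_of_polyOn fun X hX => ?_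
  have hX' := hX
  obtain ⟨P, hP⟩ := hX'
  refine PolyOn.fold (Y := fun k => {y | Ty.size _ y ≤ P.eval k + P.eval k + 1}) hX
    (isPPT_fst.polyOn ⟨P + P + 1, fun k x hx => by simpa using hx⟩)
    (fun k x pre b => υ.size b ≤ P.eval k) (fun k x hx => ?_)
    fun k x hx pre a post he b hb => ?_
  · have := hP k x hx; simp only [Ty.size] at this; omega
  · have h1 := hP k x hx
    have h2 := size_lt_size_list (l := x.1) (a := a) (by simp [he])
    simp only [eval_fst, PMF.mem_support_pure_iff, forall_eq]
    simp only [Ty.size, Set.mem_ofPred_eq] at *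
    constructor <;> omega

/-- The element of a list at an index, or a default value. -/
def nthP : Prog (.prod (.list υ) (.prod .nat υ)) υ :=
  ((Prog.fst.pair (Prog.unit.pair
      ((((Prog.snd.comp .fst).pair (.num 1)).comp .add).pair (Prog.snd.comp .snd)))).comp
    (foldE (.ite (((Prog.snd.comp (Prog.snd.comp .fst)).pair (.num 1)).comp eqP)
      ((Prog.num 0).pair .fst)
      ((((Prog.snd.comp (Prog.snd.comp .fst)).pair (.num 1)).comp .sub).pair
        (Prog.snd.comp (Prog.snd.comp .snd)))))).comp .snd

@[simp] theorem eval_nthP (x : (Ty.prod (.list υ) (.prod .nat υ)).denote) :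
    nthP.eval x = PMF.pure (x.1.getD x.2.1 x.2.2) := by
  obtain ⟨l, i, d⟩ := x
  simp only [nthP, eval_comp, eval_pair, eval_fst, eval_snd, eval_unit, eval_num, eval_add,
    eval_sub, eval_foldE, eval_ite, eval_eqP, PMF.pure_bind, decide_eq_true_eq]
  rw [foldEval_eq_pure (g := fun a (b : ℕ × υ.denote) =>
    if b.1 = 1 then ((0 : ℕ), a) else (b.1 - 1, b.2)) fun a _ b => by split_ifs <;> rfl]
  simp only [PMF.pure_bind, eval_snd]
  congr 1
  -- The counter starts at `i + 1` so that `0` can mean that the element has been found; truncated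
  -- subtraction keeps it at `0` from then on.
  have h0 : ∀ (l : List υ.denote) (d : υ.denote), l.foldl (fun (b : ℕ × υ.denote) a =>
      if b.1 = 1 then ((0 : ℕ), a) else (b.1 - 1, b.2)) (0, d) = (0, d) := by
    intro l; induction l with
    | nil => simp
    | cons a l ih => intro d; simpa using ih d
  have : ∀ (l : List υ.denote) (i : ℕ) (d : υ.denote), (l.foldl (fun (b : ℕ × υ.denote) a =>
      if b.1 = 1 then ((0 : ℕ), a) else (b.1 - 1, b.2)) (i + 1, d)).2 = l.getD i d := by
    intro l; induction l with
    | nil => simp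
    | cons a l ih =>
      intro i d
      cases i with
      | zero => simp [h0]
      | succ i => simpa using ih i d
  exact this l i d

@[simp] theorem isPPT_nthP : (nthP (υ := υ)).IsPPT := by
  refine isPPT_comp (isPPT_comp (by simp (maxDischargeDepth := 99)) (isPPT_foldE
    (by simp (maxDischargeDepth := 99)) ⟨Polynomial.X, fun a e b b' hb' => ?_⟩)) (by simp)
  simp only [eval_pair, eval_fst, eval_snd, eval_num, eval_sub, eval_comp, eval_ite, eval_eqP,
    PMF.pure_bind, decide_eq_true_eq] at hb'
  split_ifs at hb' with h <;> rw [PMF.mem_support_pure_iff] at hb' <;> subst hb'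
  · simp [Ty.size]; omega
  · have := Nat.size_le_size (Nat.sub_le b.1 1)
    simp only [Ty.size, Polynomial.eval_X]; omega

/-- Multiplication of unary numbers. -/
def mulU : Prog (.prod (.list .unit) (.list .unit)) (.list .unit) :=
  (Prog.fst.pair (Prog.snd.pair .nil)).comp
    (foldE (((Prog.snd.comp .fst).pair (Prog.snd.comp .snd)).comp appendP))

theorem eval_mulU (m n : ℕ) : mulU.eval (unary m, unary n) = PMF.pure (unary (m * n)) := by
  simp only [mulU, eval_comp, eval_pair, eval_fst, eval_snd, eval_nil, eval_appendP, eval_foldE,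
    PMF.pure_bind]
  rw [foldEval_eq_pure (g := fun _ b => unary n ++ b) fun a _ b => rfl]
  congr 1
  have : ∀ m j : ℕ, (unary m).foldl (fun b _ => unary n ++ b) (unary j) = unary (j + m * n) := by
    intro m; induction m with
    | zero => simp [unary]
    | succ m ih =>
      intro j
      have : unary n ++ unary j = unary (n + j) := by simp [unary]
      rw [show unary (m + 1) = () :: unary m from rfl, List.foldl_cons, this, ih]
      congr 1; ring
  have h := this m 0
  rwa [zero_add] at h

@[simp] theorem isPPT_mulU : mulU.IsPPT := by
  refine isPPT_comp (by simp (maxDischargeDepth := 99)) (isPPT_foldE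
    (by simp (maxDischargeDepth := 99)) ⟨Polynomial.X, fun a e b b' hb' => ?_⟩)
  simp only [eval_pair, eval_fst, eval_snd, eval_appendP, eval_comp,
    PMF.pure_bind, PMF.mem_support_pure_iff] at hb'
  subst hb'
  have := size_append (σ := .unit) e b
  simp only [Polynomial.eval_X]; omega

theorem eq_unary (l : (Ty.list .unit).denote) : l = unary l.length :=
  List.eq_replicate_length.2 fun _ _ => rfl

/-- Loops run along lists, so a reduction that plays `A.q.eval k` rounds, or draws an index below a
polynomial, must first produce that number in unary. Constants, sums and multiplication by `X`
suffice. -/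
theorem exists_polynomial_prog (P : Polynomial ℕ) : ∃ p : Prog (.list .unit) (.list .unit),
    p.IsPPT ∧ ∀ k, p.eval (unary k) = PMF.pure (unary (P.eval k)) := by
  induction P using Polynomial.induction_on with
  | C a =>
    have : ∀ a : ℕ, ∃ p : Prog (.list .unit) (.list .unit),
        p.IsPPT ∧ ∀ k, p.eval (unary k) = PMF.pure (unary a) := by
      intro a
      induction a with
      | zero => exact ⟨.nil, by simp, fun k => by simp [unary]⟩
      | succ a ih =>
        obtain ⟨p, hp, h⟩ := ih
        refine ⟨(Prog.unit.pair p).comp .cons, by simp (maxDischargeDepth := 99) [hp], fun k => ?_⟩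
        simp only [eval_comp, eval_pair, eval_unit, h, PMF.pure_bind, eval_cons]
        rfl
    simpa using this a
  | add P Q hP hQ =>
    obtain ⟨p, hp, hp'⟩ := hP
    obtain ⟨q, hq, hq'⟩ := hQ
    refine ⟨(p.pair q).comp appendP, by simp (maxDischargeDepth := 99) [hp, hq], fun k => ?_⟩
    simp only [eval_comp, eval_pair, hp', hq', PMF.pure_bind, eval_appendP]
    simp [unary]
  | monomial n a ih =>
    obtain ⟨p, hp, hp'⟩ := ih
    refine ⟨(p.pair .id).comp mulU, by simp (maxDischargeDepth := 99) [hp], fun k => ?_⟩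
    simp only [eval_comp, eval_pair, hp', PMF.pure_bind, eval_id]
    simp only [Polynomial.eval_mul, Polynomial.eval_C]
    rw [eval_mulU]
    simp [pow_succ, mul_assoc]

/-- A random bit string as long as the input. -/
def randomBitsP : Prog (.list .unit) (.list .bool) :=
  (Prog.id.pair .unit).comp (mapP (((Prog.num 1).pair ((Prog.num 2).comp .rand)).comp .le))

@[simp] theorem isPPT_randomBitsP : randomBitsP.IsPPT := by
  simp (maxDischargeDepth := 99) [randomBitsP]

end Prog

/-! ### Products of distributions and random bit strings -/

theorem independent_apply {α : Type} {n : ℕ} (p : Fin n → PMF α) (x : Fin n → α) :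
    independent p x = ∏ i, p i (x i) := by
  classical
  induction n with
  | zero =>
    simp only [independent, PMF.pure_apply, Finset.univ_eq_empty, Finset.prod_empty]
    rw [if_pos (Subsingleton.elim _ _)]
  | succ n ih =>
    rw [Fin.prod_univ_succ]
    simp only [independent, monad_bind_eq_bind, PMF.bind_apply, PMF.pure_apply]
    rw [tsum_eq_single (x 0), tsum_eq_single (Fin.tail x), ih]
    · rw [if_pos (Fin.cons_self_tail x).symm, mul_one]; rfl
    · intro t ht
      rw [if_neg, mul_zero]
      intro h; apply ht; rw [h]; exact (Fin.tail_cons (α := fun _ => α) _ _).symm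
    · intro a ha
      convert mul_zero _
      rw [ENNReal.tsum_eq_zero]
      intro t
      rw [if_neg, mul_zero]
      intro h; apply ha; rw [h]; exact (Fin.cons_zero (α := fun _ => α) _ _).symm

theorem independent_uniform {α : Type} [Fintype α] [Nonempty α] (n : ℕ) :
    independent (fun _ : Fin n => PMF.uniformOfFintype α) = PMF.uniformOfFintype (Fin n → α) := by
  classical
  ext x
  simp [independent_apply, PMF.uniformOfFintype_apply, ENNReal.inv_pow]

theorem eval_randomBitsP (k : ℕ) : Prog.randomBitsP.eval (unary k) = randomBits k := by
  -- A random bit is obtained by testing `1 ≤ n` for a uniform `n` below `2`.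
  have hbit : (PMF.uniformOfFintype Bool) = (unif 2).map fun n => decide (1 ≤ n) := by
    ext b
    rw [unif, dif_neg (by norm_num)]
    simp only [PMF.uniformOfFintype_apply, PMF.map_apply, PMF.uniformOfFinset_apply]
    rw [tsum_eq_sum (s := Finset.range 2) fun n hn => by simp_all]
    cases b <;> simp [Finset.sum_range_succ]
  simp only [Prog.randomBitsP, Prog.eval_comp, Prog.eval_pair, Prog.eval_id, Prog.eval_unit,
    Prog.eval_mapP, Prog.eval_num, Prog.eval_rand, PMF.pure_bind]
  rw [randomBits, ← independent_uniform, ← mapList_ofFn, hbit]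
  have : unary k = (List.finRange k).map fun _ => () := by simp [unary]
  rw [this, mapList_map]
  congr 1; funext i
  simp only [PMF.map, PMF.bind_bind, PMF.pure_bind, Function.comp_def, Prog.eval_le]

end
end SLP

/-! ### Loops with an invariant, and access to variables -/

namespace SLP
noncomputable section

namespace Prog
variable {σ τ υ ω α β γ δ : Ty}

/-- For bodies whose behaviour is controlled only on admissible accumulators: codes of group
elements in the exponentiation, reachable states of an adversary in the query loop. -/
theorem PolyOn.foldE_inv {body : Prog (.prod υ (.prod σ τ)) τ}
    {X : ℕ → Set (Ty.prod (.list υ) (.prod σ τ)).denote} (hX : Bdd _ X)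
    (Inv : ℕ → (Ty.prod (.list υ) (.prod σ τ)).denote → List υ.denote → τ.denote → Prop)
    (h0 : ∀ k, ∀ x ∈ X k, Inv k x [] x.2.2)
    (hsize : ∃ R : Polynomial ℕ, ∀ k, ∀ x ∈ X k, ∀ pre a post, x.1 = pre ++ a :: post →
      ∀ b, Inv k x pre b → τ.size b ≤ R.eval k)
    (hb : ∀ Y, Bdd _ Y → (∀ k, ∀ y ∈ Y k, ∃ x ∈ X k, ∃ pre post, x.1 = pre ++ y.1 :: post ∧
      y.2.1 = x.2.1 ∧ Inv k x pre y.2.2) → body.PolyOn Y)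
    (hstep : ∀ k, ∀ x ∈ X k, ∀ pre a post, x.1 = pre ++ a :: post → ∀ b, Inv k x pre b →
      ∀ b' ∈ (body.eval (a, (x.2.1, b))).support, Inv k x (pre ++ [a]) b') :
    (Prog.foldE body).PolyOn X := by
  obtain ⟨R, hR⟩ := hsize
  have hX' := hX
  obtain ⟨P, hP⟩ := hX'
  let Y : ℕ → Set (Ty.prod υ (.prod σ τ)).denote := fun k => {y | ∃ x ∈ X k, ∃ pre post,
    x.1 = pre ++ y.1 :: post ∧ y.2.1 = x.2.1 ∧ Inv k x pre y.2.2}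
  have hY : Bdd _ Y := by
    refine ⟨P + P + R + 2, fun k y ⟨x, hx, pre, post, h1, h2, h3⟩ => ?_⟩
    have h4 := hP k x hx
    have h5 := hR k x hx pre y.1 post h1 _ h3
    have h6 := size_lt_size_list (l := x.1) (a := y.1) (by simp [h1])
    have h8 : Ty.size σ y.2.1 ≤ P.eval k := by
      rw [h2]; simp only [Ty.size] at h4 ⊢; omega
    simp only [Ty.size, Polynomial.eval_add, Polynomial.eval_ofNat] at *
    omega
  have hfold : (Prog.fold ((Prog.snd.comp Prog.fst).pair body)).PolyOn X := by
    refine PolyOn.fold (Y := Y) hX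
      (((isPPT_comp isPPT_snd isPPT_fst).polyOn hY).pair (hb Y hY fun k y hy => hy))
      (fun k x pre b => b.1 = x.2.1 ∧ Inv k x pre b.2) (fun k x hx => ⟨rfl, h0 k x hx⟩)
      fun k x hx pre a post he b hb => ⟨⟨x, hx, pre, post, he, hb.1, hb.2⟩, fun b' hb' => ?_⟩
    simp only [eval_pair, eval_comp, eval_snd, eval_fst, PMF.pure_bind,
      PMF.mem_support_bind_iff, PMF.mem_support_pure_iff] at hb'
    obtain ⟨c, hc, rfl⟩ := hb'
    exact ⟨hb.1, hstep k x hx pre a post he b.2 hb.2 c (by rw [← hb.1]; exact hc)⟩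
  exact hfold.comp (isPPT_snd.polyOn hfold.bdd_image)

/-- Variables of a context, from the one that was bound last. -/
def v0 : Prog (.prod α σ) α := .fst
def v1 : Prog (.prod β (.prod α σ)) α := .comp .snd v0
def v2 : Prog (.prod γ (.prod β (.prod α σ))) α := .comp .snd v1
def v3 : Prog (.prod δ (.prod γ (.prod β (.prod α σ)))) α := .comp .snd v2
def v4 : Prog (.prod ω (.prod δ (.prod γ (.prod β (.prod α σ))))) α := .comp .snd v3
def v5 : Prog (.prod υ (.prod ω (.prod δ (.prod γ (.prod β (.prod α σ)))))) α := .comp .snd v4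

@[simp] theorem eval_v0 (x : (Ty.prod α σ).denote) : v0.eval x = PMF.pure x.1 := by simp [v0]
@[simp] theorem eval_v1 (x : (Ty.prod β (.prod α σ)).denote) :
    v1.eval x = PMF.pure x.2.1 := by simp [v1, PMF.pure_bind]
@[simp] theorem eval_v2 (x : (Ty.prod γ (.prod β (.prod α σ))).denote) :
    v2.eval x = PMF.pure x.2.2.1 := by simp [v2, PMF.pure_bind]
@[simp] theorem eval_v3 (x : (Ty.prod δ (.prod γ (.prod β (.prod α σ)))).denote) :
    v3.eval x = PMF.pure x.2.2.2.1 := by simp [v3, PMF.pure_bind]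
@[simp] theorem eval_v4 (x : (Ty.prod ω (.prod δ (.prod γ (.prod β (.prod α σ))))).denote) :
    v4.eval x = PMF.pure x.2.2.2.2.1 := by simp [v4, PMF.pure_bind]
@[simp] theorem eval_v5
    (x : (Ty.prod υ (.prod ω (.prod δ (.prod γ (.prod β (.prod α σ)))))).denote) :
    v5.eval x = PMF.pure x.2.2.2.2.2.1 := by simp [v5, PMF.pure_bind]

@[simp] theorem isPPT_v0 : (v0 : Prog (.prod α σ) α).IsPPT := by simp [v0]
@[simp] theorem isPPT_v1 : (v1 : Prog (.prod β (.prod α σ)) α).IsPPT := by simp [v1]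
@[simp] theorem isPPT_v2 : (v2 : Prog (.prod γ (.prod β (.prod α σ))) α).IsPPT := by simp [v2]
@[simp] theorem isPPT_v3 : (v3 : Prog (.prod δ (.prod γ (.prod β (.prod α σ)))) α).IsPPT := by
  simp [v3]
@[simp] theorem isPPT_v4 :
    (v4 : Prog (.prod ω (.prod δ (.prod γ (.prod β (.prod α σ))))) α).IsPPT := by
  simp [v4]
@[simp] theorem isPPT_v5 :
    (v5 : Prog (.prod υ (.prod ω (.prod δ (.prod γ (.prod β (.prod α σ)))))) α).IsPPT := by
  simp [v5]

end Prog

/-! ## Programs for the encryption scheme -/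

namespace BilinearGroupGen
open Prog
variable (𝒢 : BilinearGroupGen)

/-- Descriptions that the generator may output. -/
def IsDesc (d : 𝒢.Desc.denote) : Prop := ∃ k, ∃ o ∈ (𝒢.gen.eval (unary k)).support, o.2 = d

variable {𝒢}

/-- Every group element is a possible output of the uniform sampler, so its code is no longer than
the running time of the sampler. -/
theorem exists_size_code_le : ∃ P : Polynomial ℕ, ∀ d, 𝒢.IsDesc d → ∀ x : 𝒢.G d,
    𝒢.Elt.size (𝒢.code d x) ≤ P.eval (𝒢.Desc.size d) := by
  obtain ⟨P, hP⟩ := 𝒢.sample_ppt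
  refine ⟨P, ?_⟩
  rintro _ ⟨k, o, ho, rfl⟩ x
  refine (hP o.2).size_le ?_
  rw [𝒢.sample_spec k o ho, PMF.mem_support_map_iff]
  exact ⟨x, by simp, rfl⟩

theorem IsDesc.eval_mul {d : 𝒢.Desc.denote} (hd : 𝒢.IsDesc d) (x y : 𝒢.G d) :
    𝒢.mul.eval (d, (𝒢.code d x, 𝒢.code d y)) = PMF.pure (𝒢.code d (x * y)) := by
  obtain ⟨k, o, ho, rfl⟩ := hd
  exact 𝒢.mul_spec k o ho x y

variable (𝒢) in
/-- The loop body of the exponentiation. -/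
def powStep : Prog (.prod .bool (.prod 𝒢.Desc (.prod 𝒢.Elt 𝒢.Elt))) (.prod 𝒢.Elt 𝒢.Elt) :=
  (Prog.ite v0 (Prog.snd.comp 𝒢.mul) (Prog.snd.comp (Prog.snd.comp .fst))).pair
    ((v1.pair ((Prog.snd.comp (Prog.snd.comp .snd)).pair
      (Prog.snd.comp (Prog.snd.comp .snd)))).comp 𝒢.mul)

variable (𝒢) in
/-- The power `g ^ (1 + m)`. -/
def powP : Prog (.prod 𝒢.Desc (.prod 𝒢.Elt .nat)) 𝒢.Elt :=
  (((Prog.snd.comp (Prog.snd.comp .bits)).pair (v0.pair (v1.pair v1))).comp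
    (foldE 𝒢.powStep)).comp .fst

theorem IsDesc.eval_powStep {d : 𝒢.Desc.denote} (hd : 𝒢.IsDesc d) (b : Bool) (x y : 𝒢.G d) :
    𝒢.powStep.eval (b, (d, (𝒢.code d x, 𝒢.code d y))) =
      PMF.pure (𝒢.code d (if b = true then x * y else x), 𝒢.code d (y * y)) := by
  simp only [powStep, eval_pair, eval_ite, eval_v0, eval_v1, eval_comp, eval_snd, eval_fst,
    PMF.pure_bind, hd.eval_mul]
  split_ifs <;> simp only [PMF.pure_bind]

theorem ofBits_bits (n : ℕ) : ofBits (Nat.bits n) = n := by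
  induction n using Nat.binaryRec' with
  | zero => simp [ofBits]
  | bit b n h ih =>
    rw [Nat.bits_append_bit n b h, ofBits, ih, Nat.bit_val]
    cases b <;> simp; omega

/-- Square and multiply along the bits of `m`. The accumulator starts at `g`, because the interface
has no program for the neutral element; this causes the shift of the exponent by one, which callers
undo with `x ^ n = 1`. -/
theorem IsDesc.eval_powP {d : 𝒢.Desc.denote} (hd : 𝒢.IsDesc d) (g : 𝒢.G d) (m : ℕ) :
    𝒢.powP.eval (d, (𝒢.code d g, m)) = PMF.pure (𝒢.code d (g ^ (1 + m))) := by
  have : ∀ (l : List Bool) (x y : 𝒢.G d),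
      foldEval (fun a b => 𝒢.powStep.eval (a, (d, b))) l (𝒢.code d x, 𝒢.code d y) =
        PMF.pure (𝒢.code d (x * y ^ ofBits l), 𝒢.code d (y ^ 2 ^ l.length)) := by
    intro l; induction l with
    | nil => intro x y; simp [foldEval, ofBits]
    | cons b l ih =>
      intro x y
      rw [foldEval, hd.eval_powStep, PMF.pure_bind, ih]
      congr 2
      · rw [ofBits, ← pow_two, ← pow_mul]
        cases b <;> simp [pow_add, mul_assoc]
      · rw [← pow_two, ← pow_mul, List.length_cons, pow_succ']
  simp only [powP, eval_pair, eval_v0, eval_v1, eval_comp, eval_snd, eval_bits, eval_foldE,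
    PMF.pure_bind, this, eval_fst]
  rw [ofBits_bits, pow_add, pow_one]

/-- Repeated calls of `𝒢.mul` on arbitrary data could let the size explode. On genuine elements all
intermediate values are codes again, and these are bounded uniformly by `exists_size_code_le`. -/
theorem polyOn_powP {X : ℕ → Set (Ty.prod 𝒢.Desc (.prod 𝒢.Elt .nat)).denote} (hX : Bdd _ X)
    (h : ∀ k, ∀ x ∈ X k, 𝒢.IsDesc x.1 ∧ ∃ g, x.2.1 = 𝒢.code x.1 g) : 𝒢.powP.PolyOn X := by
  have hstep : 𝒢.powStep.IsPPT := by
    simp (maxDischargeDepth := 99) [powStep, 𝒢.mul_ppt]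
  have harg : ((Prog.snd.comp (Prog.snd.comp .bits)).pair (v0.pair (v1.pair v1)) :
    Prog (.prod 𝒢.Desc (.prod 𝒢.Elt .nat)) _).PolyOn X :=
      IsPPT.polyOn (by simp (maxDischargeDepth := 99)) hX
  have hfold := harg.comp (q := foldE 𝒢.powStep) <| by
    obtain ⟨P, hP⟩ := exists_size_code_le (𝒢 := 𝒢)
    obtain ⟨Q, hQ⟩ := harg.bdd_image
    have hargX : ∀ k, ∀ x ∈ image ((Prog.snd.comp (Prog.snd.comp .bits)).pair
        (v0.pair (v1.pair v1))) X k, 𝒢.IsDesc x.2.1 ∧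
        ∃ u v, x.2.2 = (𝒢.code x.2.1 u, 𝒢.code x.2.1 v) := by
      rintro k x ⟨z, hz, hx⟩
      obtain ⟨h1, g, hg⟩ := h k z hz
      simp only [eval_pair, eval_v0, eval_v1, eval_comp, eval_snd, eval_bits,
        PMF.pure_bind, PMF.mem_support_pure_iff] at hx
      subst hx
      exact ⟨h1, g, g, by simp only [hg]⟩
    refine PolyOn.foldE_inv ⟨Q, hQ⟩
      (fun k x pre b => ∃ u v, b = (𝒢.code x.2.1 u, 𝒢.code x.2.1 v))
      (fun k x hx => (hargX k x hx).2) ⟨P.comp Q + P.comp Q + 1, ?_⟩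
      (fun Y hY _ => hstep.polyOn hY) ?_
    · rintro k x hx pre a post he b ⟨u, v, rfl⟩
      have h1 := (hargX k x hx).1
      have h2 : 𝒢.Desc.size x.2.1 ≤ Q.eval k := by
        have := hQ k x hx; simp only [Ty.size] at this; omega
      have h3 := polynomial_eval_mono P h2
      have h4 := hP _ h1 u
      have h5 := hP _ h1 v
      simp only [Ty.size, Polynomial.eval_add, Polynomial.eval_comp, Polynomial.eval_one]; omega
    · rintro k x hx pre a post he b ⟨u, v, rfl⟩ b' hb'
      rw [(hargX k x hx).1.eval_powStep, PMF.mem_support_pure_iff] at hb'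
      exact ⟨_, _, hb'⟩
  exact hfold.comp (isPPT_fst.polyOn hfold.bdd_image)

end BilinearGroupGen
end
end SLP

/-! ### BGN key generation and encryption as programs -/

namespace SLP
noncomputable section
open Prog

theorem bind_congr_support {α β : Type} {p : PMF α} {f g : α → PMF β}
    (h : ∀ a ∈ p.support, f a = g a) : p.bind f = p.bind g := by
  ext b
  simp only [PMF.bind_apply]
  refine tsum_congr fun a => ?_
  by_cases ha : a ∈ p.support
  · rw [h a ha]
  · rw [PMF.mem_support_iff, not_not] at ha; rw [ha, zero_mul, zero_mul]

namespace BGN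
variable {𝒢 : BilinearGroupGen}

/-- Public keys over a group that the generator may output. -/
def PublicKey.Valid (pk : PublicKey 𝒢) : Prop :=
  ∃ k, ∃ o ∈ (𝒢.gen.eval (unary k)).support, o.2 = pk.d ∧ pk.n = o.1.1 * o.1.2

theorem PublicKey.Valid.isDesc {pk : PublicKey 𝒢} (h : pk.Valid) : 𝒢.IsDesc pk.d := by
  obtain ⟨k, o, ho, h1, _⟩ := h
  exact ⟨k, o, ho, h1⟩

theorem PublicKey.Valid.pow_n {pk : PublicKey 𝒢} (h : pk.Valid) (x : 𝒢.G pk.d) :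
    x ^ pk.n = 1 := by
  obtain ⟨n, d, g, h'⟩ := pk
  obtain ⟨k, o, ho, rfl, rfl⟩ := h
  simp only
  rw [← 𝒢.card k o ho]
  exact pow_card_eq_one'

theorem PublicKey.Valid.n_pos {pk : PublicKey 𝒢} (h : pk.Valid) : 0 < pk.n := by
  obtain ⟨k, o, ho, _, h2⟩ := h
  rw [h2]
  exact Nat.mul_pos (𝒢.prime_left k o ho).pos (𝒢.prime_right k o ho).pos

theorem valid_of_mem_support {k : ℕ} {ks : PublicKey 𝒢 × ℕ} (h : ks ∈ (keyGen 𝒢 k).support) :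
    ks.1.Valid := by
  simp only [keyGen, monad_bind_eq_bind, PMF.mem_support_bind_iff, PMF.mem_support_pure_iff] at h
  obtain ⟨o, ho, g, _, r, _, rfl⟩ := h
  exact ⟨k, o, ho, rfl, rfl⟩

variable (𝒢) in
/-- Generation of the public key. -/
def keyGenP : Prog (.list .unit) (KeyTy 𝒢) :=
  letP 𝒢.gen <| letP ((v0.comp .snd).comp 𝒢.sample) <| letP ((v1.comp .fst).comp .mul) <|
  letP (v0.comp .rand) <|
  letP (((v3.comp .snd).pair (v2.pair
    ((((v0.pair v1).comp .add).pair (.num 1)).comp .sub))).comp 𝒢.powP) <|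
  letP (((v4.comp .snd).pair (v0.pair ((((v4.comp .fst).comp .snd).pair (.num 1)).comp
    .sub))).comp 𝒢.powP) <|
  v3.pair ((v5.comp .snd).pair (v4.pair v0))

theorem eval_keyGenP (k : ℕ) :
    (keyGenP 𝒢).eval (unary k) = (keyGen 𝒢 k).map fun ks => ks.1.toData := by
  simp only [keyGenP, keyGen, monad_bind_eq_bind, PMF.map_bind, PMF.pure_map, eval_letP]
  refine bind_congr_support fun o ho => ?_
  have hd : 𝒢.IsDesc o.2 := ⟨k, o, ho, rfl⟩
  have hn : ∀ x : 𝒢.G o.2, x ^ (o.1.1 * o.1.2) = 1 := fun x => by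
    rw [← 𝒢.card k o ho]; exact pow_card_eq_one'
  have h1 := (𝒢.prime_left k o ho).pos
  have h2 := (𝒢.prime_right k o ho).pos
  have h3 := Nat.mul_pos h1 h2
  simp only [eval_comp, eval_pair, eval_v0, eval_v1, eval_v2, eval_v3, eval_v4, eval_v5,
    eval_snd, eval_fst, eval_mul, eval_add, eval_sub, eval_num, eval_rand, PMF.pure_bind,
    𝒢.sample_spec k o ho, PMF.bind_map, Function.comp_def, hd.eval_powP]
  congr 1; funext g; congr 1; funext r
  -- `powP` adds one to its exponent. As `r` may be `0`, it is given `r + n - 1`, which yields `r +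
  -- n`, the same as `r` in a group of order `n`; the positive exponent `q₂` is simply lowered by
  -- one.
  have e1 : ∀ r n : ℕ, 0 < n → 1 + (r + n - 1) = r + n := by omega
  have e2 : ∀ n : ℕ, 0 < n → 1 + (n - 1) = n := by omega
  rw [e1 _ _ h3, e2 _ h2, pow_add, hn, mul_one]
  rfl

theorem polyOn_comp_powP {σ : Ty} {p : Prog σ (.prod 𝒢.Desc (.prod 𝒢.Elt .nat))}
    {X : ℕ → Set σ.denote} (hX : Bdd _ X) (hp : p.IsPPT) (h : ∀ k, ∀ x ∈ X k,
      ∀ y ∈ (p.eval x).support, 𝒢.IsDesc y.1 ∧ ∃ g, y.2.1 = 𝒢.code y.1 g) :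
    (p.comp 𝒢.powP).PolyOn X :=
  (hp.polyOn hX).comp (𝒢.polyOn_powP (hp.polyOn hX).bdd_image fun k y ⟨x, hx, hy⟩ => h k x hx y hy)

theorem isPPT_keyGenP : (keyGenP 𝒢).IsPPT := by
  refine isPPT_of_polyOn fun X hX => ?_
  have h1 := 𝒢.gen_ppt.polyOn hX
  have b1 := h1.bdd_ext hX
  have h2 : ((v0.comp .snd).comp 𝒢.sample).PolyOn _ :=
    IsPPT.polyOn (by simp (maxDischargeDepth := 99) [𝒢.sample_ppt]) b1
  have b2 := h2.bdd_ext b1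
  have h3 : ((v1.comp .fst).comp .mul).PolyOn _ :=
    IsPPT.polyOn (by simp (maxDischargeDepth := 99)) b2
  have b3 := h3.bdd_ext b2
  have h4 : (v0.comp .rand).PolyOn _ := IsPPT.polyOn (by simp (maxDischargeDepth := 99)) b3
  have b4 := h4.bdd_ext b3
  -- Every list of units is some `1^k`, so the promises about the generator apply to all inputs, as
  -- `IsPPT` demands.
  have valid : ∀ u : (Ty.list .unit).denote, ∀ o ∈ (𝒢.gen.eval u).support, 𝒢.IsDesc o.2 ∧
      ∀ g ∈ (𝒢.sample.eval o.2).support, ∃ g', g = 𝒢.code o.2 g' := by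
    intro u o ho
    rw [eq_unary u] at ho
    refine ⟨⟨_, o, ho, rfl⟩, fun g hg => ?_⟩
    rw [𝒢.sample_spec _ o ho, PMF.mem_support_map_iff] at hg
    obtain ⟨g', _, rfl⟩ := hg
    exact ⟨g', rfl⟩
  have h5 := polyOn_comp_powP b4 (p := (v3.comp .snd).pair (v2.pair
    ((((v0.pair v1).comp .add).pair (.num 1)).comp .sub))) (by simp (maxDischargeDepth := 99)) <| by
    rintro k ⟨r, n, g, o, u⟩ ⟨⟨⟨⟨_, ho⟩, hg⟩, _⟩, _⟩ y hy
    simp only [eval_comp, eval_pair, eval_v0, eval_v1, eval_v2, eval_v3, eval_snd, eval_add,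
      eval_sub, eval_num, PMF.pure_bind, PMF.mem_support_pure_iff] at hy hg
    subst hy
    exact ⟨(valid u o ho).1, (valid u o ho).2 g hg⟩
  have b5 := h5.bdd_ext b4
  have h6 := polyOn_comp_powP b5 (p := (v4.comp .snd).pair (v0.pair
    ((((v4.comp .fst).comp .snd).pair (.num 1)).comp .sub)))
    (by simp (maxDischargeDepth := 99)) <| by
    rintro k ⟨w, r, n, g, o, u⟩ ⟨⟨⟨⟨⟨_, ho⟩, hg⟩, _⟩, _⟩, hw⟩ y hy
    simp only [eval_comp, eval_pair, eval_v0, eval_v1, eval_v2, eval_v3, eval_v4, eval_snd, eval_add,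
      eval_sub, eval_num, eval_fst, PMF.pure_bind, PMF.mem_support_pure_iff] at hy hg hw
    obtain ⟨g', rfl⟩ := (valid u o ho).2 g hg
    rw [(valid u o ho).1.eval_powP, PMF.mem_support_pure_iff] at hw
    subst hy
    exact ⟨(valid u o ho).1, _, hw⟩
  have b6 := h6.bdd_ext b5
  exact h1.letP hX <| h2.letP b1 <| h3.letP b2 <| h4.letP b3 <| h5.letP b4 <| h6.letP b5 <|
    IsPPT.polyOn (by simp (maxDischargeDepth := 99)) b6

variable (𝒢) in
/-- Encryption of a bit. -/
def encryptP : Prog (.prod (KeyTy 𝒢) .bool) 𝒢.Elt :=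
  letP ((v0.comp .fst).comp .rand) <|
  letP (((v1.comp (Prog.comp .snd .fst)).pair ((v1.comp (Prog.comp .snd (Prog.comp .snd .snd))).pair
    ((((v0.pair (v1.comp .fst)).comp .add).pair (.num 1)).comp .sub))).comp 𝒢.powP) <|
  .ite (Prog.snd.comp (Prog.snd.comp .snd))
    (((v2.comp (Prog.comp .snd .fst)).pair ((v2.comp (Prog.comp .snd (Prog.comp .snd .fst))).pair
      v0)).comp 𝒢.mul) v0

theorem PublicKey.Valid.eval_encryptP {pk : PublicKey 𝒢} (h : pk.Valid) (b : Bool) :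
    (encryptP 𝒢).eval (pk.toData, b) =
      (encrypt pk (if b = true then 1 else 0)).map (𝒢.code pk.d) := by
  have e1 : ∀ r n : ℕ, 0 < n → 1 + (r + n - 1) = r + n := by omega
  simp only [encryptP, encrypt, PublicKey.toData, monad_bind_eq_bind, PMF.map_bind, PMF.pure_map,
    eval_letP, eval_comp, eval_pair, eval_v0, eval_v1, eval_v2, eval_snd, eval_fst, eval_add,
    eval_sub, eval_num, eval_rand, eval_ite, PMF.pure_bind, h.isDesc.eval_powP, h.isDesc.eval_mul]
  congr 1; funext r
  rw [e1 _ _ h.n_pos, pow_add, h.pow_n, mul_one]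
  split_ifs <;> simp

theorem polyOn_encryptP {X : ℕ → Set (Ty.prod (KeyTy 𝒢) .bool).denote} (hX : Bdd _ X)
    (h : ∀ k, ∀ x ∈ X k, ∃ pk : PublicKey 𝒢, pk.Valid ∧ x.1 = pk.toData) :
    (encryptP 𝒢).PolyOn X := by
  have h1 : ((v0.comp .fst).comp .rand).PolyOn X :=
    IsPPT.polyOn (by simp (maxDischargeDepth := 99)) hX
  have b1 := h1.bdd_ext hX
  have h2 := polyOn_comp_powP b1 (𝒢 := 𝒢) (p := (v1.comp (Prog.comp .snd .fst)).pair
    ((v1.comp (Prog.comp .snd (Prog.comp .snd .snd))).pair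
      ((((v0.pair (v1.comp .fst)).comp .add).pair (.num 1)).comp .sub)))
    (by simp (maxDischargeDepth := 99)) <| by
    rintro k ⟨r, x⟩ ⟨hx, _⟩ y hy
    obtain ⟨pk, hpk, he⟩ := h k x hx
    simp only [eval_comp, eval_pair, eval_v0, eval_v1, eval_snd, eval_add,
      eval_sub, eval_num, eval_fst, PMF.pure_bind, PMF.mem_support_pure_iff, he,
      PublicKey.toData] at hy
    subst hy
    exact ⟨hpk.isDesc, _, rfl⟩
  have b2 := h2.bdd_ext b1
  exact h1.letP hX <| h2.letP b1 <|
    IsPPT.polyOn (by simp (maxDischargeDepth := 99) [𝒢.mul_ppt]) b2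

/-- Independent encryptions of the entries of a matrix. -/
def encryptRows (pk : PublicKey 𝒢) {N : ℕ} (m : Fin N → Fin N → ℕ) :
    PMF (List (List 𝒢.Elt.denote)) :=
  mapList (fun i => mapList (fun j => (encrypt pk (m i j)).map (𝒢.code pk.d)) (List.finRange N))
    (List.finRange N)

theorem encryptRows_eq (pk : PublicKey 𝒢) {N : ℕ} (m : Fin N → Fin N → ℕ) :
    encryptRows pk m = (independent fun i => independent fun j => encrypt pk (m i j)).map
      fun M => List.ofFn fun i => List.ofFn fun j => 𝒢.code pk.d (M i j) := by
  simp only [encryptRows, mapList_map_map, mapList_ofFn, PMF.map_comp]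
  congr 1
  funext M
  simp [Function.comp_def, List.map_ofFn]

variable (𝒢) in
/-- A square matrix of encryptions of zero; its dimension is given in unary. -/
def zeroRowsP : Prog (.prod (.list .unit) (KeyTy 𝒢)) (.list (.list 𝒢.Elt)) :=
  (Prog.fst.pair .id).comp (mapP (Prog.snd.comp (mapP ((Prog.snd.pair (.bool false)).comp
    (encryptP 𝒢)))))

theorem PublicKey.Valid.eval_zeroRowsP {pk : PublicKey 𝒢} (h : pk.Valid) (N : ℕ) :
    (zeroRowsP 𝒢).eval (unary N, pk.toData) =
      encryptRows pk fun _ _ : Fin N => 0 := by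
  have : unary N = (List.finRange N).map fun _ => () := by simp [unary]
  simp only [zeroRowsP, eval_comp, eval_pair, eval_fst, eval_id, eval_mapP, eval_snd, eval_bool,
    PMF.pure_bind, h.eval_encryptP]
  rw [this, mapList_map]
  simp only [mapList_map]
  rfl

theorem polyOn_zeroRowsP {X : ℕ → Set (Ty.prod (.list .unit) (KeyTy 𝒢)).denote} (hX : Bdd _ X)
    (h : ∀ k, ∀ x ∈ X k, ∃ pk : PublicKey 𝒢, pk.Valid ∧ x.2 = pk.toData) :
    (zeroRowsP 𝒢).PolyOn X := by
  have hX' := hX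
  obtain ⟨P, hP⟩ := hX'
  have h1 : (Prog.pair .fst .id).PolyOn X := IsPPT.polyOn (by simp) hX
  refine h1.comp (PolyOn.mapP h1.bdd_image ?_)
  have hsnd : ∀ k, ∀ w : (Ty.prod .unit (.prod (.list .unit) (KeyTy 𝒢))).denote,
    (∃ x ∈ image (Prog.pair .fst .id) X k, w.1 ∈ x.1 ∧ w.2 = x.2) → w.2 ∈ X k := by
    rintro k w ⟨x, ⟨y, hy, hx⟩, hw1, hw2⟩
    simp only [eval_pair, eval_fst, eval_id, PMF.pure_bind, PMF.mem_support_pure_iff] at hx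
    rw [hw2, hx]; exact hy
  have hbdd : Bdd (Ty.prod .unit (.prod (.list .unit) (KeyTy 𝒢)))
      fun k => {w | ∃ x ∈ image (Prog.pair .fst .id) X k, w.1 ∈ x.1 ∧ w.2 = x.2} := by
    refine ⟨P + 2, fun k w hw => ?_⟩
    have := hP k _ (hsnd k w hw)
    rw [Ty.size]
    simp only [Polynomial.eval_add, Polynomial.eval_ofNat]
    have h1 : Ty.size .unit w.1 = 1 := rfl
    omega
  have h2 : (Prog.snd : Prog (.prod .unit (.prod (.list .unit) (KeyTy 𝒢))) _).PolyOn
    fun k => {w | ∃ x ∈ image (Prog.pair .fst .id) X k, w.1 ∈ x.1 ∧ w.2 = x.2} :=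
      isPPT_snd.polyOn hbdd
  have himage : ∀ k, ∀ x ∈ image (Prog.snd : Prog (.prod .unit (.prod (.list .unit) (KeyTy 𝒢))) _)
      (fun k => {w | ∃ x ∈ image (Prog.pair .fst .id) X k, w.1 ∈ x.1 ∧ w.2 = x.2}) k, x ∈ X k := by
    rintro k x ⟨w, hw, hx⟩
    simp only [eval_snd, PMF.mem_support_pure_iff] at hx
    rw [hx]; exact hsnd k w hw
  refine h2.comp (PolyOn.mapP h2.bdd_image ?_)
  have hb : Bdd (Ty.prod .unit (KeyTy 𝒢)) fun k => {w | ∃ x ∈ X k, w.1 ∈ x.1 ∧ w.2 = x.2} := by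
    refine ⟨P, fun k w ⟨x, hx, hw1, hw2⟩ => ?_⟩
    have := hP k x hx
    have h3 := size_lt_size_list hw1
    rw [Ty.size] at this ⊢
    rw [hw2]; omega
  have h3 : (Prog.pair .snd (.bool false) : Prog (.prod .unit (KeyTy 𝒢)) _).PolyOn
    fun k => {w | ∃ x ∈ X k, w.1 ∈ x.1 ∧ w.2 = x.2} := IsPPT.polyOn (by simp) hb
  refine (h3.comp (polyOn_encryptP h3.bdd_image ?_)).mono ?_
  · rintro k y ⟨w, ⟨x, hx, hw1, hw2⟩, hy⟩
    simp only [eval_pair, eval_snd, eval_bool, PMF.pure_bind, PMF.mem_support_pure_iff] at hy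
    rw [hy, hw2]; exact h k x hx
  · rintro k w ⟨x, hx, hw1, hw2⟩
    exact ⟨x, himage k x hx, hw1, hw2⟩

end BGN
end
end SLP

namespace SLP
noncomputable section

/-! ## Uniform distributions and interaction -/

/-- Moves the row permutation from the ciphertexts to the plaintexts: storing independently
encrypted rows at permuted positions is the same as encrypting the row-permuted matrix. -/
theorem independent_comp_equiv {α : Type} {n : ℕ} (p : Fin n → PMF α) (σ : Equiv.Perm (Fin n)) :
    (independent p).map (fun x i => x (σ i)) = independent fun i => p (σ i) := by
  classical
  ext x
  rw [PMF.map_apply, tsum_eq_single fun i => x (σ.symm i)]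
  · rw [if_pos (by funext i; simp), independent_apply, independent_apply]
    rw [← Equiv.prod_comp σ]
    simp
  · intro y hy
    rw [if_neg]
    rintro rfl
    exact hy (by funext i; simp)

/-- A projection of environment states that commutes with every step is invisible to the party. It
serves to add or to forget bookkeeping. -/
theorem interact_congr {σ ρ ρ' A B : Type} {party : σ → List A → PMF (B × σ)}
    {env : ρ → B → PMF (A × ρ)} {env' : ρ' → B → PMF (A × ρ')} (φ : ρ → ρ')
    (h : ∀ r b, (env r b).map (fun a => (a.1, φ a.2)) = env' (φ r) b) (q : ℕ) (s : σ) (r : ρ)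
    (l : List A) : interact party env q s r l = interact party env' q s (φ r) l := by
  induction q generalizing s r l with
  | zero => rfl
  | succ q ih =>
    simp only [interact, monad_bind_eq_bind, ← h, PMF.bind_map]
    congr 1; funext m; congr 1; funext a
    exact ih _ _ _

theorem uniformOfFinset_bind_apply {α β : Type} (s : Finset α) (hs : s.Nonempty) (f : α → PMF β)
    (b : β) : ((PMF.uniformOfFinset s hs).bind f) b = (s.card : ENNReal)⁻¹ * ∑ a ∈ s, f a b := by
  rw [PMF.bind_apply, tsum_eq_sum (s := s) fun a ha => by
    rw [PMF.uniformOfFinset_apply_of_notMem _ ha, zero_mul], Finset.mul_sum]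
  exact Finset.sum_congr rfl fun a ha => by rw [PMF.uniformOfFinset_apply_of_mem _ ha]

/-- A uniform element of `s` can be found by first choosing its image under a map whose fibres
have equal size. -/
theorem uniformOfFinset_bind_fiber {α β γ : Type} [DecidableEq β] {s : Finset α} (hs : s.Nonempty)
    {t : Finset β} (ht : t.Nonempty) (g : α → β) (hg : ∀ a ∈ s, g a ∈ t) {c : ℕ}
    (hc : ∀ b ∈ t, (s.filter (g · = b)).card = c) (f : α → PMF γ) (U : β → PMF α)
    (hU : ∀ b ∈ t, ∀ h : (s.filter (g · = b)).Nonempty, U b = PMF.uniformOfFinset _ h) :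
    (PMF.uniformOfFinset s hs).bind f = (PMF.uniformOfFinset t ht).bind fun b => (U b).bind f := by
  have hcard : s.card = t.card * c := by
    rw [Finset.card_eq_sum_card_fiberwise (f := g) (t := t) hg, Finset.sum_congr rfl hc]
    simp
  have hc0 : c ≠ 0 := by
    rintro rfl
    simp at hcard
    exact hs.ne_empty hcard
  ext x
  rw [uniformOfFinset_bind_apply, uniformOfFinset_bind_apply,
    ← Finset.sum_fiberwise_of_maps_to hg, hcard, Nat.cast_mul,
    ENNReal.mul_inv (.inr (by simp)) (.inl (by simp)), mul_assoc]
  congr 1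
  rw [Finset.mul_sum]
  refine Finset.sum_congr rfl fun b hb => ?_
  have hne : (s.filter (g · = b)).Nonempty := by
    rw [← Finset.card_pos, hc b hb]; omega
  rw [hU b hb hne, uniformOfFinset_bind_apply, hc b hb]

theorem sum_range_getD {α M : Type} [AddCommMonoid M] (l : List α) (d : α) (f : α → M) :
    ∑ i ∈ Finset.range l.length, f (l.getD i d) = (l.map f).sum := by
  induction l with
  | nil => simp
  | cons a l ih =>
    rw [List.length_cons, Finset.sum_range_succ', List.map_cons, List.sum_cons, ← ih, add_comm]
    simp

/-- In a list without repetitions indices correspond to elements bijectively, so a random number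
below the length selects a uniform element. -/
theorem map_unif_getD {α : Type} [DecidableEq α] (l : List α) (hl : l.Nodup)
    (hne : l.toFinset.Nonempty) (d : α) :
    (unif l.length).map (fun i => l.getD i d) = PMF.uniformOfFinset l.toFinset hne := by
  have h0 : l.length ≠ 0 := by
    intro h
    rw [List.length_eq_zero_iff] at h
    simp [h] at hne
  ext x
  rw [unif, dif_neg h0, ← PMF.bind_pure_comp, uniformOfFinset_bind_apply,
    ← PMF.bind_pure (PMF.uniformOfFinset l.toFinset hne), uniformOfFinset_bind_apply]
  simp only [Function.comp]
  rw [sum_range_getD l d (fun a => PMF.pure a x), List.sum_toFinset _ hl, Finset.card_range,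
    List.toFinset_card_of_nodup hl]

/-! ## Lazy sampling of a random permutation -/

section Lazy
variable {n : ℕ}

/-- The permutations that map the points in `vs` to the points in `as`. -/
def consistent (vs as : List (Fin n)) : Finset (Equiv.Perm (Fin n)) :=
  Finset.univ.filter fun f => vs.map f = as

/-- A uniform permutation that maps the points in `vs` to the points in `as`. -/
def randomExtension (vs as : List (Fin n)) : PMF (Equiv.Perm (Fin n)) :=
  if h : (consistent vs as).Nonempty then PMF.uniformOfFinset _ h else PMF.pure 1

/-- The value at `v` of a random permutation that maps the points in `vs` to those in `as`. -/
def lazyValue (vs as : List (Fin (n + 1))) (v : Fin (n + 1)) : PMF (Fin (n + 1)) :=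
  if (vs ++ [v]).idxOf v < as.length then PMF.pure (as.getD ((vs ++ [v]).idxOf v) 0)
  else (unif ((List.finRange (n + 1)).filter (· ∉ as)).length).map fun r =>
    ((List.finRange (n + 1)).filter (· ∉ as)).getD r 0

theorem randomExtension_nil : randomExtension ([] : List (Fin n)) [] =
    PMF.uniformOfFintype (Equiv.Perm (Fin n)) := by
  rw [randomExtension, dif_pos ⟨1, by simp [consistent]⟩, PMF.uniformOfFintype]
  congr 1
  simp [consistent]

theorem consistent_append (vs as : List (Fin n)) (v a : Fin n) :
    consistent (vs ++ [v]) (as ++ [a]) = (consistent vs as).filter (· v = a) := by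
  ext f
  simp only [consistent, Finset.mem_filter, Finset.mem_univ, true_and, List.map_append,
    List.map_cons, List.map_nil]
  constructor
  · intro h
    have := List.append_inj' h rfl
    exact ⟨this.1, by simpa using this.2⟩
  · rintro ⟨rfl, rfl⟩; rfl

/-- Composition with the transposition of `a` and `b` maps one fibre injectively into the other, and
it preserves the prescribed values because neither point is among them. By symmetry all fibres over
unused points have equal size. -/
theorem card_fiber_le {vs as : List (Fin n)} {v a b : Fin n} (ha : a ∉ as) (hb : b ∉ as) :
    ((consistent vs as).filter (· v = a)).card ≤ ((consistent vs as).filter (· v = b)).card := by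
  refine Finset.card_le_card_of_injOn (fun f => f.trans (Equiv.swap a b)) (fun f hf => ?_) ?_
  · simp only [consistent, Finset.mem_filter, Finset.mem_univ, true_and, Finset.coe_filter,
      Set.mem_ofPred_eq] at hf ⊢
    obtain ⟨h1, h2⟩ := hf
    refine ⟨?_, by simp [h2]⟩
    rw [← h1] at ha hb ⊢
    refine List.map_congr_left fun w hw => ?_
    simp only [Equiv.trans_apply]
    refine Equiv.swap_apply_of_ne_of_ne ?_ ?_
    · rintro rfl; exact ha (List.mem_map_of_mem hw)
    · rintro rfl; exact hb (List.mem_map_of_mem hw)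
  · intro f _ g _ h
    have := congrArg (fun e => e.trans (Equiv.swap a b)) h
    simpa [Equiv.trans_assoc] using this

theorem mem_consistent {vs as : List (Fin n)} {f : Equiv.Perm (Fin n)} :
    f ∈ consistent vs as ↔ vs.map f = as := by simp [consistent]

theorem apply_notMem {vs as : List (Fin n)} {f : Equiv.Perm (Fin n)} (hf : f ∈ consistent vs as)
    {v : Fin n} (hv : v ∉ vs) : f v ∉ as := fun h => by
  rw [← mem_consistent.1 hf, List.mem_map] at h
  obtain ⟨w, hw, he⟩ := h
  exact hv (f.injective he ▸ hw)

/-- Consistency forces `vs` and `as` to have the same length, so comparing the first occurrence of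
`v` with `as.length` tests whether `v` was queried before. -/
theorem lazyValue_of_mem {vs as : List (Fin (n + 1))} {f : Equiv.Perm (Fin (n + 1))}
    (hf : f ∈ consistent vs as) {v : Fin (n + 1)} (hv : v ∈ vs) :
    lazyValue vs as v = PMF.pure (f v) := by
  have hlen : as.length = vs.length := by rw [← mem_consistent.1 hf, List.length_map]
  have hlt : vs.idxOf v < vs.length := List.idxOf_lt_length_iff.2 hv
  rw [lazyValue, List.idxOf_append_of_mem hv, if_pos (hlen ▸ hlt), ← mem_consistent.1 hf,
    List.getD_eq_getElem _ _ (by simpa using hlt), List.getElem_map, List.getElem_idxOf]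

theorem lazyValue_of_notMem {vs as : List (Fin (n + 1))} {f : Equiv.Perm (Fin (n + 1))}
    (hf : f ∈ consistent vs as) {v : Fin (n + 1)} (hv : v ∉ vs) :
    lazyValue vs as v = PMF.uniformOfFinset (Finset.univ.filter (· ∉ as))
      ⟨f v, by simpa using apply_notMem hf hv⟩ := by
  have hlen : as.length = vs.length := by rw [← mem_consistent.1 hf, List.length_map]
  have hL : ((List.finRange (n + 1)).filter (· ∉ as)).toFinset =
      Finset.univ.filter (· ∉ as) := by ext; simp
  rw [lazyValue, if_neg (by rw [List.idxOf_append_of_notMem hv]; simp [hlen]),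
    map_unif_getD _ ((List.nodup_finRange _).filter _)
      (hL ▸ ⟨f v, by simpa using apply_notMem hf hv⟩) 0]
  congr

/-- Keeps `randomExtension` in its uniform branch along the interaction. For a new `v` the fibre
over `f v` is nonempty, and the fibre over any other unused point is at least as large. -/
theorem consistent_append_nonempty {vs as : List (Fin (n + 1))} {v a : Fin (n + 1)}
    (h : (consistent vs as).Nonempty) (ha : a ∈ (lazyValue vs as v).support) :
    (consistent (vs ++ [v]) (as ++ [a])).Nonempty := by
  obtain ⟨f, hf⟩ := h
  rw [consistent_append]
  by_cases hv : v ∈ vs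
  · rw [lazyValue_of_mem hf hv, PMF.mem_support_pure_iff] at ha
    exact ⟨f, by simp [hf, ha]⟩
  · rw [lazyValue_of_notMem hf hv] at ha
    have ha' := (PMF.mem_support_uniformOfFinset_iff _ _).1 ha
    rw [← Finset.card_pos]
    refine lt_of_lt_of_le ?_ (card_fiber_le (apply_notMem hf hv) (by simpa using ha'))
    exact Finset.card_pos.2 ⟨f, by simp [hf]⟩

/-- Conditioning on the value at `v`: at an old point it is determined, at a new point it is uniform
on the unused points because the fibres have equal size; given the value, the permutation is uniform
in its fibre. -/
theorem randomExtension_bind {γ : Type} {vs as : List (Fin (n + 1))} (v : Fin (n + 1))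
    (h : (consistent vs as).Nonempty) (K : Fin (n + 1) → Equiv.Perm (Fin (n + 1)) → PMF γ) :
    (randomExtension vs as).bind (fun f => K (f v) f) =
      (lazyValue vs as v).bind fun a => (randomExtension (vs ++ [v]) (as ++ [a])).bind (K a) := by
  -- Every permutation in the support of the extended distribution takes the value `a` at `v`, so
  -- the first argument of `K` may be read off from `f`.
  have hlazy : ((lazyValue vs as v).bind fun a =>
      (randomExtension (vs ++ [v]) (as ++ [a])).bind (K a)) = (lazyValue vs as v).bind fun a =>
      (randomExtension (vs ++ [v]) (as ++ [a])).bind fun f => K (f v) f := by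
    refine bind_congr_support fun a ha => bind_congr_support fun f hf => ?_
    rw [randomExtension, dif_pos (consistent_append_nonempty h ha),
      PMF.mem_support_uniformOfFinset_iff, consistent_append, Finset.mem_filter] at hf
    rw [hf.2]
  rw [hlazy]
  obtain ⟨f₀, hf₀⟩ := h
  by_cases hv : v ∈ vs
  · have hval : ∀ f ∈ consistent vs as, f v = f₀ v := fun f hf => by
      have := (mem_consistent.1 hf).trans (mem_consistent.1 hf₀).symm
      exact List.map_inj_left.1 this v hv
    rw [lazyValue_of_mem hf₀ hv, PMF.pure_bind]
    simp only [randomExtension, consistent_append, Finset.filter_true_of_mem hval]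
  · rw [randomExtension, dif_pos ⟨f₀, hf₀⟩, lazyValue_of_notMem hf₀ hv]
    have hmem : ∀ a : Fin (n + 1), a ∈ Finset.univ.filter (· ∉ as) → a ∉ as := by simp
    exact uniformOfFinset_bind_fiber ⟨f₀, hf₀⟩ _ (fun f => f v)
      (fun f hf => by simpa using apply_notMem hf hv)
      (c := ((consistent vs as).filter (· v = f₀ v)).card)
      (fun b hb => le_antisymm (card_fiber_le (hmem b hb) (apply_notMem hf₀ hv))
        (card_fiber_le (apply_notMem hf₀ hv) (hmem b hb)))
      (fun f => K (f v) f) (fun a => randomExtension (vs ++ [v]) (as ++ [a]))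
      (fun b hb hne => by
        simp only [randomExtension, consistent_append]
        rw [dif_pos hne])

/-- Answering queries with a random permutation is the same as choosing its values when they are
needed. -/
theorem interact_randomExtension {σ A B E : Type} (party : σ → List A → PMF (B × σ))
    (vertex : B → Fin (n + 1)) (R : PMF E) (ans : Fin (n + 1) → E → A) (q : ℕ) (s : σ)
    (vs as : List (Fin (n + 1))) (l : List A) (h : (consistent vs as).Nonempty) :
    (randomExtension vs as).bind (fun f => interact party
      (fun (_ : Unit) b => R.map fun e => (ans (f (vertex b)) e, ())) q s () l) =
    interact party (fun (w : List (Fin (n + 1)) × List (Fin (n + 1))) b =>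
      (lazyValue w.1 w.2 (vertex b)).bind fun a => R.map fun e =>
        (ans a e, (w.1 ++ [vertex b], w.2 ++ [a]))) q s (vs, as) l := by
  induction q generalizing s vs as l with
  | zero => simp [interact]
  | succ q ih =>
    simp only [interact, monad_bind_eq_bind, PMF.bind_map, PMF.bind_bind, Function.comp_def]
    -- The message of the party does not depend on the permutation, so it can be drawn first.
    rw [PMF.bind_comm]
    congr 1; funext m
    rw [randomExtension_bind (vertex m.1) h fun a f => R.bind fun e => interact party
      (fun (_ : Unit) b => R.map fun e => (ans (f (vertex b)) e, ())) q m.2 () (l ++ [ans a e])]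
    refine bind_congr_support fun a ha => ?_
    rw [PMF.bind_comm]
    congr 1; funext e
    exact ih _ _ _ _ (consistent_append_nonempty h ha)

end Lazy
end
end SLP

namespace SLP
noncomputable section
open Prog

/-! ## The games -/

/-- Data type of the encrypted table. -/
abbrev TableTy (𝒢 : BilinearGroupGen) : Ty := .prod (BGN.KeyTy 𝒢) (.list (.list 𝒢.Elt))

/-- Data type of trapdoors. -/
abbrev TrapTy : Ty := .prod .nat (.list .bool)

/-- The part of the games after the generation of the table. -/
def play {TTy TauTy : Ty} (A : Adversary TTy TauTy) (k : ℕ) (s : A.St.denote) (T : TTy.denote)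
    {ρ : Type} (env : ρ → ℕ → PMF (TauTy.denote × ρ)) (r : ρ) : PMF Bool :=
  (interact (fun (s : A.St.denote) (l : List TauTy.denote) => A.query.eval (s, (T, l))) env
    (A.q.eval k) s r []).bind fun t => A.guess.eval (t.1, (T, t.2))

/-- Trapdoors with the positions given by a permutation. -/
def permEnv (k : ℕ) (M : GraphTy.denote) (f : Equiv.Perm (Fin (numVertices M))) (_ : Unit) (v : ℕ) :
    PMF (TrapTy.denote × Unit) :=
  (randomBits k).map fun s => (((f (toVertex M v)).val, s), ())

variable {𝒢 : BilinearGroupGen}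

/-- The game with a table of encryptions of the matrix `m` and positions given by `F`. -/
def keyedGame (F : KeyedPerm) (A : Adversary (TableTy 𝒢) TrapTy)
    (m : List Bool → (M : GraphTy.denote) → Fin (numVertices M) → Fin (numVertices M) → ℕ) (k : ℕ) :
    PMF Bool :=
  (randomBits k).bind fun key => (BGN.keyGen 𝒢 k).bind fun ks =>
    (A.start.eval (unary k)).bind fun o => (BGN.encryptRows ks.1 (m key o.1)).bind fun rows =>
      play A k o.2 (ks.1.toData, rows) (permEnv k o.1 (F.perm key _)) ()

/-- The adjacency matrix with rows permuted by `F`. -/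
def permutedEntry (F : KeyedPerm) (key : List Bool) (M : GraphTy.denote)
    (p j : Fin (numVertices M)) : ℕ :=
  open Classical in if (toGraph M).Adj ((F.perm key _).symm p) j then 1 else 0

theorem real_eq (F π : KeyedPerm) (H : GarblingHash) (A : Adversary (TableTy 𝒢) TrapTy) (k : ℕ) :
    real (slpIII 𝒢 F π H) A k = keyedGame F A (permutedEntry F) k := by
  simp only [real, slpIII, SLPIII.keyGen, keyedGame, monad_bind_eq_bind, PMF.bind_bind,
    PMF.pure_bind]
  congr 1; funext key; congr 1; funext ks; congr 1; funext o
  rw [BGN.encryptRows_eq, PMF.bind_map]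
  simp only [SLPIII.encMatrix, monad_bind_eq_bind, PMF.bind_bind, PMF.pure_bind]
  -- Position `p` of the table holds the row of the vertex `F⁻¹(p)`, so the permuted matrix may be
  -- encrypted directly.
  have : (independent fun i => independent fun j =>
      BGN.encrypt ks.1 (permutedEntry F key o.1 i j)) = (independent fun i => independent fun j =>
      BGN.encrypt ks.1 (open Classical in if (toGraph o.1).Adj i j then 1 else 0)).map
        fun x i => x ((F.perm key _).symm i) := by
    rw [independent_comp_equiv]; rfl
  rw [this, PMF.bind_map]
  congr 1; funext x
  simp only [Function.comp, play, SLPIII.trapdoorGen, monad_bind_eq_bind, PMF.map_bind,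
    PMF.pure_map]
  rfl

/-! ### Simulation from leaked trapdoors -/

/-- The table of the simulators. -/
def tableP (𝒢 : BilinearGroupGen) : Prog (.prod (.list .unit) (.list .unit)) (TableTy 𝒢) :=
  letP (v0.comp (BGN.keyGenP 𝒢)) (v0.pair (((Prog.snd.comp .snd).pair v0).comp (BGN.zeroRowsP 𝒢)))

theorem eval_tableP (k N : ℕ) : (tableP 𝒢).eval (unary k, unary N) =
    (BGN.keyGen 𝒢 k).bind fun ks => (BGN.encryptRows ks.1 fun _ _ : Fin N => 0).map
      fun rows => (ks.1.toData, rows) := by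
  simp only [tableP, eval_letP, eval_comp, eval_v0, PMF.pure_bind, BGN.eval_keyGenP, PMF.bind_map]
  refine bind_congr_support fun ks hks => ?_
  simp only [eval_pair, eval_comp, eval_v0, eval_snd, PMF.pure_bind, Function.comp]
  rw [(BGN.valid_of_mem_support hks).eval_zeroRowsP]
  rfl

theorem isPPT_tableP : (tableP 𝒢).IsPPT := by
  refine isPPT_of_polyOn fun X hX => ?_
  have h1 : (v0.comp (BGN.keyGenP 𝒢) : Prog (.prod (.list .unit) (.list .unit)) _).PolyOn X :=
    IsPPT.polyOn (by simp [BGN.isPPT_keyGenP]) hX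
  have b1 := h1.bdd_ext hX
  have h2 : (v0 : Prog (.prod (BGN.KeyTy 𝒢) (.prod (.list .unit) (.list .unit))) _).PolyOn
    (ext (v0.comp (BGN.keyGenP 𝒢)) X) := isPPT_v0.polyOn b1
  have h3 : ((Prog.snd.comp .snd).pair v0 :
    Prog (.prod (BGN.KeyTy 𝒢) (.prod (.list .unit) (.list .unit))) _).PolyOn
    (ext (v0.comp (BGN.keyGenP 𝒢)) X) := IsPPT.polyOn (by simp) b1
  refine h1.letP hX (h2.pair (h3.comp (BGN.polyOn_zeroRowsP h3.bdd_image ?_)))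
  rintro k y ⟨⟨pk, u, N⟩, ⟨hx, hpk⟩, hy⟩
  simp only [eval_pair, eval_comp, eval_v0, eval_snd, PMF.pure_bind,
    PMF.mem_support_pure_iff] at hy hpk
  rw [eq_unary u, BGN.eval_keyGenP, PMF.mem_support_map_iff] at hpk
  obtain ⟨ks, hks, rfl⟩ := hpk
  exact ⟨ks.1, BGN.valid_of_mem_support hks, by rw [hy]⟩

/-- The simulator that gets the trapdoors as leakage. -/
def echoSimulator (𝒢 : BilinearGroupGen) :
    Simulator (TableTy 𝒢) TrapTy (.list .unit) TrapTy where
  St := .unit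
  start := (tableP 𝒢).pair .unit
  next := ((Prog.snd.pair ((Prog.num 0).pair .nil)).comp lastP).pair .unit

theorem echoSimulator_isPPT : (echoSimulator 𝒢).IsPPT := by
  have h1 : (echoSimulator 𝒢).start.IsPPT := by
    simp [echoSimulator, isPPT_tableP]
  have h2 : (echoSimulator 𝒢).next.IsPPT := by
    simp (maxDischargeDepth := 99) [echoSimulator]
  obtain ⟨P, hP⟩ := h1
  obtain ⟨Q, hQ⟩ := h2
  -- The string `1^k` has size `2k + 1` and pairing adds `1`; the other bound counts the state of
  -- size `1` and the pairing.
  refine ⟨P.comp (2 * Polynomial.X + 2) + Q.comp (Polynomial.X + 2), fun k b => ⟨?_, ?_⟩⟩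
  · refine runsWithin_mono (hP _) ?_
    rw [Polynomial.eval_add, Polynomial.eval_comp]
    refine le_add_right (polynomial_eval_mono P ?_)
    rw [Ty.size, size_unary]
    simp only [Polynomial.eval_add, Polynomial.eval_mul, Polynomial.eval_ofNat, Polynomial.eval_X]
    omega
  · intro l s _ a
    refine runsWithin_mono (hQ _) ?_
    rw [Polynomial.eval_add, Polynomial.eval_comp, Polynomial.eval_comp]
    refine le_add_left (polynomial_eval_mono Q ?_)
    have : Ty.size (echoSimulator 𝒢).St s = 1 := rfl
    rw [Ty.size, this]
    simp only [Polynomial.eval_add, Polynomial.eval_ofNat, Polynomial.eval_X]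
    omega

/-- The adversary chooses its graph before it has seen anything, so the choice commutes with key
generation and can come first, as in the ideal games. -/
theorem keyedGame_eq_bind_start (F : KeyedPerm) (A : Adversary (TableTy 𝒢) TrapTy)
    (m : List Bool → (M : GraphTy.denote) → Fin (numVertices M) → Fin (numVertices M) → ℕ) (k : ℕ) :
    keyedGame F A m k = (A.start.eval (unary k)).bind fun o => (randomBits k).bind fun key =>
      (BGN.keyGen 𝒢 k).bind fun ks => (BGN.encryptRows ks.1 (m key o.1)).bind fun rows =>
        play A k o.2 (ks.1.toData, rows) (permEnv k o.1 (F.perm key _)) () := by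
  rw [keyedGame, PMF.bind_comm (A.start.eval (unary k))]
  congr 1; funext key
  exact PMF.bind_comm _ _ _

/-- The game with a table of encryptions of zero. -/
abbrev zeroGame (F : KeyedPerm) (A : Adversary (TableTy 𝒢) TrapTy) (k : ℕ) : PMF Bool :=
  keyedGame F A (fun _ _ _ _ => 0) k

/-- In the ideal game the public key comes from the simulator and the trapdoors from an independent
key generation of the leakage algorithm; in `zeroGame` there is one generation. The distributions
agree since trapdoors depend only on the permutation key. -/
theorem ideal_trapdoorLeakage_eq (F π : KeyedPerm) (H : GarblingHash)
    (A : Adversary (TableTy 𝒢) TrapTy) (k : ℕ) :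
    ideal (slpIII 𝒢 F π H) (trapdoorLeakage (slpIII 𝒢 F π H)) A (echoSimulator 𝒢) k =
      zeroGame F A k := by
  have hstart : ∀ N, (echoSimulator 𝒢).start.eval (unary k, unary N) =
      (BGN.keyGen 𝒢 k).bind fun ks => (BGN.encryptRows ks.1 fun _ _ : Fin N => 0).bind
        fun rows => PMF.pure ((ks.1.toData, rows), ()) := by
    intro N
    simp only [echoSimulator, eval_pair, eval_unit, PMF.pure_bind]
    rw [eval_tableP]
    simp only [PMF.bind_bind, PMF.bind_map, Function.comp_def]
  have hnext : ∀ (l : List TrapTy.denote) (a : TrapTy.denote),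
      (echoSimulator 𝒢).next.eval ((), l ++ [a]) = PMF.pure (a, ()) := by
    intro l a
    simp only [echoSimulator, eval_pair, eval_unit, PMF.pure_bind, eval_comp, eval_snd, eval_num,
      eval_nil, eval_lastP]
    congr 2
    simp
  have hgame : ∀ (s : A.St.denote) (M : GraphTy.denote) (T : (TableTy 𝒢).denote)
      (sk : ℕ × List Bool), (interact
      (fun (s : A.St.denote) (l : List TrapTy.denote) => A.query.eval (s, (T, l)))
      (fun (w : (Unit × (ℕ × List Bool)) × List TrapTy.denote) (v : ℕ) =>
        ((SLPIII.trapdoorGen F k (toVertex M v) w.1.2).map fun τ => (τ, w.1.2)).bind fun a =>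
          ((echoSimulator 𝒢).next.eval (w.1.1, w.2 ++ [a.1])).bind fun τ =>
            PMF.pure (τ.1, ((τ.2, a.2), w.2 ++ [a.1])))
      (A.q.eval k) s (((), sk), []) []).bind (fun t => A.guess.eval (t.1, (T, t.2))) =
        play A k s T (permEnv k M (F.perm sk.2 _)) () := by
    intro s M T sk
    rw [play]
    congr 1
    -- Both environments are compared with one whose only state is the secret key of the leakage
    -- algorithm.
    rw [interact_congr (ρ' := ℕ × List Bool) (env' := fun sk v =>
      (SLPIII.trapdoorGen F k (toVertex M v) sk).map fun τ => (τ, sk)) fun w => w.1.2,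
      interact_congr (env := permEnv k M (F.perm sk.2 _)) (env' := fun sk v =>
      (SLPIII.trapdoorGen F k (toVertex M v) sk).map fun τ => (τ, sk)) fun _ => sk]
    · intro r v
      simp only [permEnv, PMF.map_comp, SLPIII.trapdoorGen, monad_bind_eq_bind, PMF.map_bind,
        PMF.pure_map]
      rfl
    · rintro ⟨⟨⟨⟩, sk⟩, l⟩ v
      simp only [PMF.map_bind, PMF.bind_map, hnext, Function.comp_def]
      rw [← PMF.bind_pure_comp]
      congr 1; funext a
      exact (congrArg (PMF.map _) (PMF.pure_bind _ _)).trans (PMF.pure_map _ _)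
  refine Eq.trans ?_ (keyedGame_eq_bind_start F A _ k).symm
  unfold ideal
  simp only [monad_bind_eq_bind]
  congr 1; funext o
  simp only [trapdoorLeakage, slpIII, SLPIII.keyGen, monad_bind_eq_bind, PMF.map_bind,
    PMF.pure_map, PMF.bind_bind, PMF.pure_bind]
  congr 1; funext key
  have hconst : ∀ {α β : Type} (p : PMF α) (q : PMF β), (p.bind fun _ => q) = q :=
    fun p q => PMF.bind_const p q
  -- A BGN key generation whose result is ignored is inserted, to match the one made by the leakage
  -- algorithm.
  refine (hconst (BGN.keyGen 𝒢 k) _).symm.trans ?_ |>.symm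
  congr 1; funext ks'
  rw [hstart]
  refine (PMF.bind_bind _ _ _).trans ?_ |>.symm
  congr 1; funext ks
  refine (PMF.bind_bind _ _ _).trans ?_
  congr 1; funext rows
  exact (PMF.pure_bind _ _).trans (hgame o.2 o.1 (ks.1.toData, rows) (ks'.2, key))
end
end SLP

namespace SLP
noncomputable section
open Prog
variable {𝒢 : BilinearGroupGen}

/-! ## The simulator that gets the repetition pattern -/

/-- The positions that are not yet in use. -/
def unusedP : Prog (.prod (.list .unit) (.list .nat)) (.list .nat) :=
  ((Prog.fst.comp rangeP).pair .snd).comp (filterP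
    (((((Prog.snd.pair .fst).comp (filterP eqP)).comp lengthP).pair (.num 0)).comp .le))

@[simp] theorem eval_unusedP (x : (Ty.prod (.list .unit) (.list .nat)).denote) :
    unusedP.eval x = PMF.pure ((List.range x.1.length).filter (· ∉ x.2)) := by
  simp only [unusedP, eval_comp, eval_pair, eval_fst, eval_snd, eval_rangeP, PMF.pure_bind]
  refine eval_filterP fun a _ => ?_
  simp only [eval_comp, eval_pair, eval_fst, eval_snd, PMF.pure_bind, eval_num]
  rw [eval_filterP (f := fun b => decide (b = a)) fun b _ => by rw [eval_eqP]]
  simp only [PMF.pure_bind, eval_lengthP, eval_le]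
  congr 1
  rw [decide_eq_decide]
  simp only [Nat.le_zero, List.length_eq_zero_iff, List.filter_eq_nil_iff, decide_eq_true_eq]
  exact ⟨fun h ha => h a ha rfl, fun h b hb he => h (he ▸ hb)⟩

@[simp] theorem isPPT_unusedP : unusedP.IsPPT := by
  simp (maxDischargeDepth := 99) [unusedP]

/-- The simulator that samples the positions of the rows when they are queried first. -/
def lazySimulator (𝒢 : BilinearGroupGen) :
    Simulator (TableTy 𝒢) TrapTy (.list .unit) .nat where
  St := .prod (.prod (.list .unit) (.list .unit)) (.list .nat)
  start := (tableP 𝒢).pair (Prog.id.pair .nil)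
  next :=
    letP ((Prog.snd.pair (.num 0)).comp lastP) <|
    letP (.ite (((v0.pair (.num 1)).comp .add |>.pair ((v1.comp .snd).comp lengthP)).comp .le)
      (((v1.comp .snd).pair (v0.pair (.num 0))).comp nthP)
      (letP ((((v1.comp .fst).comp .snd).pair (v1.comp .snd)).comp unusedP)
        ((v0.pair (((v0.comp lengthP).comp .rand).pair (.num 0))).comp nthP))) <|
    letP (((v2.comp .fst).comp .fst).comp randomBitsP) <|
    (v1.pair v0).pair ((v3.comp .fst).pair
      (((v3.comp .snd).pair ((v1.pair .nil).comp .cons)).comp appendP))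

/-- The position that the simulator chooses. -/
def simulatedPosition (N : ℕ) (as : List ℕ) (p : ℕ) : PMF ℕ :=
  if p < as.length then PMF.pure (as.getD p 0)
  else (unif ((List.range N).filter (· ∉ as)).length).map fun r =>
    ((List.range N).filter (· ∉ as)).getD r 0

theorem eval_lazySimulator_next (k N p : ℕ) (as l : List ℕ) :
    (lazySimulator 𝒢).next.eval (((unary k, unary N), as), l ++ [p]) =
      (simulatedPosition N as p).bind fun a => (randomBits k).bind fun s =>
        PMF.pure ((a, s), ((unary k, unary N), as ++ [a])) := by
  simp only [lazySimulator, eval_letP, eval_comp, eval_pair, eval_fst, eval_snd, eval_num,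
    eval_lastP, PMF.pure_bind, eval_ite, eval_v0, eval_v1, eval_v2, eval_v3, eval_add, eval_lengthP,
    eval_le, eval_nthP, eval_unusedP, eval_rand, PMF.bind_bind, eval_nil, eval_cons, eval_appendP]
  have hlast : (l ++ [p]).getLastD 0 = p := by simp
  have hlen : (unary N).length = N := by simp [unary]
  simp only [hlast, hlen, eval_randomBitsP]
  congr 1
  rw [simulatedPosition]
  simp only [decide_eq_true_eq, Nat.succ_le_iff]
  split_ifs
  · rfl
  · rfl

theorem lazySimulator_next_isPPT : (lazySimulator 𝒢).next.IsPPT := by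
  simp (maxDischargeDepth := 99) [lazySimulator]

/-- Bounds the state for the running time. Reachability allows arbitrary leakages, so the unused
positions may run out; the default position `0` then occurs even for an empty index set, hence `≤`
instead of `<`. -/
theorem lazySimulator_reaches {k : ℕ} {b : (Ty.list .unit).denote}
    {l : List Ty.nat.denote}
    {s : (lazySimulator 𝒢).St.denote} (h : (lazySimulator 𝒢).Reaches k b l s) :
    ∃ as : List ℕ, s = ((unary k, b), as) ∧ as.length = l.length ∧ ∀ a ∈ as, a ≤ b.length := by
  induction h with
  | start h =>
    simp only [lazySimulator, eval_pair, eval_id, eval_nil, PMF.pure_bind] at h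
    obtain ⟨T, _, h⟩ := (PMF.mem_support_bind_iff _ _ _).1 h
    have h' := (PMF.mem_support_pure_iff _ _).1 h
    subst h'
    exact ⟨[], rfl, rfl, by simp⟩
  | @step l s a o _ ho ih =>
    obtain ⟨as, rfl, hlen, has⟩ := ih
    rw [eq_unary b] at ho
    have ho' := (eval_lazySimulator_next (𝒢 := 𝒢) k b.length a as l) ▸ ho
    obtain ⟨c, hc, h⟩ := (PMF.mem_support_bind_iff _ _ _).1 ho'
    obtain ⟨e, _, h⟩ := (PMF.mem_support_bind_iff _ _ _).1 h
    have h' := (PMF.mem_support_pure_iff _ _).1 h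
    subst h'
    refine ⟨as ++ [c], by rw [← eq_unary b], by simp [hlen], fun x hx => ?_⟩
    rcases List.mem_append.1 hx with hx | hx
    · exact has x hx
    · rw [List.mem_singleton] at hx
      subst hx
      rw [simulatedPosition] at hc
      split_ifs at hc with hlt
      · rw [PMF.mem_support_pure_iff] at hc
        rw [hc, List.getD_eq_getElem _ _ hlt]
        exact has _ (List.getElem_mem _)
      · rw [PMF.mem_support_map_iff] at hc
        obtain ⟨r, _, rfl⟩ := hc
        rw [List.getD_eq_getElem?_getD]
        rcases h : ((List.range b.length).filter (· ∉ as))[r]? with _ | y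
        · simp
        · have := List.mem_of_getElem? h
          simp only [List.mem_filter, List.mem_range] at this
          exact this.1.le

theorem nat_size_le_self (a : ℕ) : Nat.size a ≤ a := Nat.size_le.2 Nat.lt_two_pow_self

theorem lazySimulator_isPPT : (lazySimulator 𝒢).IsPPT := by
  have h1 : (lazySimulator 𝒢).start.IsPPT := by
    simp (maxDischargeDepth := 99) [lazySimulator, isPPT_tableP]
  obtain ⟨P, hP⟩ := h1
  obtain ⟨Q, hQ⟩ := lazySimulator_next_isPPT (𝒢 := 𝒢)
  -- The product bounds the list of positions: one per query, each of size at most `N + 1`, with one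
  -- more unit per list entry. The remaining terms cover the unary numbers, the leakages and the
  -- pairings.
  refine ⟨P.comp (2 * Polynomial.X + 2) + Q.comp (Polynomial.X * (Polynomial.X + 2) +
    5 * Polynomial.X + 10), fun k b => ⟨?_, ?_⟩⟩
  · refine runsWithin_mono (hP _) ?_
    rw [Polynomial.eval_add, Polynomial.eval_comp]
    refine le_add_right (polynomial_eval_mono P ?_)
    rw [Ty.size, size_unary]
    simp only [Polynomial.eval_add, Polynomial.eval_mul, Polynomial.eval_ofNat, Polynomial.eval_X]
    omega
  · intro l s hs a
    obtain ⟨as, rfl, hlen, has⟩ := lazySimulator_reaches hs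
    refine runsWithin_mono (hQ _) ?_
    rw [Polynomial.eval_add, Polynomial.eval_comp, Polynomial.eval_comp]
    refine le_add_left (polynomial_eval_mono Q ?_)
    have hb := length_le_size (σ := .unit) b
    have h1 : Ty.size (.list .nat) as ≤ as.length * (b.length + 1 + 1) + 1 :=
      size_list_le (σ := .nat) as fun a ha => by
        have := nat_size_le_self a
        have := has a ha
        simp only [Ty.size]; omega
    have h2 := length_le_size (σ := .nat) (l ++ [a])
    rw [List.length_append] at h2
    have h3 : Ty.size (.prod (.prod (.list .unit) (.list .unit)) (.list .nat))
        ((unary k, b), as) = 2 * k + 1 + Ty.size (.list .unit) b + 1 +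
          Ty.size (.list .nat) as + 1 := by
      rw [Ty.size, Ty.size, size_unary]
    have h4 : Ty.size (.prod (lazySimulator 𝒢).St (.list .nat)) (((unary k, b), as), l ++ [a]) =
      Ty.size (.prod (.prod (.list .unit) (.list .unit)) (.list .nat))
        ((unary k, b), as) + Ty.size (.list .nat) (l ++ [a]) + 1 := rfl
    refine h4.le.trans ?_
    rw [h3]
    simp only [Polynomial.eval_add, Polynomial.eval_mul, Polynomial.eval_ofNat, Polynomial.eval_X]
    change 2 * k + 1 + Ty.size (.list .unit) b + 1 + Ty.size (.list .nat) as + 1 +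
      Ty.size (.list .nat) (l ++ [a]) + 1 ≤ (k + Ty.size (.list .unit) b +
        Ty.size (.list .nat) (l ++ [a])) * (k + Ty.size (.list .unit) b +
        Ty.size (.list .nat) (l ++ [a]) + 2) + 5 * (k + Ty.size (.list .unit) b +
        Ty.size (.list .nat) (l ++ [a])) + 10
    have h5 : as.length * (b.length + 1 + 1) ≤ (k + Ty.size (.list .unit) b +
        Ty.size (.list .nat) (l ++ [a])) * (k + Ty.size (.list .unit) b +
        Ty.size (.list .nat) (l ++ [a]) + 2) := Nat.mul_le_mul (by omega) (by omega)
    omega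

/-- The game with a table of encryptions of zero and random positions. -/
def randomGame (A : Adversary (TableTy 𝒢) TrapTy) (k : ℕ) : PMF Bool :=
  (A.start.eval (unary k)).bind fun o => (BGN.keyGen 𝒢 k).bind fun ks =>
    (BGN.encryptRows ks.1 fun _ _ : Fin (numVertices o.1) => 0).bind fun rows =>
      (PMF.uniformOfFintype (Equiv.Perm (Fin (numVertices o.1)))).bind fun f =>
        play A k o.2 (ks.1.toData, rows) (permEnv k o.1 f) ()

/-- The lazy value depends on the queried vertices only through the index of the first occurrence,
which is exactly the leakage. -/
theorem lazyValue_map_val {n : ℕ} (vs as : List (Fin (n + 1))) (v : Fin (n + 1)) :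
    (lazyValue vs as v).map Fin.val =
      simulatedPosition (n + 1) (as.map Fin.val) ((vs.map Fin.val ++ [v.val]).idxOf v.val) := by
  have h1 : (vs.map Fin.val ++ [v.val]).idxOf v.val = (vs ++ [v]).idxOf v := by
    have hinj : ∀ l : List (Fin (n + 1)), (l.map Fin.val).idxOf v.val = l.idxOf v := by
      intro l; induction l with
      | nil => rfl
      | cons a l ih => simp [List.idxOf_cons, ih, Fin.ext_iff, beq_eq_decide]
    rw [← hinj]; simp
  have h2 : (List.range (n + 1)).filter (· ∉ as.map Fin.val) =
      ((List.finRange (n + 1)).filter (· ∉ as)).map Fin.val := by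
    rw [← List.map_coe_finRange_eq_range, List.filter_map]
    congr 1
    refine List.filter_congr fun a _ => ?_
    rw [Bool.eq_iff_iff]; simp only [decide_not, Bool.not_eq_eq_eq_not, Bool.not_true,
      decide_eq_false_iff_not, Function.comp, List.mem_map, Fin.val_inj, exists_eq_right]
  have h3 : ∀ (l : List (Fin (n + 1))) i, (l.map Fin.val).getD i 0 = (l.getD i 0).val :=
    fun l i => List.getD_map l 0 Fin.val
  rw [lazyValue, simulatedPosition, h1, h2]
  simp only [List.length_map, h3]
  split_ifs
  · rw [PMF.pure_map]
  · rw [PMF.map_comp]; rfl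

theorem interact_lazySimulator {σ : Type} {n : ℕ} (party : σ → List TrapTy.denote → PMF (ℕ × σ))
    (vertex : ℕ → Fin (n + 1)) (k q : ℕ) (s : σ) :
    interact party
      (fun (w : ((lazySimulator 𝒢).St.denote × List ℕ) × List ℕ) (v : ℕ) =>
        (PMF.pure ((w.1.2 ++ [(vertex v).val]).idxOf (vertex v).val,
          w.1.2 ++ [(vertex v).val])).bind fun a =>
          ((lazySimulator 𝒢).next.eval (w.1.1, w.2 ++ [a.1])).bind fun τ =>
            PMF.pure (τ.1, ((τ.2, a.2), w.2 ++ [a.1])))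
      q s ((((unary k, unary (n + 1)), []), []), []) [] =
    (PMF.uniformOfFintype (Equiv.Perm (Fin (n + 1)))).bind fun f => interact party
      (fun (_ : Unit) v => (randomBits k).map fun e => (((f (vertex v)).val, e), ())) q s () [] := by
  have := interact_randomExtension party vertex (randomBits k)
    (fun a e => ((a.val, e) : TrapTy.denote)) q s [] [] [] ⟨1, by simp [consistent]⟩
  rw [randomExtension_nil] at this
  refine Eq.trans ?_ this.symm
  -- A common refinement, which remembers vertices, positions and leakages: forgetting the leakages
  -- gives lazy sampling, and passing to the underlying numbers gives the simulator.
  let env (w : (List (Fin (n + 1)) × List (Fin (n + 1))) × List ℕ) (v : ℕ) :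
    PMF (TrapTy.denote × ((List (Fin (n + 1)) × List (Fin (n + 1))) × List ℕ)) :=
    (lazyValue w.1.1 w.1.2 (vertex v)).bind fun a => (randomBits k).map fun e =>
      ((a.val, e), ((w.1.1 ++ [vertex v], w.1.2 ++ [a]),
        w.2 ++ [(w.1.1.map Fin.val ++ [(vertex v).val]).idxOf (vertex v).val]))
  have h1 := interact_congr (party := party) (env := env) (env' := fun w v =>
      (lazyValue w.1 w.2 (vertex v)).bind fun a => (randomBits k).map fun e =>
        (((a.val, e) : TrapTy.denote), (w.1 ++ [vertex v], w.2 ++ [a]))) (fun w => w.1)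
    (by
      rintro ⟨⟨vs, as⟩, l⟩ v
      simp only [env, PMF.map_bind, PMF.map_comp]
      rfl) q s (([], []), []) []
  have h2 := interact_congr (party := party) (env := env)
    (env' := fun (w : ((lazySimulator 𝒢).St.denote × List ℕ) × List ℕ) (v : ℕ) =>
        (PMF.pure ((w.1.2 ++ [(vertex v).val]).idxOf (vertex v).val,
          w.1.2 ++ [(vertex v).val])).bind fun a =>
          ((lazySimulator 𝒢).next.eval (w.1.1, w.2 ++ [a.1])).bind fun τ =>
            PMF.pure (τ.1, ((τ.2, a.2), w.2 ++ [a.1])))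
    (fun w => ((((unary k, unary (n + 1)), w.1.2.map Fin.val), w.1.1.map Fin.val), w.2))
    (by
      rintro ⟨⟨vs, as⟩, l⟩ v
      refine Eq.trans ?_ (PMF.pure_bind _ _).symm
      refine Eq.trans ?_ (congrArg (fun p => PMF.bind p _)
        (eval_lazySimulator_next (𝒢 := 𝒢) k (n + 1) _ _ _)).symm
      simp only [env, PMF.map_bind, PMF.map_comp, ← lazyValue_map_val]
      rw [PMF.bind_map]
      refine Eq.trans ?_ (PMF.bind_bind _ _ _).symm
      congr 1; funext a
      refine Eq.trans ?_ (PMF.bind_bind _ _ _).symm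
      rw [← PMF.bind_pure_comp]
      congr 1; funext e
      refine Eq.trans ?_ (PMF.pure_bind _ _).symm
      simp [Function.comp_def]) q s (([], []), []) []
  exact h2.symm.trans h1

theorem ideal_repetitionLeakage_eq (F π : KeyedPerm) (H : GarblingHash)
    (A : Adversary (TableTy 𝒢) TrapTy) (k : ℕ) :
    ideal (slpIII 𝒢 F π H) repetitionLeakage A (lazySimulator 𝒢) k = randomGame A k := by
  have hstart : ∀ N, (lazySimulator 𝒢).start.eval (unary k, unary N) =
      (BGN.keyGen 𝒢 k).bind fun ks => (BGN.encryptRows ks.1 fun _ _ : Fin N => 0).bind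
        fun rows => PMF.pure ((ks.1.toData, rows), ((unary k, unary N), [])) := by
    intro N
    simp only [lazySimulator, eval_pair, eval_id, eval_nil, PMF.pure_bind]
    rw [eval_tableP]
    simp only [PMF.bind_bind, PMF.bind_map, Function.comp_def]
  unfold ideal
  simp only [monad_bind_eq_bind]
  rw [randomGame]
  congr 1; funext o
  refine (PMF.pure_bind _ _).trans ?_
  refine (congrArg (fun p => PMF.bind p _) (hstart _)).trans ?_
  refine (PMF.bind_bind _ _ _).trans ?_
  congr 1; funext ks
  refine (PMF.bind_bind _ _ _).trans ?_
  congr 1; funext rows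
  refine (PMF.pure_bind _ _).trans ?_
  have := interact_lazySimulator (𝒢 := 𝒢) (n := o.1.2.length)
    (fun (s : A.St.denote) (l : List TrapTy.denote) =>
      A.query.eval (s, ((ks.1.toData, rows), l))) (toVertex o.1) k (A.q.eval k) o.2
  refine (congrArg (fun p => PMF.bind p _) this).trans ?_
  exact PMF.bind_bind _ _ _
end
end SLP

namespace SLP
noncomputable section
open Prog
variable {𝒢 : BilinearGroupGen}

/-! ## The distinguisher for the pseudorandom permutation -/

/-- Form trapdoors from positions and keys. -/
def trapdoorsP : Prog (.prod (.list .nat) (.list (.list .bool))) (.list TrapTy) :=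
  ((Prog.fst.comp rangeP).pair .id).comp (mapP
    ((((Prog.snd.comp .fst).pair (Prog.fst.pair (.num 0))).comp nthP).pair
      (((Prog.snd.comp .snd).pair (Prog.fst.pair .nil)).comp nthP)))

theorem eval_trapdoorsP (l : List ℕ) (ss : List (List Bool)) (h : ss.length = l.length) :
    trapdoorsP.eval (l, ss) = PMF.pure (l.zip ss) := by
  simp only [trapdoorsP, eval_comp, eval_pair, eval_fst, eval_snd, eval_rangeP, eval_id, eval_num,
    eval_nil, eval_nthP, eval_mapP, PMF.pure_bind]
  rw [mapList_eq_pure (g := fun i => (l.getD i 0, ss.getD i [])) fun _ _ => rfl]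
  congr 1
  refine List.ext_getElem (by simp [h]) fun i h1 h2 => ?_
  simp only [List.length_map, List.length_range] at h1
  have h3 : i < ss.length := h ▸ h1
  have e1 := List.getD_eq_getElem l 0 h1
  have e2 := List.getD_eq_getElem ss [] h3
  simp [h1, h3]

@[simp] theorem isPPT_trapdoorsP : trapdoorsP.IsPPT := by
  simp (maxDischargeDepth := 99) [trapdoorsP]

/-- The number of vertices of a graph in unary. -/
def verticesP : Prog GraphTy (.list .unit) := (Prog.cons.pair .unit).comp (mapP .unit)

@[simp] theorem eval_verticesP (M : GraphTy.denote) :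
    verticesP.eval M = PMF.pure (unary (numVertices M)) := by
  simp only [verticesP, eval_comp, eval_pair, eval_cons, eval_unit, eval_mapP, PMF.pure_bind]
  rw [mapList_eq_pure (g := fun _ => ()) fun _ _ => rfl]
  simp [unary, numVertices, List.replicate_succ]

@[simp] theorem isPPT_verticesP : verticesP.IsPPT := by
  simp (maxDischargeDepth := 99) [verticesP]

/-- The distinguisher that runs an adversary on a table of encryptions of zero. -/
def distinguisher (A : Adversary (TableTy 𝒢) TrapTy) : PRP.Distinguisher where
  St := .prod A.St (.prod (TableTy 𝒢) (.prod (.prod (.list .unit) .nat) (.list (.list .bool))))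
  q := A.q
  start := letP A.start <| letP ((v0.comp .fst).comp verticesP) <|
    letP (((Prog.snd.comp .snd).pair v0).comp (tableP 𝒢)) <|
    v1.pair ((v2.comp .snd).pair (v0.pair (((Prog.snd.comp (Prog.snd.comp .snd)).pair
      (v1.comp lengthP)).pair .nil)))
  query := letP ((Prog.snd.pair (v0.comp (.comp .snd (.comp .snd .snd)))).comp trapdoorsP) <|
    letP (((v1.comp .fst).pair ((v1.comp (.comp .snd .fst)).pair v0)).comp A.query) <|
    letP ((v2.comp (.comp .snd (.comp .snd (.comp .fst .fst)))).comp randomBitsP) <|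
    (((v1.comp .fst).pair (v3.comp (.comp .snd (.comp .snd (.comp .fst .snd))))).comp .mod).pair
      ((v1.comp .snd).pair ((v3.comp (.comp .snd .fst)).pair
        ((v3.comp (.comp .snd (.comp .snd .fst))).pair
          (((v3.comp (.comp .snd (.comp .snd .snd))).pair ((v0.pair .nil).comp .cons)).comp
            appendP))))
  guess := letP ((Prog.snd.pair (v0.comp (.comp .snd (.comp .snd .snd)))).comp trapdoorsP) <|
    ((v1.comp .fst).pair ((v1.comp (.comp .snd .fst)).pair v0)).comp A.guess

variable (A : Adversary (TableTy 𝒢) TrapTy)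

theorem eval_distinguisher_start (k : ℕ) : (distinguisher A).start.eval (unary k) =
    (A.start.eval (unary k)).bind fun o => (BGN.keyGen 𝒢 k).bind fun ks =>
      (BGN.encryptRows ks.1 fun _ _ : Fin (numVertices o.1) => 0).bind fun rows =>
        PMF.pure (unary (numVertices o.1), (o.2, ((ks.1.toData, rows),
          ((unary k, numVertices o.1), [])))) := by
  simp only [distinguisher, eval_letP, eval_comp, eval_pair, eval_fst, eval_snd, eval_v0, eval_v1,
    eval_v2, eval_nil, eval_lengthP, eval_verticesP, PMF.pure_bind]
  congr 1; funext o
  rw [eval_tableP]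
  simp only [PMF.bind_bind, PMF.bind_map, Function.comp_def]
  congr 1; funext ks; congr 1; funext rows
  simp [unary]

theorem eval_distinguisher_query (k N : ℕ) (s : A.St.denote) (T : (TableTy 𝒢).denote) (l : List ℕ)
    (ss : List (List Bool)) (h : ss.length = l.length) :
    (distinguisher A).query.eval ((s, (T, ((unary k, N), ss))), l) =
      (A.query.eval (s, (T, l.zip ss))).bind fun m => (randomBits k).bind fun e =>
        PMF.pure (m.1 % N, (m.2, (T, ((unary k, N), ss ++ [e])))) := by
  simp only [distinguisher, eval_letP, eval_comp, eval_pair, eval_fst, eval_snd, eval_v0, eval_v1,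
    eval_v2, eval_v3, eval_nil, eval_cons, eval_appendP, eval_mod, PMF.pure_bind]
  rw [eval_trapdoorsP l ss h]
  simp only [PMF.pure_bind, eval_randomBitsP]

theorem eval_distinguisher_guess (k N : ℕ) (s : A.St.denote) (T : (TableTy 𝒢).denote) (l : List ℕ)
    (ss : List (List Bool)) (h : ss.length = l.length) :
    (distinguisher A).guess.eval ((s, (T, ((unary k, N), ss))), l) =
      A.guess.eval (s, (T, l.zip ss)) := by
  simp only [distinguisher, eval_letP, eval_comp, eval_pair, eval_fst, eval_snd, eval_v0, eval_v1,
    PMF.pure_bind]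
  rw [eval_trapdoorsP l ss h]
  simp only [PMF.pure_bind]

theorem zip_concat {α β : Type} {l : List α} {ss : List β} (h : ss.length = l.length) (a : α)
    (b : β) : (l ++ [a]).zip (ss ++ [b]) = l.zip ss ++ [(a, b)] := by
  rw [List.zip_append h.symm]; rfl

/-- The oracle supplies positions only, so the distinguisher draws the second components of the
trapdoors itself, keeps them in its state and zips them with the answers. Both programs are abstract
here, so that the induction does not involve their code. -/
theorem interact_simulate {X St : Type} {k : ℕ} {M : GraphTy.denote}
    (f : Equiv.Perm (Fin (numVertices M))) (query : St → List TrapTy.denote → PMF (ℕ × St))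
    (guess : St → List TrapTy.denote → PMF Bool) (state : St → List (List Bool) → X)
    (query' : X → List ℕ → PMF (ℕ × X)) (guess' : X → List ℕ → PMF Bool)
    (hquery : ∀ s l ss, ss.length = l.length → query' (state s ss) l =
      (query s (l.zip ss)).bind fun m => (randomBits k).bind fun e =>
        PMF.pure (m.1 % numVertices M, state m.2 (ss ++ [e])))
    (hguess : ∀ s l ss, ss.length = l.length → guess' (state s ss) l = guess s (l.zip ss))
    (q : ℕ) (s : St) (l : List ℕ) (ss : List (List Bool)) (h : ss.length = l.length) :
    (interact query' (fun (_ : Unit) (x : ℕ) => PMF.pure (PRP.answer f x, ())) q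
        (state s ss) () l).bind (fun t => guess' t.1 t.2) =
    (interact query (permEnv k M f) q s () (l.zip ss)).bind fun t => guess t.1 t.2 := by
  induction q generalizing s l ss with
  | zero => simp only [interact, PMF.pure_bind, hguess s l ss h]
  | succ q ih =>
    simp only [interact, monad_bind_eq_bind, hquery s l ss h, PMF.bind_bind, permEnv, PMF.bind_map,
      PMF.pure_bind, Function.comp_def]
    congr 1; funext m; congr 1; funext e
    -- The query was reduced modulo the number of vertices, so the oracle never gives its default
    -- answer.
    have hans : PRP.answer f (m.1 % numVertices M) = (f (toVertex M m.1)).val := by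
      exact dif_pos (Nat.mod_lt m.1 (show numVertices M > 0 from Nat.succ_pos _))
    rw [hans, ih _ _ _ (by simp [h]), zip_concat h]

theorem interact_distinguisher (k : ℕ) (M : GraphTy.denote)
    (f : Equiv.Perm (Fin (numVertices M))) (T : (TableTy 𝒢).denote) (s : A.St.denote) :
    (interact (fun (s : (distinguisher A).St.denote) (l : List ℕ) =>
        (distinguisher A).query.eval (s, l))
      (fun (_ : Unit) (x : ℕ) => PMF.pure (PRP.answer f x, ())) ((distinguisher A).q.eval k)
        (s, (T, ((unary k, numVertices M), []))) () []).bind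
      (fun t => (distinguisher A).guess.eval (t.1, t.2)) = play A k s T (permEnv k M f) () :=
  interact_simulate f (fun s l => A.query.eval (s, (T, l))) (fun s l => A.guess.eval (s, (T, l)))
    (fun s ss => (s, (T, ((unary k, numVertices M), ss))))
    (fun s l => (distinguisher A).query.eval (s, l))
    (fun s l => (distinguisher A).guess.eval (s, l))
    (fun s l ss => eval_distinguisher_query A k _ s T l ss)
    (fun s l ss => eval_distinguisher_guess A k _ s T l ss) (A.q.eval k) s [] [] rfl

theorem experiment_distinguisher (oracle : (N : ℕ) → PMF (Equiv.Perm (Fin N))) (k : ℕ) :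
    PRP.experiment oracle (distinguisher A) k =
      (A.start.eval (unary k)).bind fun o => (BGN.keyGen 𝒢 k).bind fun ks =>
      (BGN.encryptRows ks.1 fun _ _ : Fin (numVertices o.1) => 0).bind fun rows =>
        (oracle (numVertices o.1)).bind fun f =>
          play A k o.2 (ks.1.toData, rows) (permEnv k o.1 f) () := by
  unfold PRP.experiment
  simp only [monad_bind_eq_bind]
  refine (congrArg (fun p => PMF.bind p _) (eval_distinguisher_start A k)).trans ?_
  refine (PMF.bind_bind _ _ _).trans ?_
  congr 1; funext o
  refine (PMF.bind_bind _ _ _).trans ?_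
  congr 1; funext ks
  refine (PMF.bind_bind _ _ _).trans ?_
  congr 1; funext rows
  refine (PMF.pure_bind _ _).trans ?_
  have hlen : (unary (numVertices o.1)).length = numVertices o.1 := by simp [unary]
  -- The size of the index set arrives as the length of a unary list. It is generalised because the
  -- type of `f` depends on it.
  have key : ∀ N, N = numVertices o.1 → ((oracle N).bind fun f => (interact
      (fun (s : (distinguisher A).St.denote) (l : List ℕ) => (distinguisher A).query.eval (s, l))
      (fun (_ : Unit) (x : ℕ) => PMF.pure (PRP.answer f x, ())) ((distinguisher A).q.eval k)
        (o.2, ((ks.1.toData, rows), ((unary k, numVertices o.1), []))) () []).bind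
      (fun t => (distinguisher A).guess.eval (t.1, t.2))) = (oracle (numVertices o.1)).bind fun f =>
          play A k o.2 (ks.1.toData, rows) (permEnv k o.1 f) () := by
    rintro N rfl
    congr 1; funext f
    exact interact_distinguisher A k o.1 f _ _
  exact key _ hlen

theorem experiment_keyed_eq (F : KeyedPerm) (k : ℕ) :
    PRP.experiment (fun N => (randomBits k).map fun key => F.perm key N) (distinguisher A) k =
      zeroGame F A k := by
  rw [experiment_distinguisher, zeroGame, keyedGame_eq_bind_start]
  congr 1; funext o
  simp only [PMF.bind_map, Function.comp_def]
  rw [PMF.bind_comm (randomBits k)]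
  congr 1; funext ks
  exact PMF.bind_comm _ _ _

theorem experiment_random_eq (k : ℕ) :
    PRP.experiment (fun N => PMF.uniformOfFintype (Equiv.Perm (Fin N))) (distinguisher A) k =
      randomGame A k := experiment_distinguisher A _ k

/-! ### Running time -/

theorem size_zip_le {α β : Ty} (l : List α.denote) (ss : List β.denote) :
    Ty.size (.list (.prod α β)) (l.zip ss) ≤ Ty.size (.list α) l + Ty.size (.list β) ss := by
  induction l generalizing ss with
  | nil => simp [Ty.size]
  | cons a l ih =>
    cases ss with
    | nil => simp [Ty.size]
    | cons b ss =>
      have := ih ss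
      simp only [Ty.size, List.zip_cons_cons, List.map_cons, List.sum_cons] at *
      omega

variable {A}

theorem distinguisher_start_isPPT (hA : A.start.IsPPT) : (distinguisher A).start.IsPPT := by
  simp (maxDischargeDepth := 99) [distinguisher, hA, isPPT_tableP]

theorem Adversary.IsPPT.start_isPPT {TTy TauTy : Ty} {A : Adversary TTy TauTy} (hA : A.IsPPT) :
    A.start.IsPPT := by
  obtain ⟨P, hP⟩ := hA
  refine ⟨P, fun x => ?_⟩
  rw [eq_unary x, size_unary]
  exact runsWithin_mono (hP _).1 (polynomial_eval_mono P (by omega))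

theorem mem_support_randomBits {k : ℕ} {e : List Bool} (h : e ∈ (randomBits k).support) :
    e.length = k := by
  rw [randomBits, PMF.mem_support_map_iff] at h
  obtain ⟨f, _, rfl⟩ := h
  simp

theorem size_trapdoors_le {k : ℕ} {l : List ℕ} {ss : List (List Bool)} (h : ss.length = l.length)
    (hss : ∀ e ∈ ss, e.length = k) : Ty.size (.list TrapTy) (l.zip ss) ≤
      Ty.size (.list .nat) l + (Ty.size (.list .nat) l * (2 * k + 2) + 1) := by
  refine (size_zip_le (α := .nat) (β := .list .bool) l ss).trans (Nat.add_le_add_left ?_ _)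
  have h2 : Ty.size (.list (.list .bool)) ss = ss.length * (2 * k + 1 + 1) + 1 :=
    size_list_eq (σ := .list .bool) ss fun e he => by
      rw [size_list_eq (σ := .bool) e (c := 1) fun _ _ => rfl, hss e he, mul_comm]
  have h3 := length_le_size (σ := .nat) l
  have h4 : ss.length * (2 * k + 1 + 1) ≤ Ty.size (.list .nat) l * (2 * k + 2) :=
    Nat.mul_le_mul (by omega) (by omega)
  omega

/-- The index `n` of the family may exceed the security parameter `k`: for the distinguisher it also
counts the length of the answers received. -/
theorem Adversary.IsPPT.polyOn_query {TTy TauTy : Ty} {A : Adversary TTy TauTy} (hA : A.IsPPT)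
    {X : ℕ → Set (Ty.prod A.St (.prod TTy (.list TauTy))).denote} (hX : Bdd _ X)
    (h : ∀ n, ∀ x ∈ X n, ∃ k ≤ n, A.Reaches k x.2.1 x.2.2 x.1 ∧ x.2.2.length < A.q.eval k) :
    A.query.PolyOn X := by
  obtain ⟨P, hP⟩ := hA
  obtain ⟨Q, hQ⟩ := hX
  refine ⟨P.comp (Polynomial.X + Q), fun n x hx => ?_⟩
  obtain ⟨k, hk, hr, hl⟩ := h n x hx
  refine runsWithin_mono (((hP k).2 _ _ _ hr).1 hl) ?_
  rw [Polynomial.eval_comp]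
  refine polynomial_eval_mono P ?_
  have : A.St.size x.1 + Ty.size (.prod TTy (.list TauTy)) (x.2.1, x.2.2) + 1 ≤ Q.eval n := hQ n x hx
  simp only [Polynomial.eval_add, Polynomial.eval_X]
  omega

theorem Adversary.IsPPT.polyOn_guess {TTy TauTy : Ty} {A : Adversary TTy TauTy} (hA : A.IsPPT)
    {X : ℕ → Set (Ty.prod A.St (.prod TTy (.list TauTy))).denote} (hX : Bdd _ X)
    (h : ∀ n, ∀ x ∈ X n, ∃ k ≤ n, A.Reaches k x.2.1 x.2.2 x.1 ∧ x.2.2.length = A.q.eval k) :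
    A.guess.PolyOn X := by
  obtain ⟨P, hP⟩ := hA
  obtain ⟨Q, hQ⟩ := hX
  refine ⟨P.comp (Polynomial.X + Q), fun n x hx => ?_⟩
  obtain ⟨k, hk, hr, hl⟩ := h n x hx
  refine runsWithin_mono (((hP k).2 _ _ _ hr).2 hl) ?_
  rw [Polynomial.eval_comp]
  refine polynomial_eval_mono P ?_
  have : A.St.size x.1 + Ty.size (.prod TTy (.list TauTy)) (x.2.1, x.2.2) + 1 ≤ Q.eval n := hQ n x hx
  simp only [Polynomial.eval_add, Polynomial.eval_X]
  omega

/-- Reachable states of the distinguisher contain reachable states of the adversary, which is what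
its time bound requires. `R₁` bounds the data fixed at the start. `R` bounds the adversary's state,
only up to `A.q.eval k` answers, since nothing is promised about later queries. -/
theorem distinguisher_reaches (hA : A.IsPPT) : ∃ R₁ R : Polynomial ℕ, ∀ k l s,
    (distinguisher A).Reaches k l s → ∃ sA T N ss, s = (sA, (T, ((unary k, N), ss))) ∧
      ss.length = l.length ∧ (∀ e ∈ ss, e.length = k) ∧ A.Reaches k T (l.zip ss) sA ∧
      (TableTy 𝒢).size T ≤ R₁.eval k ∧ Ty.size .nat N ≤ R₁.eval k ∧
      (l.length ≤ A.q.eval k → A.St.size sA ≤ R.eval (k + Ty.size (.list .nat) l)) := by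
  obtain ⟨P, hP⟩ := distinguisher_start_isPPT hA.start_isPPT
  obtain ⟨Q, hQ⟩ := hA
  let R₁ : Polynomial ℕ := P.comp (2 * Polynomial.X + 1)
  -- Bounds the security parameter plus the size of the adversary's messages: table, positions, and
  -- one `k`-bit string per position.
  let B : Polynomial ℕ := Polynomial.X + (R₁ + (Polynomial.X +
    (Polynomial.X * (2 * Polynomial.X + 2) + 1)) + 1)
  refine ⟨R₁, R₁ + Q.comp B, fun k l s hs => ?_⟩
  unfold PRP.Distinguisher.Reaches at hs
  induction hs with
  | start h =>
    obtain ⟨o, ho, rfl⟩ := h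
    have hsize := (hP (unary k)).size_le ho
    have hPR : P.eval (Ty.size (.list .unit) (unary k)) = R₁.eval k := by
      rw [size_unary]; simp [R₁]
    rw [eval_distinguisher_start] at ho
    obtain ⟨oA, hoA, ho⟩ := (PMF.mem_support_bind_iff _ _ _).1 ho
    obtain ⟨ks, hks, ho⟩ := (PMF.mem_support_bind_iff _ _ _).1 ho
    obtain ⟨rows, hrows, ho⟩ := (PMF.mem_support_bind_iff _ _ _).1 ho
    have ho' := (PMF.mem_support_pure_iff _ _).1 ho
    subst ho'
    rw [hPR] at hsize
    change Ty.size (.list .unit) (unary (numVertices oA.1)) + (A.St.size oA.2 +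
      ((TableTy 𝒢).size (ks.1.toData, rows) + ((Ty.size (.list .unit) (unary k) +
        Ty.size .nat (numVertices oA.1) + 1) + Ty.size (.list (.list .bool)) [] + 1) + 1) + 1) + 1
        ≤ _ at hsize
    refine ⟨oA.2, (ks.1.toData, rows), numVertices oA.1, [], rfl, rfl, by simp,
      .start ⟨oA, hoA, rfl⟩, le_trans ?_ hsize, le_trans ?_ hsize, fun _ => ?_⟩
    · omega
    · omega
    · rw [Polynomial.eval_add]
      refine le_add_right (le_trans ?_ (hsize.trans (polynomial_eval_mono R₁ (Nat.le_add_right k _))))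
      omega
  | @step l s m hs hm a ih =>
    obtain ⟨sA, T, N, ss, rfl, hlen, hss, hreach, hT, hN, hsA⟩ := ih
    have hm' := (eval_distinguisher_query A k N sA T l ss hlen) ▸ hm
    obtain ⟨c, hc, hm⟩ := (PMF.mem_support_bind_iff _ _ _).1 hm'
    obtain ⟨e, he, hm⟩ := (PMF.mem_support_bind_iff _ _ _).1 hm
    have ho' := (PMF.mem_support_pure_iff _ _).1 hm
    subst ho'
    refine ⟨c.2, T, N, ss ++ [e], rfl, by simp [hlen], ?_, ?_, hT, hN, fun hl => ?_⟩
    · intro x hx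
      rcases List.mem_append.1 hx with hx | hx
      · exact hss x hx
      · rw [List.mem_singleton.1 hx]; exact mem_support_randomBits he
    · rw [zip_concat hlen]
      exact .step hreach hc (a, e)
    · have hl' : (l.zip ss).length < A.q.eval k := by
        simp only [List.length_append, List.length_singleton] at hl
        simp only [List.length_zip]
        omega
      have h1 := (((hQ k).2 T _ _ hreach).1 hl').size_le hc
      have h2 : A.St.size c.2 ≤ Ty.size (.prod .nat A.St) c := by rw [Ty.size]; omega
      rw [Polynomial.eval_add, Polynomial.eval_comp (p := Q)]
      refine le_add_left (h2.trans (h1.trans (polynomial_eval_mono Q ?_)))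
      have h3 := size_trapdoors_le hlen hss
      have h4 := size_append (σ := .nat) l [a]
      have h5 : 1 ≤ Ty.size (.list .nat) [a] := by simp [Ty.size]
      have h6 : Ty.size (.list .nat) l ≤ Ty.size (.list .nat) (l ++ [a]) := by omega
      generalize Ty.size (.list .nat) (l ++ [a]) = z at *
      generalize Ty.size (.list .nat) l = y at *
      have h7 := polynomial_eval_mono R₁ (Nat.le_add_right k z)
      have h8 : y * (2 * k + 2) ≤ (k + z) * (2 * (k + z) + 2) :=
        Nat.mul_le_mul (by omega) (by omega)
      have h9 : Ty.size (.prod (TableTy 𝒢) (.list TrapTy)) (T, l.zip ss) =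
        (TableTy 𝒢).size T + Ty.size (.list TrapTy) (l.zip ss) + 1 := rfl
      rw [h9]
      simp only [B, Polynomial.eval_add, Polynomial.eval_mul, Polynomial.eval_X,
        Polynomial.eval_ofNat, Polynomial.eval_one]
      omega

theorem bdd_distinguisher_reaches (hA : A.IsPPT) : Bdd (.prod (distinguisher A).St (.list .nat))
    fun n => {x | ∃ k, n = k + Ty.size (.list .nat) x.2 ∧ (distinguisher A).Reaches k x.2 x.1 ∧
      x.2.length ≤ A.q.eval k} := by
  obtain ⟨R₁, R, h⟩ := distinguisher_reaches hA
  refine ⟨R + R₁ + 2 * Polynomial.X + R₁ + (Polynomial.X * (2 * Polynomial.X + 2) + 1) +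
    Polynomial.X + 6, ?_⟩
  rintro n ⟨s, l⟩ ⟨k, rfl, hr, hl⟩
  obtain ⟨sA, T, N, ss, rfl, hlen, hss, -, hT, hN, hsA⟩ := h k l s hr
  have h1 := hsA hl
  have h2 : Ty.size (.list (.list .bool)) ss = ss.length * (2 * k + 1 + 1) + 1 :=
    size_list_eq (σ := .list .bool) ss fun e he => by
      rw [size_list_eq (σ := .bool) e (c := 1) fun _ _ => rfl, hss e he, mul_comm]
  have h3 := length_le_size (σ := .nat) l
  have h5 : Ty.size (.prod (distinguisher A).St (.list .nat))
      ((sA, (T, ((unary k, N), ss))), l) = (A.St.size sA + ((TableTy 𝒢).size T +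
      ((Ty.size (.list .unit) (unary k) + Ty.size .nat N + 1) + Ty.size (.list (.list .bool)) ss
        + 1) + 1) + 1) + Ty.size (.list .nat) l + 1 := rfl
  rw [h5, h2, size_unary]
  dsimp only at *
  generalize Ty.size (.list .nat) l = y at *
  have h7 := polynomial_eval_mono R₁ (Nat.le_add_right k y)
  have h8 : ss.length * (2 * k + 1 + 1) ≤ (k + y) * (2 * (k + y) + 2) :=
    Nat.mul_le_mul (by omega) (by omega)
  simp only [Polynomial.eval_add, Polynomial.eval_mul, Polynomial.eval_X,
    Polynomial.eval_ofNat, Polynomial.eval_one]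
  omega

theorem polyOn_distinguisher_query (hA : A.IsPPT)
    {X : ℕ → Set (Ty.prod (.prod A.St (.prod (TableTy 𝒢) (.prod (.prod (.list .unit) .nat)
      (.list (.list .bool))))) (.list .nat)).denote} (hX : Bdd _ X)
    (h : ∀ n, ∀ x ∈ X n, ∃ k ≤ n, ∃ sA T N ss l, x = ((sA, (T, ((unary k, N), ss))), l) ∧
      ss.length = l.length ∧ A.Reaches k T (l.zip ss) sA ∧ l.length < A.q.eval k) :
    Prog.PolyOn (σ := .prod (.prod A.St (.prod (TableTy 𝒢) (.prod (.prod (.list .unit) .nat)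
      (.list (.list .bool))))) (.list .nat)) (τ := .prod .nat (.prod A.St (.prod (TableTy 𝒢)
      (.prod (.prod (.list .unit) .nat) (.list (.list .bool)))))) (distinguisher A).query X := by
  have h1 := IsPPT.polyOn (p := (Prog.snd.pair (v0.comp (.comp .snd (.comp .snd .snd)))).comp
    trapdoorsP) (by simp (maxDischargeDepth := 99)) hX
  have b1 := h1.bdd_ext hX
  have h2 := IsPPT.polyOn (p := (v1.comp .fst).pair ((v1.comp (.comp .snd .fst)).pair v0))
    (by simp (maxDischargeDepth := 99)) b1
  have h3 := h2.comp (q := A.query) (hA.polyOn_query h2.bdd_image ?_)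
  · exact h1.letP hX (h3.letP b1 (IsPPT.polyOn (by simp (maxDischargeDepth := 99))
      (h3.bdd_ext b1)))
  · rintro n y ⟨⟨z, x⟩, ⟨hx, hz⟩, hy⟩
    obtain ⟨k, hk, sA, T, N, ss, l, rfl, hlen, hr, hl⟩ := h n x hx
    refine ⟨k, hk, ?_⟩
    simp only [eval_comp, eval_pair, eval_fst, eval_snd, eval_v0, eval_v1, PMF.pure_bind,
      PMF.mem_support_pure_iff] at hy hz
    rw [eval_trapdoorsP l ss hlen, PMF.mem_support_pure_iff] at hz
    subst hz hy
    exact ⟨hr, by simpa [hlen] using hl⟩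

theorem polyOn_distinguisher_guess (hA : A.IsPPT)
    {X : ℕ → Set (Ty.prod (.prod A.St (.prod (TableTy 𝒢) (.prod (.prod (.list .unit) .nat)
      (.list (.list .bool))))) (.list .nat)).denote} (hX : Bdd _ X)
    (h : ∀ n, ∀ x ∈ X n, ∃ k ≤ n, ∃ sA T N ss l, x = ((sA, (T, ((unary k, N), ss))), l) ∧
      ss.length = l.length ∧ A.Reaches k T (l.zip ss) sA ∧ l.length = A.q.eval k) :
    Prog.PolyOn (σ := .prod (.prod A.St (.prod (TableTy 𝒢) (.prod (.prod (.list .unit) .nat)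
      (.list (.list .bool))))) (.list .nat)) (τ := .bool) (distinguisher A).guess X := by
  have h1 := IsPPT.polyOn (p := (Prog.snd.pair (v0.comp (.comp .snd (.comp .snd .snd)))).comp
    trapdoorsP) (by simp (maxDischargeDepth := 99)) hX
  have b1 := h1.bdd_ext hX
  have h2 := IsPPT.polyOn (p := (v1.comp .fst).pair ((v1.comp (.comp .snd .fst)).pair v0))
    (by simp (maxDischargeDepth := 99)) b1
  have h3 := h2.comp (q := A.guess) (hA.polyOn_guess h2.bdd_image ?_)
  · exact h1.letP hX h3
  · rintro n y ⟨⟨z, x⟩, ⟨hx, hz⟩, hy⟩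
    obtain ⟨k, hk, sA, T, N, ss, l, rfl, hlen, hr, hl⟩ := h n x hx
    refine ⟨k, hk, ?_⟩
    simp only [eval_comp, eval_pair, eval_fst, eval_snd, eval_v0, eval_v1, PMF.pure_bind,
      PMF.mem_support_pure_iff] at hy hz
    rw [eval_trapdoorsP l ss hlen, PMF.mem_support_pure_iff] at hz
    subst hz hy
    exact ⟨hr, by simpa [hlen] using hl⟩

theorem distinguisher_isPPT (hA : A.IsPPT) : (distinguisher A).IsPPT := by
  have hb := bdd_distinguisher_reaches hA
  obtain ⟨R₁, R, hreach⟩ := distinguisher_reaches hA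
  have h_query : (distinguisher A).query.PolyOn fun n => {x | ∃ k,
      n = k + Ty.size (.list .nat) x.2 ∧ (distinguisher A).Reaches k x.2 x.1 ∧
      x.2.length < A.q.eval k} := by
    refine polyOn_distinguisher_query hA ?_ ?_
    · obtain ⟨P, hP⟩ := hb
      exact ⟨P, fun n x ⟨k, h1, h2, h3⟩ => hP n x ⟨k, h1, h2, h3.le⟩⟩
    · rintro n ⟨s, l⟩ ⟨k, rfl, hr, hl⟩
      obtain ⟨sA, T, N, ss, rfl, hlen, -, hre, -⟩ := hreach k l s hr
      exact ⟨k, Nat.le_add_right _ _, sA, T, N, ss, l, rfl, hlen, hre, hl⟩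
  have h_guess : (distinguisher A).guess.PolyOn fun n => {x | ∃ k,
      n = k + Ty.size (.list .nat) x.2 ∧ (distinguisher A).Reaches k x.2 x.1 ∧
      x.2.length = A.q.eval k} := by
    refine polyOn_distinguisher_guess hA ?_ ?_
    · obtain ⟨P, hP⟩ := hb
      exact ⟨P, fun n x ⟨k, h1, h2, h3⟩ => hP n x ⟨k, h1, h2, h3.le⟩⟩
    · rintro n ⟨s, l⟩ ⟨k, rfl, hr, hl⟩
      obtain ⟨sA, T, N, ss, rfl, hlen, -, hre, -⟩ := hreach k l s hr
      exact ⟨k, Nat.le_add_right _ _, sA, T, N, ss, l, rfl, hlen, hre, hl⟩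
  obtain ⟨P₀, h₀⟩ := distinguisher_start_isPPT hA.start_isPPT
  obtain ⟨P₁, h₁⟩ := h_query
  obtain ⟨P₂, h₂⟩ := h_guess
  refine ⟨P₀.comp (2 * Polynomial.X + 1) + P₁ + P₂, fun k => ⟨?_, fun l s hr => ⟨fun hl => ?_, fun hl => ?_⟩⟩⟩
  · refine runsWithin_mono (h₀ _) ?_
    rw [size_unary]
    simp only [Polynomial.eval_add, Polynomial.eval_mul, Polynomial.eval_X,
      Polynomial.eval_ofNat, Polynomial.eval_one, Polynomial.eval_comp]
    omega
  · refine runsWithin_mono (h₁ _ (s, l) ⟨k, rfl, hr, hl⟩) ?_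
    simp only [Polynomial.eval_add]
    omega
  · refine runsWithin_mono (h₂ _ (s, l) ⟨k, rfl, hr, hl⟩) ?_
    simp only [Polynomial.eval_add]
    omega

end
end SLP

namespace SLP
noncomputable section
open Prog
variable {𝒢 : BilinearGroupGen}

/-! ## The hybrid argument -/

/-- A sample shared by a list of draws may be replaced by a fresh sample for each draw if at most
one of them depends on it. The pairwise condition expresses this: of any two entries, one ignores
`c`. -/
theorem bind_mapList {α β γ : Type} {q : PMF γ} {K : γ → α → PMF β} {f : α → PMF β} {l : List α}
    (hf : ∀ a ∈ l, f a = q.bind fun c => K c a)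
    (hK : l.Pairwise fun a b => (∀ c, K c a = f a) ∨ ∀ c, K c b = f b) :
    (q.bind fun c => mapList (K c) l) = mapList f l := by
  induction l with
  | nil => exact PMF.bind_const _ _
  | cons a l ih =>
    rw [List.pairwise_cons] at hK
    have ih := ih (fun a ha => hf a (by simp [ha])) hK.2
    simp only [mapList]
    by_cases h : ∀ c, K c a = f a
    · simp only [h]
      rw [PMF.bind_comm]
      congr 1; funext b
      rw [← ih, PMF.bind_bind]
    · have h' : ∀ c, mapList (K c) l = mapList f l := fun c =>
        mapList_congr fun b hb => (hK.1 b hb).resolve_left h c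
      simp only [h']
      rw [hf a (by simp), PMF.bind_bind]

/-- The first `t` entries of a matrix, and zeros. -/
def hybridEntry (m : List Bool → (M : GraphTy.denote) → Fin (numVertices M) →
    Fin (numVertices M) → ℕ) (t : ℕ) (key : List Bool) (M : GraphTy.denote)
    (p j : Fin (numVertices M)) : ℕ :=
  if p.val * numVertices M + j.val < t then m key M p j else 0

/-- The table of the first `t` entries of a matrix and zeros, in which entry number `t` is a given
ciphertext. -/
def challengeRows (pk : BGN.PublicKey 𝒢) {N : ℕ} (m : Fin N → Fin N → ℕ) (t : ℕ)
    (c : 𝒢.G pk.d) : PMF (List (List 𝒢.Elt.denote)) :=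
  mapList (fun p : Fin N => mapList (fun j : Fin N =>
    if p.val * N + j.val = t then PMF.pure (𝒢.code pk.d c)
    else (BGN.encrypt pk (if p.val * N + j.val < t then m p j else 0)).map (𝒢.code pk.d))
      (List.finRange N)) (List.finRange N)

theorem index_inj {N : ℕ} {p p' j j' : Fin N}
    (h : p.val * N + j.val = p'.val * N + j'.val) : p = p' ∧ j = j' := by
  have hN : 0 < N := p.pos
  have h1 : ∀ p j : Fin N, (p.val * N + j.val) / N = p.val := fun p j => by
    rw [mul_comm, Nat.mul_add_div hN, Nat.div_eq_of_lt j.2, add_zero]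
  have h2 : ∀ p j : Fin N, (p.val * N + j.val) % N = j.val := fun p j => by
    rw [mul_comm, Nat.mul_add_mod, Nat.mod_eq_of_lt j.2]
  exact ⟨Fin.ext (by rw [← h1 p j, h, h1]), Fin.ext (by rw [← h2 p j, h, h2])⟩

/-- Encrypting entry `t` or zero in the challenge gives the hybrid `t + 1` or `t`. If `t` lies
beyond the matrix, no entry holds the challenge and both hybrids coincide, so `a` is unconstrained.
-/
theorem encryptRows_eq_challengeRows (pk : BGN.PublicKey 𝒢) {N : ℕ} (m : Fin N → Fin N → ℕ)
    (t : ℕ) (b : Bool) (a : ℕ) (ha : ∀ p j : Fin N, p.val * N + j.val = t → a = m p j) :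
    (BGN.encryptRows pk fun p j : Fin N =>
      if p.val * N + j.val < t + (if b = true then 1 else 0) then m p j else 0) =
    (BGN.encrypt pk (if b = true then a else 0)).bind (challengeRows pk m t) := by
  have hconst : ∀ p j : Fin N, p.val * N + j.val ≠ t →
      (p.val * N + j.val < t + (if b = true then 1 else 0) ↔ p.val * N + j.val < t) := by
    intro p j h; split_ifs <;> omega
  unfold BGN.encryptRows
  symm
  -- The challenge is pulled out in two stages, from a row and from the list of rows; `index_inj`
  -- shows that it occurs in at most one entry and in at most one row.
  refine bind_mapList (fun p _ => (bind_mapList (fun j _ => ?_) ?_).symm) ?_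
  · by_cases h : p.val * N + j.val = t
    · simp only [h, if_true]
      rw [ha p j h, ← PMF.bind_pure_comp]
      cases b <;> simp [Function.comp_def]
    · simp only [h, if_false, hconst p j h]
      exact (PMF.bind_const _ _).symm
  · refine (List.nodup_finRange N).imp fun {j j'} hne => ?_
    by_cases h : p.val * N + j.val = t
    · have h' : p.val * N + j'.val ≠ t := fun h' => hne (index_inj (h.trans h'.symm)).2
      right; intro c
      simp only [h', if_false, hconst p j' h']
    · left; intro c
      simp only [h, if_false, hconst p j h]
  · refine (List.nodup_finRange N).imp fun {p p'} hne => ?_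
    by_cases h : ∃ j : Fin N, p.val * N + j.val = t
    · obtain ⟨j, h⟩ := h
      right; intro c
      refine mapList_congr fun j' _ => ?_
      have h' : p'.val * N + j'.val ≠ t := fun h' => hne (index_inj (h.trans h'.symm)).1
      simp only [h', if_false, hconst p' j' h']
    · left; intro c
      refine mapList_congr fun j _ => ?_
      have h' : p.val * N + j.val ≠ t := fun h' => h ⟨j, h'⟩
      simp only [h', if_false, hconst p j h']

theorem prTrue_bind_unif {n : ℕ} (hn : 0 < n) (f : ℕ → PMF Bool) :
    n * prTrue ((unif n).bind f) = ∑ t ∈ Finset.range n, prTrue (f t) := by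
  rw [prTrue, unif, dif_neg hn.ne', uniformOfFinset_bind_apply, ENNReal.toReal_mul,
    ENNReal.toReal_sum fun t _ => PMF.apply_ne_top _ _, Finset.card_range, ENNReal.toReal_inv,
    ENNReal.toReal_natCast, mul_inv_cancel_left₀ (by positivity)]
  rfl

/-- Telescoping: averaging over a uniform index turns the sum of all neighbouring differences into
`n` times one difference, so a single adversary accounts for all hybrids. -/
theorem prTrue_hybrid {n : ℕ} (hn : 0 < n) (g : ℕ → PMF Bool) :
    prTrue (g n) - prTrue (g 0) =
      n * (prTrue ((unif n).bind fun t => g (t + 1)) - prTrue ((unif n).bind g)) := by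
  rw [mul_sub, prTrue_bind_unif hn, prTrue_bind_unif hn, ← Finset.sum_sub_distrib,
    Finset.sum_range_sub fun t => prTrue (g t)]

/-! ## The adversary against semantic security -/

/-- The adjacency test for two vertices. -/
def adjP : Prog (.prod (.prod .nat .nat) GraphTy) .bool :=
  letP (Prog.snd.comp .cons) <|
  letP ((((v0.pair ((v1.comp .fst).pair .nil)).comp nthP).pair
    ((v1.comp .snd).pair (.bool false))).comp nthP) <|
  letP ((((v1.pair ((v2.comp .snd).pair .nil)).comp nthP).pair
    ((v2.comp .fst).pair (.bool false))).comp nthP) <|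
  .ite (v3.comp eqP) (.bool false) (.ite v1 (.bool true) v0)

open Classical in
theorem eval_adjP (M : GraphTy.denote) (i j : Fin (numVertices M)) :
    adjP.eval ((i.val, j.val), M) = PMF.pure (decide ((toGraph M).Adj i j)) := by
  simp only [adjP, eval_letP, eval_comp, eval_pair, eval_fst, eval_snd, eval_v0, eval_v1, eval_v2, eval_v3,
    eval_cons, eval_nil, eval_bool, eval_nthP, eval_eqP, eval_ite, PMF.pure_bind]
  rw [toGraph, SimpleGraph.fromRel_adj]
  by_cases h : i = j
  · simp [h]
  · have h' : i.val ≠ j.val := fun h' => h (Fin.ext h')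
    simp only [h', decide_false, h, ne_eq, not_false_eq_true, true_and, Bool.false_eq_true, if_false]
    generalize List.getD ((M.1 :: M.2).getD i.val []) j.val false = a
    generalize List.getD ((M.1 :: M.2).getD j.val []) i.val false = b
    cases a <;> cases b <;> rfl

@[simp] theorem isPPT_adjP : adjP.IsPPT := by
  simp (maxDischargeDepth := 99) [adjP]

/-- The inverse of the permutation; the input is a position and a key with the size of the index
set in unary. -/
def inverseP (F : KeyedPerm) : Prog (.prod .nat (.prod (.list .bool) (.list .unit))) .nat :=
  ((((Prog.snd.comp .snd).comp rangeP).pair .id).comp (filterP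
    (((((Prog.snd.comp (.comp .snd .fst)).pair (((Prog.snd.comp (.comp .snd .snd)).comp
      lengthP).pair .fst)).comp F.prog).pair (Prog.snd.comp .fst)).comp eqP)) |>.pair
    (.num 0)).comp lastP

/-- Exhaustive search: exactly one index is mapped to `p`. Only forward evaluation of `F` is assumed
efficient; the search is polynomial because the size of the index set is given in unary. -/
theorem eval_inverseP (F : KeyedPerm) (key : List Bool) {N : ℕ} (p : Fin N) :
    (inverseP F).eval (p.val, (key, unary N)) = PMF.pure ((F.perm key N).symm p).val := by
  have hlen : (unary N).length = N := by simp [unary]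
  simp only [inverseP, eval_comp, eval_pair, eval_snd, eval_rangeP, eval_id, eval_num,
    PMF.pure_bind, PMF.bind_bind]
  rw [eval_filterP (f := fun i => decide (i = ((F.perm key N).symm p).val))]
  · simp only [PMF.pure_bind, eval_lastP, hlen]
    congr 1
    have h1 : (List.range N).filter (fun i => decide (i = ((F.perm key N).symm p).val)) =
        [((F.perm key N).symm p).val] := by
      have := List.filter_eq (l := List.range N) ((F.perm key N).symm p).val
      rw [List.count_eq_one_of_mem (List.nodup_range) (by simp)] at this
      simpa [eq_comm] using this
    rw [h1]; rfl
  · intro i hi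
    have hi' : i < N := by simpa [hlen] using hi
    simp only [eval_comp, eval_pair, eval_fst, eval_snd, eval_lengthP, PMF.pure_bind, hlen]
    rw [F.prog_spec key N ⟨i, hi'⟩]
    simp only [PMF.pure_bind, eval_eqP]
    congr 1
    rw [decide_eq_decide, Fin.val_inj, ← Equiv.eq_symm_apply, Fin.ext_iff]

@[simp] theorem isPPT_inverseP (F : KeyedPerm) : (inverseP F).IsPPT := by
  simp (maxDischargeDepth := 99) [inverseP, F.prog_ppt]

/-- The entries of the permuted adjacency matrix. -/
def entryP (F : KeyedPerm) : Prog (.prod (.prod .nat .nat) (.prod (.list .bool) GraphTy)) .bool :=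
  ((((Prog.fst.comp .fst).pair ((Prog.snd.comp .fst).pair ((Prog.snd.comp .snd).comp
    verticesP))).comp (inverseP F)).pair (Prog.fst.comp .snd) |>.pair (Prog.snd.comp .snd)).comp adjP

open Classical in
theorem eval_entryP (F : KeyedPerm) (key : List Bool) (M : GraphTy.denote)
    (p j : Fin (numVertices M)) : (entryP F).eval ((p.val, j.val), (key, M)) =
      PMF.pure (decide ((toGraph M).Adj ((F.perm key _).symm p) j)) := by
  simp only [entryP, eval_comp, eval_pair, eval_fst, eval_snd, eval_verticesP, PMF.pure_bind]
  rw [eval_inverseP]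
  simp only [PMF.pure_bind]
  exact eval_adjP M _ j

@[simp] theorem isPPT_entryP (F : KeyedPerm) : (entryP F).IsPPT := by
  simp (maxDischargeDepth := 99) [entryP]

end
end SLP

/-! ### Programs that run the hybrid games -/

namespace SLP
noncomputable section
open Prog
variable {𝒢 : BilinearGroupGen}

/-- What the adversary against semantic security remembers: the position of the challenge, the key
of the permutation, the graph and the state of the adversary against the scheme, and its input. -/
abbrev HybridTy (𝒢 : BilinearGroupGen) (St : Ty) : Ty :=
  .prod .nat (.prod (.list .bool) (.prod (.prod GraphTy St) (.prod (.list .unit) (BGN.KeyTy 𝒢))))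

/-- The message that is encrypted in the challenge. -/
def challengeMessageP (𝒢 : BilinearGroupGen) (F : KeyedPerm) (St : Ty) :
    Prog (HybridTy 𝒢 St) .nat :=
  letP (((v2.comp .fst).comp verticesP).comp lengthP) <|
  .ite ((((((v1.pair v0).comp .div).pair (.num 1)).comp .add).pair v0).comp .le)
    (.ite (((((v1.pair v0).comp .div).pair ((v1.pair v0).comp .mod)).pair
      (v2.pair (v3.comp .fst))).comp (entryP F)) (.num 1) (.num 0)) (.num 0)

/-- Entry number `t` of the permuted adjacency matrix. -/
def challengeMessage (F : KeyedPerm) (key : List Bool) (M : GraphTy.denote) (t : ℕ) : ℕ :=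
  if h : t / numVertices M < numVertices M then permutedEntry F key M ⟨_, h⟩
    ⟨t % numVertices M, Nat.mod_lt _ (Nat.succ_pos _)⟩ else 0

theorem challengeMessage_eq (F : KeyedPerm) (key : List Bool) (M : GraphTy.denote)
    (p j : Fin (numVertices M)) :
    challengeMessage F key M (p.val * numVertices M + j.val) = permutedEntry F key M p j := by
  have h1 : (p.val * numVertices M + j.val) / numVertices M = p.val := by
    rw [mul_comm, Nat.mul_add_div p.pos, Nat.div_eq_of_lt j.2, add_zero]
  have h2 : (p.val * numVertices M + j.val) % numVertices M = j.val := by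
    rw [mul_comm, Nat.mul_add_mod, Nat.mod_eq_of_lt j.2]
  rw [challengeMessage, dif_pos (show (p.val * numVertices M + j.val) / numVertices M <
    numVertices M by rw [h1]; exact p.2)]
  congr 1 <;> exact Fin.ext (by assumption)

theorem eval_challengeMessageP (F : KeyedPerm) {St : Ty} (t : ℕ) (key : List Bool)
    (M : GraphTy.denote) (x : St.denote) (y : (Ty.prod (.list .unit) (BGN.KeyTy 𝒢)).denote) :
    (challengeMessageP 𝒢 F St).eval (t, (key, ((M, x), y))) =
      PMF.pure (challengeMessage F key M t) := by
  have hlen : (unary (numVertices M)).length = numVertices M := by simp [unary]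
  simp only [challengeMessageP, eval_letP, eval_comp, eval_pair, eval_fst, eval_v0, eval_v1,
    eval_v2, eval_v3, eval_verticesP, eval_lengthP, eval_div, eval_mod, eval_add, eval_le, eval_ite,
    eval_num, PMF.pure_bind, hlen, decide_eq_true_eq]
  rw [challengeMessage]
  split_ifs with h1 h2 h2
  · have := eval_entryP F key M ⟨_, h2⟩ ⟨t % numVertices M, Nat.mod_lt _ (Nat.succ_pos _)⟩
    refine (congrArg (fun p => PMF.bind p _) this).trans ((PMF.pure_bind _ _).trans ?_)
    rw [permutedEntry]
    by_cases h : (toGraph M).Adj ((F.perm key _).symm ⟨_, h2⟩)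
      ⟨t % numVertices M, Nat.mod_lt _ (Nat.succ_pos _)⟩
    · simp only [h, decide_true, if_true]
    · simp only [h, decide_false, if_false, Bool.false_eq_true]
  · exact absurd h1 h2
  · exact absurd h2 h1
  · rfl

@[simp] theorem isPPT_challengeMessageP (F : KeyedPerm) (St : Ty) :
    (challengeMessageP 𝒢 F St).IsPPT := by
  simp (maxDischargeDepth := 99) [challengeMessageP]

/-- An entry of the table. -/
def hybridCellP (𝒢 : BilinearGroupGen) (F : KeyedPerm) (St : Ty) :
    Prog (.prod .nat (.prod .nat (.prod 𝒢.Elt (HybridTy 𝒢 St)))) 𝒢.Elt :=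
  letP ((((v1.pair (((v5.comp .fst).comp verticesP).comp lengthP)).comp .mul).pair v0).comp .add) <|
  .ite ((v0.pair v4).comp eqP) v3 <|
  (((Prog.snd.comp (.comp .snd (.comp .snd (.comp .snd (.comp .snd (.comp .snd (.comp .snd
    .snd))))))).pair (.ite ((v4.pair v0).comp .le) (.bool false)
      (((v2.pair v1).pair (v5.pair ((Prog.snd.comp v5).comp .fst))).comp (entryP F)))).comp
        (BGN.encryptP 𝒢))

/-- The table of the hybrid games. -/
def hybridRowsP (𝒢 : BilinearGroupGen) (F : KeyedPerm) (St : Ty) :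
    Prog (.prod 𝒢.Elt (HybridTy 𝒢 St)) (.list (.list 𝒢.Elt)) :=
  ((((v3.comp .fst).comp verticesP).comp rangeP).pair .id).comp <| mapP <|
    (((((Prog.snd.comp v3).comp .fst).comp verticesP).comp rangeP).pair .id).comp <| mapP <|
      hybridCellP 𝒢 F St

theorem eval_hybridRowsP (F : KeyedPerm) {St : Ty} {pk : BGN.PublicKey 𝒢} (hpk : pk.Valid)
    (c : 𝒢.G pk.d) (t : ℕ) (key : List Bool) (M : GraphTy.denote) (x : St.denote)
    (u : List Unit) : (hybridRowsP 𝒢 F St).eval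
      (𝒢.code pk.d c, (t, (key, ((M, x), (u, pk.toData))))) =
        challengeRows pk (permutedEntry F key M) t c := by
  have hlen : (unary (numVertices M)).length = numVertices M := by simp [unary]
  simp only [hybridRowsP, eval_comp, eval_pair, eval_fst, eval_snd, eval_id, eval_v3,
    eval_verticesP, eval_rangeP, eval_mapP, PMF.pure_bind, hlen]
  rw [challengeRows, ← List.map_coe_finRange_eq_range, mapList_map]
  congr 1; funext p
  rw [mapList_map]
  congr 1; funext j
  simp only [hybridCellP, eval_letP, eval_comp, eval_pair, eval_fst, eval_snd, eval_v0, eval_v1,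
    eval_v2, eval_v3, eval_v4, eval_v5, eval_verticesP, eval_lengthP, eval_mul, eval_add, eval_eqP,
    eval_le, eval_bool, eval_ite, PMF.pure_bind, hlen, decide_eq_true_eq]
  split_ifs with h1 h2 h3 h3
  · rfl
  · exact absurd h3 (not_lt_of_ge h2)
  · rw [PMF.pure_bind, PMF.pure_bind, hpk.eval_encryptP]; rfl
  · rw [eval_entryP, PMF.pure_bind, PMF.pure_bind, hpk.eval_encryptP]
    congr 2
    rw [permutedEntry]
    by_cases h : (toGraph M).Adj ((F.perm key _).symm p) j
    · simp only [h, decide_true, if_true]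
    · simp only [h, decide_false, if_false, Bool.false_eq_true]
  · exact absurd (lt_of_not_ge h2) h3

variable (A : Adversary (TableTy 𝒢) TrapTy)

/-- One query of the adversary against the scheme. -/
def hybridStepP (F : KeyedPerm) : Prog (.prod .unit (.prod (.prod (TableTy 𝒢) (.prod (.list .bool)
      (.prod .nat (.list .unit)))) (.prod A.St (.list TrapTy)))) (.prod A.St (.list TrapTy)) :=
  letP (((Prog.snd.comp (.comp .snd .fst)).pair ((v1.comp .fst).pair
    (Prog.snd.comp (.comp .snd .snd)))).comp A.query) <|
  letP (((v2.comp (.comp .snd .fst)).pair ((v2.comp (.comp .snd (.comp .snd .fst))).pair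
    (((v0.comp .fst).pair (v2.comp (.comp .snd (.comp .snd .fst)))).comp .mod))).comp F.prog) <|
  letP ((v3.comp (.comp .snd (.comp .snd .snd))).comp randomBitsP) <|
  (v2.comp .snd).pair (((Prog.snd.comp (.comp .snd (.comp .snd (.comp .snd (.comp .snd
    .snd))))).pair (((v1.pair v0).pair .nil).comp .cons)).comp appendP)

theorem eval_hybridStepP (F : KeyedPerm) (T : (TableTy 𝒢).denote) (key : List Bool)
    (M : GraphTy.denote) (k : ℕ) (b : (Ty.prod A.St (.list TrapTy)).denote) :
    (hybridStepP A F).eval ((), ((T, (key, (numVertices M, unary k))), b)) =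
      (A.query.eval (b.1, (T, b.2))).bind fun m =>
        (permEnv k M (F.perm key _) () m.1).bind fun a => PMF.pure (m.2, b.2 ++ [a.1]) := by
  obtain ⟨s, l⟩ := b
  simp only [hybridStepP, eval_letP, eval_comp, eval_pair, eval_fst, eval_snd, eval_v0, eval_v1,
    eval_v2, eval_v3, eval_mod, eval_nil, eval_cons, eval_appendP, PMF.pure_bind]
  congr 1; funext m
  refine (congrArg (fun p => PMF.bind p _) (F.prog_spec key _ (toVertex M m.1))).trans ?_
  refine (PMF.pure_bind _ _).trans ?_
  rw [eval_randomBitsP, permEnv, PMF.bind_map]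
  rfl

/-- The input of the loop that runs the queries; `r` computes their number. -/
def hybridInitP (r : Prog (.list .unit) (.list .unit)) : Prog (.prod (TableTy 𝒢) (HybridTy 𝒢 A.St))
    (.prod (.list .unit) (.prod (.prod (TableTy 𝒢) (.prod (.list .bool)
      (.prod .nat (.list .unit)))) (.prod A.St (.list TrapTy)))) :=
  ((Prog.snd.comp (.comp .snd (.comp .snd (.comp .snd .fst)))).comp r).pair
    ((v0.pair (v2.pair ((((v3.comp .fst).comp verticesP).comp lengthP).pair
      (Prog.snd.comp (.comp .snd (.comp .snd (.comp .snd .fst))))))).pair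
    ((v3.comp .snd).pair .nil))

/-- The queries of the adversary against the scheme. -/
def hybridLoopP (F : KeyedPerm) (r : Prog (.list .unit) (.list .unit)) :
    Prog (.prod (TableTy 𝒢) (HybridTy 𝒢 A.St)) (.prod A.St (.list TrapTy)) :=
  (hybridInitP A r).comp (foldE (hybridStepP A F))

theorem eval_hybridInitP {r : Prog (.list .unit) (.list .unit)} {k : ℕ}
    (hr : r.eval (unary k) = PMF.pure (unary (A.q.eval k))) (T : (TableTy 𝒢).denote) (t : ℕ)
    (key : List Bool) (o : (Ty.prod GraphTy A.St).denote) (pk : (BGN.KeyTy 𝒢).denote) :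
    (hybridInitP A r).eval (T, (t, (key, (o, (unary k, pk))))) =
      PMF.pure (unary (A.q.eval k), ((T, (key, (numVertices o.1, unary k))), (o.2, []))) := by
  have hlen : (unary (numVertices o.1)).length = numVertices o.1 := by simp [unary]
  simp only [hybridInitP, eval_comp, eval_pair, eval_fst, eval_snd, eval_v0, eval_v2, eval_v3,
    eval_verticesP, eval_lengthP, eval_nil, PMF.pure_bind, hlen, hr]

@[simp] theorem isPPT_hybridInitP {r : Prog (.list .unit) (.list .unit)} (hr : r.IsPPT) :
    (hybridInitP A r).IsPPT := by
  simp (maxDischargeDepth := 99) [hybridInitP, hr]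

/-- The game after the generation of the table. -/
def hybridPlayP (F : KeyedPerm) (r : Prog (.list .unit) (.list .unit)) :
    Prog (.prod (TableTy 𝒢) (HybridTy 𝒢 A.St)) .bool :=
  letP (hybridLoopP A F r) (((v0.comp .fst).pair (v1.pair (v0.comp .snd))).comp A.guess)

/-- With a stateless environment, a round changes only the party's state and the transcript, so `q`
rounds are a loop along a list of `q` units. -/
theorem foldEval_eq_interact {σ A B : Type} (party : σ → List A → PMF (B × σ))
    (env : Unit → B → PMF (A × Unit)) (f : Unit → σ × List A → PMF (σ × List A))
    (hf : ∀ b, f () b = (party b.1 b.2).bind fun m => (env () m.1).bind fun a =>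
      PMF.pure (m.2, b.2 ++ [a.1])) (q : ℕ) (s : σ) (l : List A) :
    foldEval f (unary q) (s, l) = interact party env q s () l := by
  induction q generalizing s l with
  | zero => rfl
  | succ q ih =>
    change (f () (s, l)).bind (foldEval f (unary q)) = _
    simp only [hf, interact, monad_bind_eq_bind, PMF.bind_bind, PMF.pure_bind, ih]

theorem eval_hybridLoopP (F : KeyedPerm) {r : Prog (.list .unit) (.list .unit)} {k : ℕ}
    (hr : r.eval (unary k) = PMF.pure (unary (A.q.eval k))) (T : (TableTy 𝒢).denote) (t : ℕ)
    (key : List Bool) (M : GraphTy.denote) (s : A.St.denote) (pk : (BGN.KeyTy 𝒢).denote) :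
    (hybridLoopP A F r).eval (T, (t, (key, ((M, s), (unary k, pk))))) =
      interact (fun s l => A.query.eval (s, (T, l))) (permEnv k M (F.perm key _)) (A.q.eval k)
        s () [] := by
  rw [hybridLoopP, eval_comp, eval_hybridInitP A hr]
  refine (PMF.pure_bind _ _).trans ?_
  rw [eval_foldE]
  exact foldEval_eq_interact _ _ _ (fun b => eval_hybridStepP A F T key M k b) _ _ _

theorem eval_hybridPlayP (F : KeyedPerm) {r : Prog (.list .unit) (.list .unit)} {k : ℕ}
    (hr : r.eval (unary k) = PMF.pure (unary (A.q.eval k))) (T : (TableTy 𝒢).denote) (t : ℕ)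
    (key : List Bool) (M : GraphTy.denote) (s : A.St.denote) (pk : (BGN.KeyTy 𝒢).denote) :
    (hybridPlayP A F r).eval (T, (t, (key, ((M, s), (unary k, pk))))) =
      play A k s T (permEnv k M (F.perm key _)) () := by
  simp only [hybridPlayP, eval_letP, eval_comp, eval_pair, eval_fst, eval_snd, eval_v0, eval_v1,
    PMF.pure_bind, eval_hybridLoopP A F hr, play]

/-- The adversary against semantic security that puts its challenge into a random entry of the
table, below the number in unary that `w` computes. -/
def hybridAdversary (F : KeyedPerm) (w r : Prog (.list .unit) (.list .unit)) :
    BGN.Adversary 𝒢 where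
  St := HybridTy 𝒢 A.St
  choose := letP (Prog.fst.comp A.start) <| letP ((v1.comp randomBitsP)) <|
    letP (((v2.comp w).comp lengthP).comp .rand) <|
    ((Prog.num 0).pair (challengeMessageP 𝒢 F A.St)).pair .id
  guess := letP ((Prog.snd.pair .fst).comp (hybridRowsP 𝒢 F A.St)) <|
    ((((v1.comp (.comp .snd (.comp .snd (.comp .snd .snd)))).pair v0).pair v1).comp
      (hybridPlayP A F r))

theorem eval_hybridAdversary_choose (F : KeyedPerm) {w : Prog (.list .unit) (.list .unit)}
    (r : Prog (.list .unit) (.list .unit)) {k n : ℕ}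
    (hw : w.eval (unary k) = PMF.pure (unary n)) (pk : (BGN.KeyTy 𝒢).denote) :
    (hybridAdversary A F w r).choose.eval (unary k, pk) =
      (A.start.eval (unary k)).bind fun o => (randomBits k).bind fun key =>
        (unif n).bind fun t =>
          PMF.pure ((0, challengeMessage F key o.1 t), (t, (key, (o, (unary k, pk))))) := by
  have hlen : (unary n).length = n := by simp [unary]
  simp only [hybridAdversary, eval_letP, eval_comp, eval_pair, eval_fst, eval_v1, eval_v2,
    eval_lengthP, eval_rand, eval_id, eval_num, eval_randomBitsP, PMF.pure_bind, hw, hlen]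
  congr 1; funext o; congr 1; funext key; congr 1; funext t
  rw [eval_challengeMessageP, PMF.pure_bind, PMF.pure_bind]

theorem eval_hybridAdversary_guess (F : KeyedPerm) (w : Prog (.list .unit) (.list .unit))
    {r : Prog (.list .unit) (.list .unit)} {k : ℕ}
    (hr : r.eval (unary k) = PMF.pure (unary (A.q.eval k))) {pk : BGN.PublicKey 𝒢} (hpk : pk.Valid)
    (c : 𝒢.G pk.d) (t : ℕ) (key : List Bool) (o : (Ty.prod GraphTy A.St).denote) :
    (hybridAdversary A F w r).guess.eval ((t, (key, (o, (unary k, pk.toData)))), 𝒢.code pk.d c) =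
      (challengeRows pk (permutedEntry F key o.1) t c).bind fun rows =>
        play A k o.2 (pk.toData, rows) (permEnv k o.1 (F.perm key _)) () := by
  obtain ⟨M, s⟩ := o
  simp only [hybridAdversary, eval_letP, eval_comp, eval_pair, eval_fst, eval_snd, eval_v0,
    eval_v1, PMF.pure_bind]
  rw [eval_hybridRowsP F hpk]
  congr 1; funext rows
  exact eval_hybridPlayP A F hr _ _ _ _ _ _

/-- The message numbered `0` is zero and the message numbered `1` is entry `t`, so the challenge bit
moves the hybrid by one. Everything else in the game is produced faithfully from the public key and
a permutation key drawn by the adversary itself. -/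
theorem experiment_hybridAdversary (F : KeyedPerm) {w r : Prog (.list .unit) (.list .unit)}
    {k n : ℕ} (hw : w.eval (unary k) = PMF.pure (unary n))
    (hr : r.eval (unary k) = PMF.pure (unary (A.q.eval k))) (b : Bool) :
    BGN.experiment (hybridAdversary A F w r) b k = (unif n).bind fun t =>
      keyedGame F A (hybridEntry (permutedEntry F) (t + if b = true then 1 else 0)) k := by
  unfold BGN.experiment
  simp only [monad_bind_eq_bind]
  have hlhs : ∀ ks ∈ (BGN.keyGen 𝒢 k).support,
      (((hybridAdversary A F w r).choose.eval (unary k, ks.1.toData)).bind fun o =>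
        (BGN.encrypt ks.1 (if b = true then o.1.2 else o.1.1)).bind fun c =>
          (hybridAdversary A F w r).guess.eval (o.2, 𝒢.code ks.1.d c)) =
      (A.start.eval (unary k)).bind fun o => (randomBits k).bind fun key => (unif n).bind fun t =>
        (BGN.encryptRows ks.1 (hybridEntry (permutedEntry F) (t + if b = true then 1 else 0)
          key o.1)).bind fun rows =>
            play A k o.2 (ks.1.toData, rows) (permEnv k o.1 (F.perm key _)) () := by
    intro ks hks
    refine (congrArg (fun p => PMF.bind p _) (eval_hybridAdversary_choose A F r hw _)).trans ?_
    refine (PMF.bind_bind _ _ _).trans ?_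
    congr 1; funext o
    refine (PMF.bind_bind _ _ _).trans ?_
    congr 1; funext key
    refine (PMF.bind_bind _ _ _).trans ?_
    congr 1; funext t
    refine (PMF.pure_bind _ _).trans ?_
    have := encryptRows_eq_challengeRows ks.1 (permutedEntry F key o.1) t b
      (challengeMessage F key o.1 t) (fun p j h => h ▸ challengeMessage_eq F key o.1 p j)
    unfold hybridEntry
    rw [this, PMF.bind_bind]
    congr 1; funext c
    exact eval_hybridAdversary_guess A F w hr (BGN.valid_of_mem_support hks) c t key o
  rw [bind_congr_support hlhs]
  -- The two games draw the index, the permutation key, the BGN keys and the graph in different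
  -- orders; independent draws commute.
  simp only [keyedGame]
  rw [PMF.bind_comm (unif n)]
  simp only [PMF.bind_comm (unif n)]
  rw [PMF.bind_comm (randomBits k)]
  congr 1; funext ks
  rw [PMF.bind_comm (randomBits k)]

end
end SLP

namespace SLP
noncomputable section
open Prog
variable {𝒢 : BilinearGroupGen} {A : Adversary (TableTy 𝒢) TrapTy}

/-! ### Running time of the adversary against semantic security -/

theorem Prog.bdd_elements {υ σ : Ty} {X : ℕ → Set (Ty.prod (.list υ) σ).denote} (hX : Bdd _ X) :
    Bdd (.prod υ σ) fun k => {w | ∃ x ∈ X k, w.1 ∈ x.1 ∧ w.2 = x.2} := by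
  obtain ⟨P, hP⟩ := hX
  refine ⟨P, fun k w ⟨x, hx, h1, h2⟩ => ?_⟩
  have h3 := hP k x hx
  have h4 := size_lt_size_list h1
  rw [Ty.size] at h3 ⊢
  rw [h2]
  omega

theorem polyOn_hybridCellP (F : KeyedPerm) {St : Ty}
    {X : ℕ → Set (Ty.prod .nat (.prod .nat (.prod 𝒢.Elt (HybridTy 𝒢 St)))).denote} (hX : Bdd _ X)
    (h : ∀ k, ∀ x ∈ X k, ∃ pk : BGN.PublicKey 𝒢, pk.Valid ∧ x.2.2.2.2.2.2.2 = pk.toData) :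
    (hybridCellP 𝒢 F St).PolyOn X := by
  have h1 : Prog.PolyOn (σ := .prod .nat (.prod .nat (.prod 𝒢.Elt (HybridTy 𝒢 St))))
    ((((v1.pair (((v5.comp .fst).comp verticesP).comp lengthP)).comp .mul).pair v0).comp .add) X :=
    IsPPT.polyOn (by simp (maxDischargeDepth := 99)) hX
  have b1 := h1.bdd_ext hX
  refine h1.letP hX (PolyOn.ite (IsPPT.polyOn (by simp (maxDischargeDepth := 99)) b1)
    ((IsPPT.polyOn (by simp (maxDischargeDepth := 99)) b1).mono fun k x hx => hx.1)
    (PolyOn.mono ?_ fun k x hx => hx.1))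
  have h2 := IsPPT.polyOn (p := (Prog.snd.comp (.comp .snd (.comp .snd (.comp .snd (.comp .snd
      (.comp .snd (.comp .snd .snd))))))).pair (.ite ((v4.pair v0).comp .le) (.bool false)
      (((v2.pair v1).pair (v5.pair ((Prog.snd.comp v5).comp .fst))).comp (entryP F))))
      (by simp (maxDischargeDepth := 99)) b1
  refine h2.comp (BGN.polyOn_encryptP h2.bdd_image ?_)
  rintro k y ⟨⟨i, x⟩, ⟨hx, -⟩, hy⟩
  simp only [eval_pair, eval_comp, eval_snd, PMF.pure_bind, PMF.mem_support_bind_iff,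
    PMF.mem_support_pure_iff] at hy
  obtain ⟨b, -, rfl⟩ := hy
  exact h k x hx

theorem polyOn_hybridRowsP (F : KeyedPerm) {St : Ty}
    {X : ℕ → Set (Ty.prod 𝒢.Elt (HybridTy 𝒢 St)).denote} (hX : Bdd _ X)
    (h : ∀ k, ∀ x ∈ X k, ∃ pk : BGN.PublicKey 𝒢, pk.Valid ∧ x.2.2.2.2.2 = pk.toData) :
    (hybridRowsP 𝒢 F St).PolyOn X := by
  have h1 : Prog.PolyOn (σ := .prod 𝒢.Elt (HybridTy 𝒢 St))
    ((((v3.comp .fst).comp verticesP).comp rangeP).pair .id) X :=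
    IsPPT.polyOn (by simp (maxDischargeDepth := 99)) hX
  refine h1.comp (PolyOn.mapP h1.bdd_image ?_)
  have b1 := bdd_elements h1.bdd_image
  have h2 := IsPPT.polyOn (p := ((((Prog.snd.comp v3).comp .fst).comp verticesP).comp
    rangeP).pair .id) (by simp (maxDischargeDepth := 99)) b1
  refine h2.comp (PolyOn.mapP h2.bdd_image ?_)
  refine polyOn_hybridCellP F (bdd_elements h2.bdd_image) ?_
  rintro k z ⟨y, ⟨w, ⟨v, ⟨x, hx, hv⟩, hw1, hw2⟩, hy⟩, hz1, hz2⟩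
  simp only [eval_pair, eval_comp, eval_fst, eval_snd, eval_v3, eval_id, eval_verticesP,
    eval_rangeP, PMF.pure_bind, PMF.mem_support_pure_iff] at hv hy
  rw [hz2, hy, hw2, hv]
  exact h k x hx

theorem reaches_of_mem_support_interact {σ ρ A B : Type} {start : σ → Prop}
    {party : σ → List A → PMF (B × σ)} {env : ρ → B → PMF (A × ρ)} {q : ℕ} {s : σ} {r : ρ}
    {l : List A} (h : Reaches start party l s) {y : σ × List A}
    (hy : y ∈ (interact party env q s r l).support) :
    Reaches start party y.2 y.1 ∧ y.2.length = l.length + q := by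
  induction q generalizing s r l with
  | zero =>
    rw [interact, PMF.mem_support_pure_iff] at hy
    subst hy
    exact ⟨h, rfl⟩
  | succ q ih =>
    simp only [interact, monad_bind_eq_bind, PMF.mem_support_bind_iff] at hy
    obtain ⟨m, hm, a, -, hy⟩ := hy
    have := ih (h.step hm a.1) hy
    refine ⟨this.1, this.2.trans ?_⟩
    simp only [List.length_append, List.length_singleton]; omega

/-- The state of the adversary does not grow in a compounding way: its time, and so each new state,
is bounded in terms of the security parameter and the messages received, not of the old state. The
invariant keeps reachability and the bounds on the transcript. -/
theorem polyOn_hybridLoopP (hA : A.IsPPT) (F : KeyedPerm) {r : Prog (.list .unit) (.list .unit)}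
    (hr : r.IsPPT) (hreval : ∀ k, r.eval (unary k) = PMF.pure (unary (A.q.eval k)))
    {X : ℕ → Set (Ty.prod (TableTy 𝒢) (HybridTy 𝒢 A.St)).denote} (hX : Bdd _ X)
    (h : ∀ k, ∀ x ∈ X k, ∃ T t key pk, ∃ o ∈ (A.start.eval (unary k)).support,
      x = (T, (t, (key, (o, (unary k, pk)))))) :
    (hybridLoopP A F r).PolyOn X := by
  have h1 := (isPPT_hybridInitP A hr).polyOn hX
  refine h1.comp ?_
  have b1 := h1.bdd_image
  have himage : ∀ k, ∀ y ∈ image (hybridInitP A r) X k, ∃ T t key pk,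
      ∃ o ∈ (A.start.eval (unary k)).support, ((T, (t, (key, (o, (unary k, pk))))) :
          (Ty.prod (TableTy 𝒢) (HybridTy 𝒢 A.St)).denote) ∈ X k ∧
        y = (unary (A.q.eval k), ((T, (key, (numVertices o.1, unary k))), (o.2, []))) := by
    rintro k y ⟨x, hx, hy⟩
    obtain ⟨T, t, key, pk, o, ho, rfl⟩ := h k x hx
    rw [eval_hybridInitP A (hreval k)] at hy
    exact ⟨T, t, key, pk, o, ho, hx, (PMF.mem_support_pure_iff _ _).1 hy⟩
  revert b1 himage
  generalize image _ X = Z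
  intro b1 himage
  obtain ⟨P, hP⟩ := b1
  obtain ⟨Q, hQ⟩ := hX
  have hA' := hA
  obtain ⟨R, hR⟩ := hA'
  -- `E` bounds one trapdoor (a position below the number of vertices and `k` bits), `L` a list of
  -- at most `A.q.eval k` trapdoors, and `S` the adversary's state, initially or after a query.
  let E : Polynomial ℕ := Q + 2 * Polynomial.X + 3
  let L : Polynomial ℕ := A.q * (E + 1) + 1
  let S : Polynomial ℕ := P + R.comp (Polynomial.X + (P + L + 1))
  have hlist : ∀ k (l : List TrapTy.denote), l.length ≤ A.q.eval k →
      (∀ e ∈ l, TrapTy.size e ≤ E.eval k) → Ty.size (.list TrapTy) l ≤ L.eval k := by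
    intro k l hl he
    refine (size_list_le (σ := TrapTy) l he).trans ?_
    simp only [L, Polynomial.eval_add, Polynomial.eval_mul, Polynomial.eval_one]
    gcongr
  have hlen : ∀ {k pre a post}, unary (A.q.eval k) = pre ++ a :: post →
      pre.length < A.q.eval k := by
    intro k pre a post he
    have := congrArg List.length he
    simp only [unary, List.length_replicate, List.length_append, List.length_cons] at this
    omega
  refine PolyOn.foldE_inv ⟨P, hP⟩ (fun k y pre b => A.Reaches k y.2.1.1 b.2 b.1 ∧
    b.2.length = pre.length ∧ (∀ e ∈ b.2, TrapTy.size e ≤ E.eval k) ∧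
    A.St.size b.1 ≤ S.eval k) ?_ ⟨S + L + 1, ?_⟩ ?_ ?_
  · intro k y hy
    obtain ⟨T, t, key, pk, o, ho, hx, rfl⟩ := himage k y hy
    refine ⟨.start ⟨o, ho, rfl⟩, rfl, by simp, ?_⟩
    have h2 := hP k _ hy
    have h3 : A.St.size o.2 ≤ P.eval k := by
      refine le_trans ?_ h2
      simp only [Ty.size]; omega
    simp only [S, Polynomial.eval_add]
    omega
  · rintro k y hy pre a post he b ⟨-, h3, h4, h5⟩
    obtain ⟨T, t, key, pk, o, ho, hx, rfl⟩ := himage k y hy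
    have h6 := hlist k b.2 (h3 ▸ (hlen he).le) h4
    rw [Ty.size]
    simp only [Polynomial.eval_add, Polynomial.eval_one]
    omega
  · intro Y hY hinv
    have h2 := IsPPT.polyOn (p := (Prog.snd.comp (.comp .snd .fst)).pair ((v1.comp .fst).pair
      (Prog.snd.comp (.comp .snd .snd)))) (by simp (maxDischargeDepth := 99)) hY
    have h3 := h2.comp (q := A.query) (hA.polyOn_query h2.bdd_image ?_)
    · exact h3.letP hY (IsPPT.polyOn (by simp (maxDischargeDepth := 99) [F.prog_ppt])
        (h3.bdd_ext hY))
    · rintro k z ⟨w, hw, hz⟩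
      obtain ⟨y, hy, pre, post, he, h4, h5⟩ := hinv k w hw
      obtain ⟨T, t, key, pk, o, ho, hx, rfl⟩ := himage k y hy
      simp only [eval_pair, eval_comp, eval_fst, eval_snd, eval_v1, PMF.pure_bind,
        PMF.mem_support_pure_iff] at hz
      subst hz
      refine ⟨k, le_rfl, ?_, ?_⟩
      · rw [h4]; exact h5.1
      · exact h5.2.1 ▸ hlen he
  · rintro k y hy pre a post he b ⟨h2, h3, h4, h5⟩ b' hb'
    obtain ⟨T, t, key, pk, o, ho, hx, rfl⟩ := himage k y hy
    have hb'' := (eval_hybridStepP A F T key o.1 k b) ▸ hb'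
    obtain ⟨m, hm, hb''⟩ := (PMF.mem_support_bind_iff _ _ _).1 hb''
    obtain ⟨c, hc, hb''⟩ := (PMF.mem_support_bind_iff _ _ _).1 hb''
    have hb := (PMF.mem_support_pure_iff _ _).1 hb''
    subst hb
    have hl := hlen he
    have h6 := hlist k b.2 (h3 ▸ hl.le) h4
    refine ⟨h2.step hm c.1, by simp [h3], ?_, ?_⟩
    · intro e he'
      rcases List.mem_append.1 he' with he' | he'
      · exact h4 e he'
      · rw [List.mem_singleton.1 he']
        rw [permEnv, PMF.mem_support_map_iff] at hc
        obtain ⟨z, hz, rfl⟩ := hc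
        have h7 := (F.perm key _ (toVertex o.1 m.1)).2
        have h8 := nat_size_le_self (F.perm key _ (toVertex o.1 m.1)).val
        have h9 := hQ k _ hx
        have h10 := length_le_size (σ := .list .bool) o.1.2
        have h11 : numVertices o.1 ≤ Q.eval k := by
          refine le_trans ?_ h9
          simp only [Ty.size, numVertices] at h10 ⊢
          omega
        have h12 : TrapTy.size ((F.perm key _ (toVertex o.1 m.1)).val, z) =
            Nat.size (F.perm key _ (toVertex o.1 m.1)).val + 1 + Ty.size (.list .bool) z + 1 := rfl
        rw [h12, size_list_eq (σ := .bool) z (c := 1) fun _ _ => rfl, mem_support_randomBits hz]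
        simp only [E, Polynomial.eval_add, Polynomial.eval_mul, Polynomial.eval_ofNat,
          Polynomial.eval_X]
        omega
    · have h7 := (((hR k).2 T _ _ h2).1 (h3 ▸ hl)).size_le hm
      have h8 : A.St.size m.2 ≤ Ty.size (.prod .nat A.St) m := by rw [Ty.size]; omega
      refine h8.trans (h7.trans ?_)
      simp only [S]
      rw [Polynomial.eval_add, Polynomial.eval_comp]
      refine le_add_left (polynomial_eval_mono R ?_)
      have h9 := hP k _ hy
      have h10 : (TableTy 𝒢).size T ≤ P.eval k := by
        refine le_trans ?_ h9
        simp only [Ty.size]; omega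
      have h11 : Ty.size (.prod (TableTy 𝒢) (.list TrapTy)) (T, b.2) =
        (TableTy 𝒢).size T + Ty.size (.list TrapTy) b.2 + 1 := rfl
      rw [h11]
      simp only [Polynomial.eval_add, Polynomial.eval_X, Polynomial.eval_one]
      omega

theorem polyOn_hybridPlayP (hA : A.IsPPT) (F : KeyedPerm) {r : Prog (.list .unit) (.list .unit)}
    (hr : r.IsPPT) (hreval : ∀ k, r.eval (unary k) = PMF.pure (unary (A.q.eval k)))
    {X : ℕ → Set (Ty.prod (TableTy 𝒢) (HybridTy 𝒢 A.St)).denote} (hX : Bdd _ X)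
    (h : ∀ k, ∀ x ∈ X k, ∃ T t key pk, ∃ o ∈ (A.start.eval (unary k)).support,
      x = (T, (t, (key, (o, (unary k, pk)))))) :
    (hybridPlayP A F r).PolyOn X := by
  have h1 := polyOn_hybridLoopP hA F hr hreval hX h
  have h2 := IsPPT.polyOn (p := (v0.comp .fst).pair (v1.pair (v0.comp .snd)))
    (by simp (maxDischargeDepth := 99)) (h1.bdd_ext hX)
  refine h1.letP hX (h2.comp (hA.polyOn_guess h2.bdd_image ?_))
  rintro k z ⟨⟨b, x⟩, ⟨hx, hb⟩, hz⟩
  obtain ⟨T, t, key, pk, ⟨M, s⟩, ho, rfl⟩ := h k x hx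
  simp only [eval_comp, eval_pair, eval_fst, eval_snd, eval_v0, eval_v1, PMF.pure_bind,
    PMF.mem_support_pure_iff] at hz
  subst hz
  have hb' := eval_hybridLoopP A F (hreval k) T t key M s pk ▸ hb
  have := reaches_of_mem_support_interact
    (start := fun s => ∃ o ∈ (A.start.eval (unary k)).support, s = o.2) (.start ⟨_, ho, rfl⟩) hb'
  exact ⟨k, le_rfl, this.1, this.2.trans (Nat.zero_add _)⟩

theorem size_snd_le {σ τ : Ty} (x : (Ty.prod σ τ).denote) :
    τ.size x.2 ≤ Ty.size (.prod σ τ) x := by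
  rw [Ty.size]; omega

/-- `choose` is polynomial on all inputs. `guess` encrypts and runs the adversary's queries, so it
is bounded only on inputs from an honest key, an actual output of `choose` and a genuine group
element. -/
theorem hybridAdversary_isPPT (hA : A.IsPPT) (F : KeyedPerm)
    {w r : Prog (.list .unit) (.list .unit)} (hw : w.IsPPT) (hr : r.IsPPT) {W : ℕ → ℕ}
    (hweval : ∀ k, w.eval (unary k) = PMF.pure (unary (W k)))
    (hreval : ∀ k, r.eval (unary k) = PMF.pure (unary (A.q.eval k))) :
    (hybridAdversary A F w r).IsPPT := by
  let X : ℕ → Set (Ty.prod (.list .unit) (BGN.KeyTy 𝒢)).denote := fun k =>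
    {x | ∃ ks ∈ (BGN.keyGen 𝒢 k).support, x = (unary k, ks.1.toData)}
  have hX : Bdd _ X := by
    obtain ⟨P, hP⟩ := BGN.isPPT_keyGenP (𝒢 := 𝒢)
    refine ⟨2 * Polynomial.X + P.comp (2 * Polynomial.X + 1) + 2, ?_⟩
    rintro k x ⟨ks, hks, rfl⟩
    have h1 : ks.1.toData ∈ ((BGN.keyGenP 𝒢).eval (unary k)).support := by
      rw [BGN.eval_keyGenP, PMF.mem_support_map_iff]
      exact ⟨ks, hks, rfl⟩
    have h2 := (hP _).size_le h1
    rw [size_unary] at h2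
    rw [Ty.size, size_unary]
    simp only [Polynomial.eval_add, Polynomial.eval_mul, Polynomial.eval_comp,
      Polynomial.eval_ofNat, Polynomial.eval_X, Polynomial.eval_one]
    omega
  have hchoose : (hybridAdversary A F w r).choose.PolyOn X := by
    have h1 : (hybridAdversary A F w r).choose.IsPPT := by
      have hs := hA.start_isPPT
      simp (maxDischargeDepth := 99) [hybridAdversary, hw, hs]
    exact h1.polyOn hX
  -- The inputs that `guess` can receive. The challenge may be any group element, whose code is
  -- bounded by `exists_size_code_le`.
  let Y : ℕ → Set (Ty.prod (HybridTy 𝒢 A.St) 𝒢.Elt).denote := fun k =>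
    {y | ∃ ks ∈ (BGN.keyGen 𝒢 k).support, ∃ o ∈ ((hybridAdversary A F w r).choose.eval
      (unary k, ks.1.toData)).support, ∃ c : 𝒢.G ks.1.d, y = (o.2, 𝒢.code ks.1.d c)}
  have hYspec : ∀ k, ∀ y ∈ Y k, ∃ t key, ∃ o ∈ (A.start.eval (unary k)).support,
      ∃ ks ∈ (BGN.keyGen 𝒢 k).support, ∃ c : 𝒢.G ks.1.d,
        y = ((t, (key, (o, (unary k, ks.1.toData)))), 𝒢.code ks.1.d c) := by
    rintro k y ⟨ks, hks, o, ho, c, rfl⟩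
    have heval := eval_hybridAdversary_choose A F r (hweval k) ks.1.toData ▸ ho
    obtain ⟨o', ho', ho⟩ := (PMF.mem_support_bind_iff _ _ _).1 heval
    obtain ⟨key, -, ho⟩ := (PMF.mem_support_bind_iff _ _ _).1 ho
    obtain ⟨t, -, ho⟩ := (PMF.mem_support_bind_iff _ _ _).1 ho
    have heq := (PMF.mem_support_pure_iff _ _).1 ho
    subst heq
    exact ⟨t, key, o', ho', ks, hks, c, rfl⟩
  have hY : Bdd (.prod (HybridTy 𝒢 A.St) 𝒢.Elt) Y := by
    obtain ⟨P, hP⟩ := hchoose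
    obtain ⟨Q, hQ⟩ := 𝒢.exists_size_code_le
    obtain ⟨R, hR⟩ := hX
    refine ⟨P + Q.comp R + 1, ?_⟩
    rintro k y ⟨ks, hks, o, ho, c, rfl⟩
    have h1 := (hP k _ ⟨ks, hks, rfl⟩).size_le ho
    have h2 := hQ ks.1.d (BGN.valid_of_mem_support hks).isDesc c
    have h3 := hR k _ ⟨ks, hks, rfl⟩
    have h4 : 𝒢.Desc.size ks.1.d ≤ R.eval k := by
      refine le_trans ?_ h3
      simp only [Ty.size, BGN.PublicKey.toData]; omega
    have h5 := polynomial_eval_mono Q h4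
    have h6 : Ty.size (HybridTy 𝒢 A.St) o.2 ≤ P.eval k :=
      (size_snd_le (σ := .prod .nat .nat) (τ := HybridTy 𝒢 A.St) o).trans h1
    have h7 : Ty.size (.prod (HybridTy 𝒢 A.St) 𝒢.Elt) (o.2, 𝒢.code ks.1.d c) =
      Ty.size (HybridTy 𝒢 A.St) o.2 + 𝒢.Elt.size (𝒢.code ks.1.d c) + 1 := rfl
    refine h7.le.trans ?_
    simp only [Polynomial.eval_add, Polynomial.eval_comp, Polynomial.eval_one]
    omega
  have hguess : Prog.PolyOn (σ := .prod (HybridTy 𝒢 A.St) 𝒢.Elt) (τ := .bool)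
      (hybridAdversary A F w r).guess Y := by
    have h1 := IsPPT.polyOn (p := Prog.snd.pair .fst) (by simp) hY
    have h2 := h1.comp (q := hybridRowsP 𝒢 F A.St) (polyOn_hybridRowsP F h1.bdd_image ?_)
    · have b2 := h2.bdd_ext hY
      have h3 := IsPPT.polyOn (p := ((v1.comp (.comp .snd (.comp .snd (.comp .snd .snd)))).pair
        v0).pair v1) (by simp (maxDischargeDepth := 99)) b2
      refine h2.letP hY (h3.comp (polyOn_hybridPlayP hA F hr hreval h3.bdd_image ?_))
      rintro k z ⟨⟨rows, y⟩, ⟨hy, -⟩, hz⟩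
      obtain ⟨t, key, o, ho, ks, hks, c, rfl⟩ := hYspec k y hy
      simp only [eval_comp, eval_pair, eval_snd, eval_v0, eval_v1, PMF.pure_bind,
        PMF.mem_support_pure_iff] at hz
      exact ⟨_, t, key, ks.1.toData, o, ho, hz⟩
    · rintro k z ⟨y, hy, hz⟩
      obtain ⟨t, key, o, ho, ks, hks, c, rfl⟩ := hYspec k y hy
      simp only [eval_pair, eval_fst, eval_snd, PMF.pure_bind, PMF.mem_support_pure_iff] at hz
      subst hz
      exact ⟨ks.1, BGN.valid_of_mem_support hks, rfl⟩
  obtain ⟨P, hP⟩ := hchoose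
  obtain ⟨Q, hQ⟩ := hguess
  refine ⟨P + Q, fun k ks hks => ⟨runsWithin_mono (hP k _ ⟨ks, hks, rfl⟩) ?_, fun o ho c =>
    runsWithin_mono (hQ k _ ⟨ks, hks, o, ho, c, rfl⟩) ?_⟩⟩
  · rw [Polynomial.eval_add]; omega
  · rw [Polynomial.eval_add]; omega

end
end SLP

namespace SLP
noncomputable section
open Prog
variable {𝒢 : BilinearGroupGen} {A : Adversary (TableTy 𝒢) TrapTy}

/-! ## Security -/

theorem keyedGame_hybridEntry_zero (F : KeyedPerm) (m : List Bool → (M : GraphTy.denote) →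
    Fin (numVertices M) → Fin (numVertices M) → ℕ) (k : ℕ) :
    keyedGame F A (hybridEntry m 0) k = zeroGame F A k := by
  have : hybridEntry m 0 = fun _ _ _ _ => 0 := by
    funext key M p j
    exact if_neg (Nat.not_lt_zero _)
  rw [this]

/-- Entry indices are below the square of the number of vertices, so from there on a hybrid contains
the whole matrix. One `n` must serve all graphs that the adversary may choose. -/
theorem keyedGame_hybridEntry_of_le (F : KeyedPerm) (m : List Bool → (M : GraphTy.denote) →
    Fin (numVertices M) → Fin (numVertices M) → ℕ) {k n : ℕ}
    (h : ∀ o ∈ (A.start.eval (unary k)).support, numVertices o.1 * numVertices o.1 ≤ n) :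
    keyedGame F A (hybridEntry m n) k = keyedGame F A m k := by
  rw [keyedGame_eq_bind_start, keyedGame_eq_bind_start]
  refine bind_congr_support fun o ho => ?_
  have : ∀ key, hybridEntry m n key o.1 = m key o.1 := by
    intro key
    funext p j
    refine if_pos (lt_of_lt_of_le ?_ (h o ho))
    calc p.val * numVertices o.1 + j.val < (p.val + 1) * numVertices o.1 := by
          rw [add_mul, one_mul]; exact Nat.add_lt_add_left j.2 _
      _ ≤ _ := Nat.mul_le_mul_right _ p.2
  simp only [this]

theorem exists_numVertices_le (hA : A.IsPPT) : ∃ P : Polynomial ℕ, ∀ k,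
    ∀ o ∈ (A.start.eval (unary k)).support, numVertices o.1 ≤ P.eval k := by
  obtain ⟨P, hP⟩ := hA
  refine ⟨P, fun k o ho => ((hP k).1.size_le ho).trans' ?_⟩
  have := length_le_size (σ := .list .bool) o.1.2
  simp only [Ty.size, numVertices] at this ⊢
  omega

theorem Negligible.trans_le {f g : ℕ → ℝ} (hf : Negligible f) (h0 : ∀ k, 0 ≤ g k)
    (h : ∀ k, g k ≤ f k) : Negligible g := by
  refine Asymptotics.SuperpolynomialDecay.trans_eventually_abs_le hf
    (Filter.Eventually.of_forall fun k => ?_)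
  simp only [Function.comp]
  rw [abs_of_nonneg (h0 k), abs_of_nonneg ((h0 k).trans (h k))]
  exact h k

theorem negligible_keyedGame_sub_zeroGame (hBGN : BGN.SemanticallySecure 𝒢) (F : KeyedPerm)
    (hA : A.IsPPT) : Negligible fun k =>
      |prTrue (keyedGame F A (permutedEntry F) k) - prTrue (zeroGame F A k)| := by
  obtain ⟨P, hP⟩ := exists_numVertices_le hA
  -- `P * P` bounds the number of entries; the `1` makes the range of the random index nonempty.
  obtain ⟨w, hw, hweval⟩ := exists_polynomial_prog (P * P + 1)
  obtain ⟨r, hr, hreval⟩ := exists_polynomial_prog A.q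
  have := hBGN _ (hybridAdversary_isPPT hA F hw hr hweval hreval)
  -- The polynomial number of hybrids times a negligible advantage is negligible.
  have h1 := Asymptotics.SuperpolynomialDecay.polynomial_mul this
    ((P * P + 1).map (Nat.castRingHom ℝ))
  refine Negligible.trans_le h1 (fun k => abs_nonneg _) fun k => le_of_eq ?_
  have hn : 0 < (P * P + 1).eval k := by simp
  have h2 := prTrue_hybrid hn fun t => keyedGame F A (hybridEntry (permutedEntry F) t) k
  rw [keyedGame_hybridEntry_zero, keyedGame_hybridEntry_of_le] at h2
  · rw [h2, abs_mul, experiment_hybridAdversary A F (hweval k) (hreval k),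
      experiment_hybridAdversary A F (hweval k) (hreval k)]
    have h3 : Polynomial.eval (k : ℝ) ((P * P + 1).map (Nat.castRingHom ℝ)) =
        ((P * P + 1).eval k : ℕ) := by
      rw [Polynomial.eval_natCast_map]; rfl
    simp only [h3, Nat.abs_cast, if_true, Bool.false_eq_true, if_false, add_zero]
  · intro o ho
    have := hP k o ho
    simp only [Polynomial.eval_add, Polynomial.eval_mul, Polynomial.eval_one]
    exact (Nat.mul_le_mul this this).trans (Nat.le_succ _)

theorem negligible_zeroGame_sub_randomGame {F : KeyedPerm} (hF : F.IsPRP) (hA : A.IsPPT) :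
    Negligible fun k => |prTrue (zeroGame F A k) - prTrue (randomGame A k)| := by
  have := hF _ (distinguisher_isPPT hA)
  simpa only [experiment_keyed_eq, experiment_random_eq] using this

end
end SLP

theorem theorem3 (𝒢 : SLP.BilinearGroupGen) (F π : SLP.KeyedPerm) (H : SLP.GarblingHash)
    (hBGN : SLP.BGN.SemanticallySecure 𝒢) (hF : F.IsPRP) :
    (SLP.slpIII 𝒢 F π H).AdaptivelySecure (SLP.trapdoorLeakage (SLP.slpIII 𝒢 F π H)) ∧
      (SLP.slpIII 𝒢 F π H).AdaptivelySecure SLP.repetitionLeakage := by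
  refine ⟨fun A hA => ⟨SLP.echoSimulator 𝒢, SLP.echoSimulator_isPPT, ?_⟩,
    fun A hA => ⟨SLP.lazySimulator 𝒢, SLP.lazySimulator_isPPT, ?_⟩⟩
  · refine SLP.Negligible.trans_le (SLP.negligible_keyedGame_sub_zeroGame hBGN F hA)
      (fun k => abs_nonneg _) fun k => le_of_eq ?_
    exact congrArg₂ (fun p q => |SLP.prTrue p - SLP.prTrue q|) (SLP.real_eq F π H A k)
      (SLP.ideal_trapdoorLeakage_eq F π H A k)
  · refine SLP.Negligible.trans_le ((SLP.negligible_keyedGame_sub_zeroGame hBGN F hA).add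
      (SLP.negligible_zeroGame_sub_randomGame hF hA)) (fun k => abs_nonneg _) fun k => ?_
    -- Triangle inequality through `zeroGame`; both ends are exact equalities of games.
    refine le_trans (le_of_eq ?_) (abs_sub_le _ (SLP.prTrue (SLP.zeroGame F A k)) _)
    exact congrArg₂ (fun p q => |SLP.prTrue p - SLP.prTrue q|) (SLP.real_eq F π H A k)
      (SLP.ideal_repetitionLeakage_eq F π H A k)
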